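/- Consider the word RAM with unit-cost operations on words of $W$ bits (addition, subtraction, multiplication, integer division and remainder, bitwise Boolean operations, shifts, comparisons, indirect loads and stores, and conditional branching). There are a deterministic construction program, a deterministic query program and a constant $K$ such that for every constant $c$ there is a constant $C$ with the following property. Let $\tau:\mathbb{N}\to\mathbb{N}$ satisfy $\tau(n)=o\left(\frac{\log n}{\log\log n}\right)$. Then for all sufficiently large $n$ (depending on $c$ and $\tau$), every word size $W$ with $2^W\ge Kn$, and every text $T$ of length $n$ whose letters are non-negative integers smaller than $\min(n^{c},2^W)$: (i) given $T$, $n$ and $\tau=\tau(n)$, the construction program builds in time at most $Cn$ a data structure that consists of at most $C\,\frac{n\log \tau}{\log n}$ machine words; (ii) given only this data structure and indices $1\le \ell\le r\le n$ with $r-\ell+1\le\tau$, the query program returns, in time at most $C$ and without changing the memory, the length of the lexicographically smallest non-empty suffix of the fragment $T[\ell..r]$. -/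

import Mathlib

/-! ### The word RAM

Words of a machine with word size `W` are the natural numbers below `2 ^ W`. The memory is an array
of words addressed by words; in addition there are registers, of which a program uses only the
finitely many that it names. Every instruction and every test of a register costs one time unit.
A program is a fixed finite object: it depends neither on `W` nor on the input. -/

namespace WordRAM

/-- The binary operations of the machine. -/
inductive Op
  | add | sub | mul | div | mod | and | or | xor | shl | shr | lt | eq

/-- The result of an operation on two words. Arithmetic is modulo `2 ^ W`, comparisons return
`0` or `1`. -/
def Op.eval (W : ℕ) : Op → ℕ → ℕ → ℕ
  | .add, a, b => (a + b) % 2 ^ W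
  | .sub, a, b => (2 ^ W + a - b) % 2 ^ W
  | .mul, a, b => (a * b) % 2 ^ W
  | .div, a, b => a / b
  | .mod, a, b => a % b
  | .and, a, b => a &&& b
  | .or, a, b => a ||| b
  | .xor, a, b => a ^^^ b
  | .shl, a, b => (a * 2 ^ b) % 2 ^ W
  | .shr, a, b => a / 2 ^ b
  | .lt, a, b => if a < b then 1 else 0
  | .eq, a, b => if a = b then 1 else 0

/-- Elementary instructions; `d`, `a`, `b` are names of registers. -/
inductive Instr
  /-- `d := k` -/
  | const (d k : ℕ)
  /-- `d := a o b` -/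
  | op (o : Op) (d a b : ℕ)
  /-- `d := mem[a]` -/
  | load (d a : ℕ)
  /-- `mem[a] := b` -/
  | store (a b : ℕ)

/-- The contents of the registers and of the memory. -/
structure State where
  regs : ℕ → ℕ
  mem : ℕ → ℕ

/-- The effect of one elementary instruction. -/
def Instr.exec (W : ℕ) : Instr → State → State
  | .const d k, s => ⟨Function.update s.regs d (k % 2 ^ W), s.mem⟩
  | .op o d a b, s => ⟨Function.update s.regs d (o.eval W (s.regs a) (s.regs b)), s.mem⟩
  | .load d a, s => ⟨Function.update s.regs d (s.mem (s.regs a)), s.mem⟩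
  | .store a b, s => ⟨s.regs, Function.update s.mem (s.regs a) (s.regs b)⟩

/-- Programs: elementary instructions, sequencing, branching on whether the register `r` is
nonzero, and iteration as long as the register `r` is nonzero. -/
inductive Prog
  | instr (i : Instr)
  | seq (p q : Prog)
  | ite (r : ℕ) (p q : Prog)
  | while (r : ℕ) (p : Prog)

/-- `Exec W p s s' t`: on a machine with word size `W`, the program `p` started in the state `s`
halts in the state `s'` after exactly `t` time units. -/
inductive Exec (W : ℕ) : Prog → State → State → ℕ → Prop
  | instr (i : Instr) (s : State) : Exec W (.instr i) s (i.exec W s) 1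
  | seq {p q : Prog} {s₁ s₂ s₃ : State} {t u : ℕ} :
      Exec W p s₁ s₂ t → Exec W q s₂ s₃ u → Exec W (.seq p q) s₁ s₃ (t + u)
  | ite_nonzero {r : ℕ} {p q : Prog} {s s' : State} {t : ℕ} :
      s.regs r ≠ 0 → Exec W p s s' t → Exec W (.ite r p q) s s' (t + 1)
  | ite_zero {r : ℕ} {p q : Prog} {s s' : State} {t : ℕ} :
      s.regs r = 0 → Exec W q s s' t → Exec W (.ite r p q) s s' (t + 1)
  | while_zero {r : ℕ} {p : Prog} {s : State} :
      s.regs r = 0 → Exec W (.while r p) s s 1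
  | while_nonzero {r : ℕ} {p : Prog} {s₁ s₂ s₃ : State} {t u : ℕ} :
      s₁.regs r ≠ 0 → Exec W p s₁ s₂ t → Exec W (.while r p) s₂ s₃ u →
      Exec W (.while r p) s₁ s₃ (t + u + 1)

/-- Registers `0` and `1` hold `x` and `y`, all other registers hold `0`. -/
def inputRegs (x y : ℕ) : ℕ → ℕ
  | 0 => x
  | 1 => y
  | _ => 0

/-- The input of a construction algorithm: the text is stored in the first `|T|` memory cells, one
letter per cell, and the rest of the memory is `0`; registers `0` and `1` hold `|T|` and the
parameter `τ`. -/
def buildInput (T : List ℕ) (τ : ℕ) : State :=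
  ⟨inputRegs T.length τ, fun a => T.getD a 0⟩

end WordRAM

/-! ### Minimal suffixes -/

/-- The fragment `T[ℓ..r]`, positions being numbered from `1`. -/
def fragment (T : List ℕ) (ℓ r : ℕ) : List ℕ :=
  (T.take r).drop (ℓ - 1)

/-- `s` is the lexicographically smallest non-empty suffix of `v`. -/
def IsMinSuf (v s : List ℕ) : Prop :=
  s ≠ [] ∧ s <:+ v ∧ ∀ u : List ℕ, u ≠ [] → u <:+ v → s = u ∨ List.Lex (· < ·) s u

/-- `D` is a memory whose first `size` cells contain a data structure for the text `T`. The program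
`query`, given `ℓ` and `r` in the registers `0` and `1` and given these `size` cells (the rest of
the memory is arbitrary), returns in register `0` the length of the minimal suffix of `T[ℓ..r]`,
for every non-empty fragment of `T` of length at most `τ`. It takes at most `time` time units and
leaves the memory as it was. -/
def AnswersMinSuf (W : ℕ) (query : WordRAM.Prog) (D : ℕ → ℕ) (size : ℕ) (T : List ℕ)
    (τ time : ℕ) : Prop :=
  ∀ ℓ r : ℕ, 1 ≤ ℓ → ℓ ≤ r → r ≤ T.length → r - ℓ + 1 ≤ τ →
    ∀ M : ℕ → ℕ, (∀ a < size, M a = D a) →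
      ∃ (q : WordRAM.State) (t : ℕ),
        WordRAM.Exec W query ⟨WordRAM.inputRegs ℓ r, M⟩ q t ∧ t ≤ time ∧ q.mem = M ∧
        ∃ s : List ℕ, IsMinSuf (fragment T ℓ r) s ∧ q.regs 0 = s.length

/-!
Let `t ≥ τ` be a power of two with `t = O(τ)`. Cover the text by the blocks of `2 * t` letters that
start at the multiples of `t`; every fragment of length at most `τ` lies in one of them. Replacing
each letter by its rank within its block preserves the comparison of suffixes and turns a block into
an identifier of `O(τ log τ) = o(log n)` bits. Hence a table with one entry for each identifier and
each pair of places in a block has `O(√n)` entries, and even the naive comparison of suffixes fills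
it in sublinear time. The identifiers of the `n / t` blocks, packed `Θ(log n / (τ log τ))` to a
word, take `O(n log τ / log n)` words; a query unpacks one identifier and reads one entry.

The letters are smaller than `n ^ c`, so radix sort in base `n` arranges them in time `O(c * n)`.
The ranks within all blocks are found in one sweep over the sorted letters: it suffices to count,
for each block, the distinct values met so far.

The programs are written in a small language with exact arithmetic and finitely many arrays of
length `n`. A program of this language whose values and indices stay within bounds compiles to the
word RAM with the same running time.
-/

/-! ### A structured language with arrays -/

namespace ArrayLang

open WordRAM

/-- The value of an operation in exact arithmetic. -/
@[simp] def exactValue : Op → ℕ → ℕ → ℕ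
  | .add, a, b => a + b
  | .sub, a, b => a - b
  | .mul, a, b => a * b
  | .div, a, b => a / b
  | .mod, a, b => a % b
  | .and, a, b => a &&& b
  | .or, a, b => a ||| b
  | .xor, a, b => a ^^^ b
  | .shl, a, b => a * 2 ^ b
  | .shr, a, b => a / 2 ^ b
  | .lt, a, b => if a < b then 1 else 0
  | .eq, a, b => if a = b then 1 else 0

/-- A sufficient condition for the exact value to be computed modulo `N`. -/
@[simp] def Fits (N : ℕ) : Op → ℕ → ℕ → Prop
  | .add, a, b => a + b < N
  | .sub, a, b => b ≤ a ∧ a < N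
  | .mul, a, b => a * b < N
  | .shl, a, b => a * 2 ^ b < N
  | _, _, _ => True

theorem op_eval_eq_exactValue {W : ℕ} {o : Op} {a b : ℕ} (h : Fits (2 ^ W) o a b) :
    o.eval W a b = exactValue o a b := by
  cases o <;> simp only [Op.eval, exactValue, Fits] at *
  case sub => rw [Nat.add_sub_assoc h.1, Nat.add_mod_left, Nat.mod_eq_of_lt (by omega)]
  all_goals exact Nat.mod_eq_of_lt h

/-- Expressions over the variables `V` and the arrays `A`. -/
inductive Exp (V A : Type)
  | var (x : V)
  | lit (k : ℕ)
  | bin (o : Op) (a b : Exp V A)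
  | get (k : A) (i : Exp V A)

/-- Commands over the variables `V` and the arrays `A`. -/
inductive Cmd (V A : Type)
  | skip
  | asg (x : V) (e : Exp V A)
  | put (k : A) (i e : Exp V A)
  | seq (p q : Cmd V A)
  | ite (e : Exp V A) (p q : Cmd V A)
  | while (e : Exp V A) (p : Cmd V A)

infixr:30 ";;" => Cmd.seq
notation "𝐯" x:max => Exp.var x
notation "𝐥" x:max => Exp.lit x
infixl:65 "+ₑ" => Exp.bin Op.add
infixl:65 "-ₑ" => Exp.bin Op.sub
infixl:70 "*ₑ" => Exp.bin Op.mul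
infixl:70 "/ₑ" => Exp.bin Op.div
infixl:70 "%ₑ" => Exp.bin Op.mod
infixl:75 "<<ₑ" => Exp.bin Op.shl
infixl:75 ">>ₑ" => Exp.bin Op.shr
infix:62 "<ₑ" => Exp.bin Op.lt
infix:62 "=ₑ" => Exp.bin Op.eq
infix:40 "::=" => Cmd.asg

/-- The values of the variables and the contents of the arrays. -/
structure Env (V A : Type) where
  v : V → ℕ
  arr : A → ℕ → ℕ

section Semantics

variable {V A : Type}

/-- The value of an expression. -/
@[simp] def Exp.eval (s : Env V A) : Exp V A → ℕ
  | .var x => s.v x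
  | .lit k => k
  | .bin o a b => exactValue o (a.eval s) (b.eval s)
  | .get k i => s.arr k (i.eval s)

/-- The number of instructions that evaluate an expression. -/
@[simp] def Exp.cost : Exp V A → ℕ
  | .var _ => 1
  | .lit _ => 1
  | .bin _ a b => a.cost + b.cost + 1
  | .get _ i => i.cost + 2

/-- The word size of the machine and the common length of the arrays. -/
structure Dims where
  W : ℕ
  len : ℕ

/-- The number of words of the machine. -/
def Dims.words (D : Dims) : ℕ := 2 ^ D.W

/-- No operation overflows and all array accesses are within bounds. -/
@[simp] def Exp.Safe (D : Dims) (s : Env V A) : Exp V A → Prop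
  | .var _ => True
  | .lit k => k < D.words
  | .bin o a b => a.Safe D s ∧ b.Safe D s ∧ Fits D.words o (a.eval s) (b.eval s)
  | .get _ i => i.Safe D s ∧ i.eval s < D.len

/-- Assign a value to a variable. -/
def Env.set [DecidableEq V] (s : Env V A) (x : V) (a : ℕ) : Env V A :=
  ⟨Function.update s.v x a, s.arr⟩

/-- Write a value to a cell of an array. -/
def Env.write [DecidableEq A] (s : Env V A) (k : A) (i a : ℕ) : Env V A :=
  ⟨s.v, Function.update s.arr k (Function.update (s.arr k) i a)⟩

@[simp] theorem Env.set_v [DecidableEq V] (s : Env V A) (x y : V) (a : ℕ) :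
    (s.set x a).v y = if y = x then a else s.v y :=
  Function.update_apply ..

@[simp] theorem Env.set_arr [DecidableEq V] (s : Env V A) (x : V) (a : ℕ) :
    (s.set x a).arr = s.arr := rfl

@[simp] theorem Env.write_v [DecidableEq A] (s : Env V A) (k : A) (i a : ℕ) :
    (s.write k i a).v = s.v := rfl

@[simp] theorem Env.write_arr [DecidableEq A] (s : Env V A) (k l : A) (i a : ℕ) :
    (s.write k i a).arr l = if l = k then Function.update (s.arr k) i a else s.arr l :=
  Function.update_apply ..

variable [DecidableEq V] [DecidableEq A]

/-- `Eval D p s s' t`: the command `p` takes the environment `s` to `s'` in time `t`. -/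
inductive Eval (D : Dims) : Cmd V A → Env V A → Env V A → ℕ → Prop
  | skip (s : Env V A) : Eval D .skip s s 1
  | asg {s : Env V A} {x : V} {e : Exp V A} : e.Safe D s →
      Eval D (.asg x e) s (s.set x (e.eval s)) (e.cost + 1)
  | put {s : Env V A} {k : A} {i e : Exp V A} : i.Safe D s → e.Safe D s → i.eval s < D.len →
      Eval D (.put k i e) s (s.write k (i.eval s) (e.eval s)) (i.cost + e.cost + 2)
  | seq {p q : Cmd V A} {s₁ s₂ s₃ : Env V A} {t u : ℕ} :
      Eval D p s₁ s₂ t → Eval D q s₂ s₃ u → Eval D (.seq p q) s₁ s₃ (t + u)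
  | ite_nonzero {e : Exp V A} {p q : Cmd V A} {s s' : Env V A} {t : ℕ} : e.Safe D s →
      e.eval s ≠ 0 → Eval D p s s' t → Eval D (.ite e p q) s s' (e.cost + (t + 1))
  | ite_zero {e : Exp V A} {p q : Cmd V A} {s s' : Env V A} {t : ℕ} : e.Safe D s →
      e.eval s = 0 → Eval D q s s' t → Eval D (.ite e p q) s s' (e.cost + (t + 1))
  | while_zero {e : Exp V A} {p : Cmd V A} {s : Env V A} : e.Safe D s → e.eval s = 0 →
      Eval D (.while e p) s s (e.cost + 1)
  | while_nonzero {e : Exp V A} {p : Cmd V A} {s₁ s₂ s₃ : Env V A} {t u : ℕ} : e.Safe D s₁ →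
      e.eval s₁ ≠ 0 → Eval D p s₁ s₂ t → Eval D (.while e p) s₂ s₃ u →
      Eval D (.while e p) s₁ s₃ (e.cost + (t + u + 1))

end Semantics

/-! ### Compilation -/

section Compilation

variable {V A : Type} [FinEnum V] [FinEnum A]

/-- The register that holds a variable. -/
def varReg (x : V) : ℕ := FinEnum.equiv x

variable (V A) in
/-- The first of the registers for intermediate results. -/
def tempReg : ℕ := FinEnum.card V + FinEnum.card A

variable (V) in
/-- The register that holds the address of an array. -/
def baseReg (k : A) : ℕ := FinEnum.card V + FinEnum.equiv k

/-- The address of an array: array number `k` occupies the cells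
`k * len, …, k * len + len - 1`. -/
def baseAddr (D : Dims) (k : A) : ℕ := FinEnum.equiv k * D.len

/-- Instructions that leave the value of an expression in register `d` and change no register
below `d`. -/
def Exp.compile (d : ℕ) : Exp V A → Prog
  | .var x => .instr (.op .or d (varReg x) (varReg x))
  | .lit k => .instr (.const d k)
  | .bin o a b => .seq (.seq (a.compile d) (b.compile (d + 1))) (.instr (.op o d d (d + 1)))
  | .get k i => .seq (.seq (i.compile d) (.instr (.op .add d d (baseReg V k))))
      (.instr (.load d d))

/-- The word RAM program of a command. -/
def Cmd.compile : Cmd V A → Prog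
  | .skip => .instr (.const (tempReg V A) 0)
  | .asg x e => .seq (e.compile (tempReg V A))
      (.instr (.op .or (varReg x) (tempReg V A) (tempReg V A)))
  | .put k i e => .seq (.seq (.seq (i.compile (tempReg V A))
      (.instr (.op .add (tempReg V A) (tempReg V A) (baseReg V k))))
      (e.compile (tempReg V A + 1))) (.instr (.store (tempReg V A) (tempReg V A + 1)))
  | .seq p q => .seq p.compile q.compile
  | .ite e p q => .seq (e.compile (tempReg V A)) (.ite (tempReg V A) p.compile q.compile)
  | .while e p => .seq (e.compile (tempReg V A))
      (.while (tempReg V A) (.seq p.compile (e.compile (tempReg V A))))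

/-- The machine state `z` represents the environment `s`. -/
structure Represents (D : Dims) (z : State) (s : Env V A) : Prop where
  var : ∀ x, z.regs (varReg x) = s.v x
  base : ∀ k : A, z.regs (baseReg V k) = baseAddr D k
  arr : ∀ k, ∀ i < D.len, z.mem (baseAddr D k + i) = s.arr k i

theorem varReg_lt (x : V) : varReg x < FinEnum.card V := (FinEnum.equiv x).isLt

theorem varReg_injective : Function.Injective (varReg : V → ℕ) :=
  Fin.val_injective.comp FinEnum.equiv.injective

variable (A) in
theorem varReg_lt_tempReg (x : V) : varReg x < tempReg V A :=
  (varReg_lt x).trans_le (Nat.le_add_right _ _)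

variable (V) in
theorem baseReg_lt_tempReg (k : A) : baseReg V k < tempReg V A :=
  Nat.add_lt_add_left (FinEnum.equiv k).isLt _

theorem baseReg_ne_varReg (k : A) (x : V) : baseReg V k ≠ varReg x :=
  ((varReg_lt x).trans_le (Nat.le_add_right _ _)).ne'

theorem baseAddr_add_lt {D : Dims} (hD : FinEnum.card A * D.len ≤ D.words) (k : A) {i : ℕ}
    (hi : i < D.len) : baseAddr D k + i < 2 ^ D.W := by
  have : (FinEnum.equiv k + 1) * D.len ≤ FinEnum.card A * D.len :=
    Nat.mul_le_mul_right _ (FinEnum.equiv k).isLt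
  rw [baseAddr]
  rw [Dims.words] at hD
  linarith

theorem baseAddr_add_injective {D : Dims} {k l : A} {i j : ℕ} (hi : i < D.len) (hj : j < D.len)
    (h : baseAddr D k + i = baseAddr D l + j) : k = l ∧ i = j := by
  have hdiv (k : A) {i : ℕ} (hi : i < D.len) : (baseAddr D k + i) / D.len = FinEnum.equiv k := by
    rw [baseAddr, add_comm, Nat.add_mul_div_right _ _ (by omega), Nat.div_eq_of_lt hi, zero_add]
  have hkl : k = l := FinEnum.equiv.injective (Fin.ext (by rw [← hdiv k hi, h, hdiv l hj]))
  subst hkl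
  exact ⟨rfl, Nat.add_left_cancel h⟩

theorem Represents.congr {D : Dims} {z z' : State} {s : Env V A} (h : Represents D z s)
    (hr : ∀ x < tempReg V A, z'.regs x = z.regs x) (hz : z'.mem = z.mem) : Represents D z' s where
  var x := by rw [hr _ (varReg_lt_tempReg A x), h.var]
  base k := by rw [hr _ (baseReg_lt_tempReg V k), h.base]
  arr k i hi := by rw [hz, h.arr k i hi]

theorem Exp.exec_compile {D : Dims} (hD : FinEnum.card A * D.len ≤ D.words) {s : Env V A}
    (e : Exp V A) : ∀ (d : ℕ) (z : State), tempReg V A ≤ d → e.Safe D s → Represents D z s →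
      ∃ z', Exec D.W (e.compile d) z z' e.cost ∧ z'.mem = z.mem ∧ z'.regs d = e.eval s ∧
        ∀ x < d, z'.regs x = z.regs x := by
  induction e with
  | var x =>
    intro d z _ _ hz
    refine ⟨_, Exec.instr _ _, rfl, by simp [Instr.exec, Op.eval, hz.var], fun y hy => ?_⟩
    simp [Instr.exec, hy.ne]
  | lit k =>
    intro d z _ hs _
    refine ⟨_, Exec.instr _ _, rfl, ?_, fun y hy => ?_⟩
    · simpa [Instr.exec] using Nat.mod_eq_of_lt (show k < 2 ^ D.W from hs)
    simp [Instr.exec, hy.ne]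
  | bin o a b iha ihb =>
    intro d z hd hs hz
    obtain ⟨z₁, e₁, m₁, v₁, f₁⟩ := iha d z hd hs.1 hz
    obtain ⟨z₂, e₂, m₂, v₂, f₂⟩ := ihb (d + 1) z₁ (by omega) hs.2.1
      (hz.congr (fun x hx => f₁ x (by omega)) m₁)
    refine ⟨_, Exec.seq (Exec.seq e₁ e₂) (Exec.instr _ _), m₂.trans m₁, ?_, fun y hy => ?_⟩
    · simp only [Instr.exec, Function.update_self, Exp.eval]
      rw [v₂, f₂ d (by omega), v₁, op_eval_eq_exactValue hs.2.2]
    · simp only [Instr.exec, Function.update_of_ne hy.ne]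
      rw [f₂ y (by omega), f₁ y hy]
  | get k i ih =>
    intro d z hd hs hz
    obtain ⟨z₁, e₁, m₁, v₁, f₁⟩ := ih d z hd hs.1 hz
    rw [show (Exp.get k i : Exp V A).cost = i.cost + 1 + 1 from rfl]
    refine ⟨_, Exec.seq (Exec.seq e₁ (Exec.instr _ _)) (Exec.instr _ _), m₁, ?_, fun y hy => ?_⟩
    · simp only [Instr.exec, Function.update_self, Exp.eval, Op.eval]
      rw [v₁, f₁ _ ((baseReg_lt_tempReg V k).trans_le hd), hz.base k, add_comm,
        Nat.mod_eq_of_lt (baseAddr_add_lt hD k hs.2), m₁, hz.arr k _ hs.2]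
    · simp only [Instr.exec, Function.update_of_ne hy.ne]
      exact f₁ y hy

theorem Cmd.exec_compile_asg {D : Dims} (hD : FinEnum.card A * D.len ≤ D.words) {s : Env V A}
    {x : V} {e : Exp V A} (he : e.Safe D s) {z : State} (hz : Represents D z s) :
    ∃ z', Exec D.W (Cmd.asg x e).compile z z' (e.cost + 1) ∧
      Represents D z' (s.set x (e.eval s)) := by
  obtain ⟨z₁, e₁, m₁, v₁, f₁⟩ := e.exec_compile hD _ z le_rfl he hz
  refine ⟨_, Exec.seq e₁ (Exec.instr _ _), ⟨fun y => ?_, fun k => ?_, fun k i hi => ?_⟩⟩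
  · by_cases hyx : y = x
    · simp [Instr.exec, Op.eval, v₁, hyx]
    · simp [Instr.exec, hyx, varReg_injective.ne hyx, f₁ _ (varReg_lt_tempReg A y), hz.var y]
  · simp [Instr.exec, baseReg_ne_varReg, f₁ _ (baseReg_lt_tempReg V k), hz.base k]
  · simp [Instr.exec, m₁, hz.arr k i hi]

theorem Cmd.exec_compile_put {D : Dims} (hD : FinEnum.card A * D.len ≤ D.words) {s : Env V A}
    {k : A} {i e : Exp V A} (hi : i.Safe D s) (he : e.Safe D s) (hlen : i.eval s < D.len)
    {z : State} (hz : Represents D z s) :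
    ∃ z', Exec D.W (Cmd.put k i e).compile z z' (i.cost + e.cost + 2) ∧
      Represents D z' (s.write k (i.eval s) (e.eval s)) := by
  obtain ⟨z₁, e₁, m₁, v₁, f₁⟩ := i.exec_compile hD _ z le_rfl hi hz
  set z₂ := (Instr.op .add (tempReg V A) (tempReg V A) (baseReg V k)).exec D.W z₁ with hz₂
  have hr₂ : Represents D z₂ s := by
    refine hz.congr (fun x hx => ?_) m₁
    simp only [hz₂, Instr.exec, Function.update_of_ne hx.ne]
    exact f₁ x hx
  obtain ⟨z₃, e₃, m₃, v₃, f₃⟩ := e.exec_compile hD _ z₂ (Nat.le_succ _) he hr₂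
  have haddr : z₃.regs (tempReg V A) = baseAddr D k + i.eval s := by
    rw [f₃ _ (Nat.lt_succ_self _)]
    simp only [hz₂, Instr.exec, Function.update_self, Op.eval]
    rw [v₁, f₁ _ (baseReg_lt_tempReg V k), hz.base k, add_comm,
      Nat.mod_eq_of_lt (baseAddr_add_lt hD k hlen)]
  have hr₃ := hr₂.congr (fun x hx => f₃ x (by omega)) m₃
  rw [show i.cost + e.cost + 2 = i.cost + 1 + e.cost + 1 by ring]
  refine ⟨_, Exec.seq (Exec.seq (Exec.seq e₁ (Exec.instr _ _)) e₃) (Exec.instr _ _),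
    ⟨hr₃.var, hr₃.base, fun l j hj => ?_⟩⟩
  simp only [Instr.exec, haddr, v₃, Env.write_arr]
  by_cases hlk : l = k
  · subst hlk
    simp [Function.update_apply, hr₃.arr l j hj]
  · rw [Function.update_of_ne fun h => hlk (baseAddr_add_injective hj hlen h).1]
    simpa [hlk] using hr₃.arr l j hj

theorem Eval.exec_compile {D : Dims} (hD : FinEnum.card A * D.len ≤ D.words) {p : Cmd V A}
    {s s' : Env V A} {t : ℕ} (h : Eval D p s s' t) : ∀ z, Represents D z s →
      ∃ z', Exec D.W p.compile z z' t ∧ Represents D z' s' := by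
  induction h with
  | skip s =>
    intro z hz
    refine ⟨_, Exec.instr _ _, hz.congr (fun x hx => ?_) rfl⟩
    simp [Instr.exec, hx.ne]
  | asg he => exact fun z hz => Cmd.exec_compile_asg hD he hz
  | put hi he hlen => exact fun z hz => Cmd.exec_compile_put hD hi he hlen hz
  | seq _ _ ihp ihq =>
    intro z hz
    obtain ⟨z₁, e₁, h₁⟩ := ihp z hz
    obtain ⟨z₂, e₂, h₂⟩ := ihq z₁ h₁
    exact ⟨z₂, Exec.seq e₁ e₂, h₂⟩
  | @ite_nonzero e p q s s' t hs hne _ ih =>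
    intro z hz
    obtain ⟨z₁, e₁, m₁, v₁, f₁⟩ := e.exec_compile hD _ z le_rfl hs hz
    obtain ⟨z₂, e₂, h₂⟩ := ih z₁ (hz.congr f₁ m₁)
    exact ⟨z₂, Exec.seq e₁ (Exec.ite_nonzero (by rwa [v₁]) e₂), h₂⟩
  | @ite_zero e p q s s' t hs h0 _ ih =>
    intro z hz
    obtain ⟨z₁, e₁, m₁, v₁, f₁⟩ := e.exec_compile hD _ z le_rfl hs hz
    obtain ⟨z₂, e₂, h₂⟩ := ih z₁ (hz.congr f₁ m₁)
    exact ⟨z₂, Exec.seq e₁ (Exec.ite_zero (by rwa [v₁]) e₂), h₂⟩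
  | @while_zero e p s hs h0 =>
    intro z hz
    obtain ⟨z₁, e₁, m₁, v₁, f₁⟩ := e.exec_compile hD _ z le_rfl hs hz
    exact ⟨z₁, Exec.seq e₁ (Exec.while_zero (by rwa [v₁])), hz.congr f₁ m₁⟩
  | @while_nonzero e p s₁ s₂ s₃ t u hs hne _ _ ih₁ ih₂ =>
    intro z hz
    obtain ⟨z₁, e₁, m₁, v₁, f₁⟩ := e.exec_compile hD _ z le_rfl hs hz
    obtain ⟨z₂, e₂, h₂⟩ := ih₁ z₁ (hz.congr f₁ m₁)
    obtain ⟨z₃, e₃, h₃⟩ := ih₂ z₂ h₂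
    refine ⟨z₃, ?_, h₃⟩
    cases e₃ with
    | seq ea eb =>
      have := Exec.seq e₁ (Exec.while_nonzero (by rwa [v₁]) (Exec.seq e₂ ea) eb)
      rwa [add_assoc t] at this

end Compilation

/-! ### Total correctness with time -/

section Rules

variable {V A : Type}

/-- The variables that a command may change. -/
@[simp] def Cmd.vars : Cmd V A → List V
  | .skip => []
  | .asg x _ => [x]
  | .put _ _ _ => []
  | .seq p q => p.vars ++ q.vars
  | .ite _ p q => p.vars ++ q.vars
  | .while _ p => p.vars

/-- The arrays that a command may change. -/
@[simp] def Cmd.arrays : Cmd V A → List A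
  | .skip => []
  | .asg _ _ => []
  | .put k _ _ => [k]
  | .seq p q => p.arrays ++ q.arrays
  | .ite _ p q => p.arrays ++ q.arrays
  | .while _ p => p.arrays

/-- The environments agree on everything that `p` cannot change. -/
structure Frame (p : Cmd V A) (s s' : Env V A) : Prop where
  v : ∀ x, x ∉ p.vars → s'.v x = s.v x
  arr : ∀ k, k ∉ p.arrays → s'.arr k = s.arr k

theorem Frame.refl (p : Cmd V A) (s : Env V A) : Frame p s s := ⟨fun _ _ => rfl, fun _ _ => rfl⟩

theorem Frame.trans {p : Cmd V A} {s₁ s₂ s₃ : Env V A} (h : Frame p s₁ s₂) (h' : Frame p s₂ s₃) :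
    Frame p s₁ s₃ :=
  ⟨fun x hx => (h'.v x hx).trans (h.v x hx), fun x hx => (h'.arr x hx).trans (h.arr x hx)⟩

theorem Frame.of_subset {p q : Cmd V A} {s₁ s₂ : Env V A} (h : Frame p s₁ s₂)
    (hv : p.vars ⊆ q.vars) (ha : p.arrays ⊆ q.arrays) : Frame q s₁ s₂ :=
  ⟨fun x hx => h.v x fun hx' => hx (hv hx'), fun x hx => h.arr x fun hx' => hx (ha hx')⟩

variable [DecidableEq V] [DecidableEq A] {D : Dims} {s : Env V A} {Q : Env V A → ℕ → Prop}

theorem Eval.frame {p : Cmd V A} {s s' : Env V A} {t : ℕ} (h : Eval D p s s' t) :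
    Frame p s s' := by
  induction h with
  | skip => exact Frame.refl _ _
  | asg => exact ⟨fun x hx => by simp_all, fun _ _ => rfl⟩
  | put => exact ⟨fun _ _ => rfl, fun x hx => by simp_all⟩
  | seq _ _ h₁ h₂ =>
    exact (h₁.of_subset (by simp) (by simp)).trans (h₂.of_subset (by simp) (by simp))
  | ite_nonzero _ _ _ h => exact h.of_subset (by simp) (by simp)
  | ite_zero _ _ _ h => exact h.of_subset (by simp) (by simp)
  | while_zero => exact Frame.refl _ _
  | while_nonzero _ _ _ _ h₁ h₂ => exact Frame.trans (h₁.of_subset (by simp) (by simp)) h₂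

/-- `p` terminates from `s`; its final environment and its running time satisfy `Q`. -/
def Runs (D : Dims) (p : Cmd V A) (s : Env V A) (Q : Env V A → ℕ → Prop) : Prop :=
  ∃ s' t, Eval D p s s' t ∧ Q s' t

theorem Runs.mono {p : Cmd V A} {Q' : Env V A → ℕ → Prop} (h : Runs D p s Q)
    (hq : ∀ s' t, Frame p s s' → Q s' t → Q' s' t) : Runs D p s Q' := by
  obtain ⟨s', t, e, h⟩ := h
  exact ⟨s', t, e, hq s' t e.frame h⟩

@[simp] theorem runs_skip : Runs D .skip s Q ↔ Q s 1 := by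
  constructor
  · rintro ⟨_, _, ⟨⟩, h⟩; exact h
  · exact fun h => ⟨_, _, .skip _, h⟩

@[simp] theorem runs_asg {x : V} {e : Exp V A} :
    Runs D (.asg x e) s Q ↔ e.Safe D s ∧ Q (s.set x (e.eval s)) (e.cost + 1) := by
  constructor
  · rintro ⟨_, _, ⟨⟩, h⟩; exact ⟨by assumption, h⟩
  · exact fun h => ⟨_, _, .asg h.1, h.2⟩

@[simp] theorem runs_put {k : A} {i e : Exp V A} :
    Runs D (.put k i e) s Q ↔ i.Safe D s ∧ e.Safe D s ∧ i.eval s < D.len ∧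
      Q (s.write k (i.eval s) (e.eval s)) (i.cost + e.cost + 2) := by
  constructor
  · rintro ⟨_, _, ⟨⟩, h⟩; exact ⟨by assumption, by assumption, by assumption, h⟩
  · exact fun h => ⟨_, _, .put h.1 h.2.1 h.2.2.1, h.2.2.2⟩

@[simp] theorem runs_seq {p q : Cmd V A} :
    Runs D (p ;; q) s Q ↔ Runs D p s fun s' t => Runs D q s' fun s'' u => Q s'' (t + u) := by
  constructor
  · rintro ⟨_, _, e, h⟩
    cases e with
    | seq e₁ e₂ => exact ⟨_, _, e₁, _, _, e₂, h⟩
  · rintro ⟨_, _, e₁, _, _, e₂, h⟩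
    exact ⟨_, _, .seq e₁ e₂, h⟩

@[simp] theorem runs_ite {e : Exp V A} {p q : Cmd V A} :
    Runs D (.ite e p q) s Q ↔ e.Safe D s ∧
      (e.eval s ≠ 0 → Runs D p s fun s' t => Q s' (e.cost + (t + 1))) ∧
      (e.eval s = 0 → Runs D q s fun s' t => Q s' (e.cost + (t + 1))) := by
  constructor
  · rintro ⟨_, _, h, hq⟩
    cases h with
    | ite_nonzero hs hne h => exact ⟨hs, fun _ => ⟨_, _, h, hq⟩, fun h0 => absurd h0 hne⟩
    | ite_zero hs h0 h => exact ⟨hs, fun hne => absurd h0 hne, fun _ => ⟨_, _, h, hq⟩⟩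
  · rintro ⟨hs, h₁, h₂⟩
    by_cases h0 : e.eval s = 0
    · obtain ⟨_, _, h, hq⟩ := h₂ h0
      exact ⟨_, _, .ite_zero hs h0 h, hq⟩
    · obtain ⟨_, _, h, hq⟩ := h₁ h0
      exact ⟨_, _, .ite_nonzero hs h0 h, hq⟩

theorem Runs.seq {p q : Cmd V A} {Q₁ : Env V A → ℕ → Prop} (h : Runs D p s Q₁)
    (hq : ∀ s' t, Frame p s s' → Q₁ s' t → Runs D q s' fun s'' u => Q s'' (t + u)) :
    Runs D (p ;; q) s Q :=
  runs_seq.2 (h.mono hq)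

/-- The first argument of the invariant `I` bounds the number of remaining iterations. -/
theorem Runs.while {e : Exp V A} {p : Cmd V A} (I : ℕ → Env V A → Prop) {B k : ℕ} (h0 : I k s)
    (hsafe : ∀ k s', Frame p s s' → I k s' → e.Safe D s')
    (hstep : ∀ k s', Frame p s s' → I k s' → e.eval s' ≠ 0 →
      Runs D p s' fun s'' t => t ≤ B ∧ ∃ j < k, I j s'') :
    Runs D (.while e p) s fun s' t =>
      t ≤ (B + e.cost + 1) * k + e.cost + 1 ∧ e.eval s' = 0 ∧ ∃ j, I j s' := by
  suffices H : ∀ j s', Frame p s s' → I j s' → Runs D (.while e p) s' fun s'' t =>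
      t ≤ (B + e.cost + 1) * j + e.cost + 1 ∧ e.eval s'' = 0 ∧ ∃ i, I i s'' from
    H k s (Frame.refl _ _) h0
  intro j
  induction j using Nat.strong_induction_on with
  | _ j ih =>
    intro s' hf hj
    have hs := hsafe j s' hf hj
    by_cases hz : e.eval s' = 0
    · exact ⟨s', _, .while_zero hs hz, by rw [add_assoc]; exact Nat.le_add_left _ _, hz, j, hj⟩
    · obtain ⟨s₁, t₁, e₁, ht₁, i, hij, hi⟩ := hstep j s' hf hj hz
      obtain ⟨s₂, t₂, e₂, ht₂, hex⟩ := ih i hij s₁ (hf.trans e₁.frame) hi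
      refine ⟨s₂, _, .while_nonzero hs hz e₁ e₂, ?_, hex⟩
      have : (B + e.cost + 1) * (i + 1) ≤ (B + e.cost + 1) * j := Nat.mul_le_mul_left _ hij
      rw [mul_add, mul_one] at this
      omega

/-- The loop that runs `p` while `x < e`, incrementing `x` after each iteration. -/
def Cmd.for (x : V) (e : Exp V A) (p : Cmd V A) : Cmd V A :=
  .while (𝐯 x <ₑ e) (p ;; x ::= 𝐯 x +ₑ 𝐥 1)

theorem Runs.for {x : V} {e : Exp V A} {p : Cmd V A} (I : ℕ → Env V A → Prop) {B N : ℕ}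
    (hN : N < D.words) (hx : s.v x ≤ N) (h0 : I (s.v x) s)
    (he : ∀ s', Frame (.for x e p) s s' → e.Safe D s' ∧ e.eval s' = N)
    (hstep : ∀ s', Frame (.for x e p) s s' → s'.v x < N → I (s'.v x) s' → Runs D p s' fun s'' t =>
      t ≤ B ∧ s''.v x = s'.v x ∧ I (s'.v x + 1) (s''.set x (s'.v x + 1))) :
    Runs D (.for x e p) s fun s' t =>
      t ≤ (B + e.cost + 7) * (N - s.v x) + e.cost + 3 ∧ s'.v x = N ∧ I N s' := by
  have hframe {s'} (hf : Frame (p ;; x ::= 𝐯 x +ₑ 𝐥 1) s s') : Frame (.for x e p) s s' :=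
    ⟨hf.v, hf.arr⟩
  refine (Runs.while (B := B + 4)
    (fun k s' => k = N - s'.v x ∧ s'.v x ≤ N ∧ I (s'.v x) s') ⟨rfl, hx, h0⟩ ?_ ?_).mono ?_
  · rintro k s' hf -
    exact ⟨trivial, (he s' (hframe hf)).1, trivial⟩
  · rintro k s' hf ⟨rfl, -, hi⟩ hlt
    have hlt : s'.v x < N := by simpa [(he s' (hframe hf)).2] using hlt
    rw [runs_seq]
    refine (hstep s' (hframe hf) hlt hi).mono fun s'' t _ ⟨_, hx'', hi'⟩ => ?_
    simp only [runs_asg, Exp.Safe, Fits, Exp.eval, exactValue, Exp.cost, hx'', Env.set_v, if_true]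
    exact ⟨⟨trivial, by omega, by omega⟩, by omega, _, by omega, rfl, by omega, hi'⟩
  · rintro s' t hf ⟨ht, hz, _, -, hle, hi⟩
    have hge : ¬ s'.v x < N := by simpa [(he s' ⟨hf.v, hf.arr⟩).2] using hz
    have hxN : s'.v x = N := by omega
    refine ⟨ht.trans (le_of_eq ?_), hxN, hxN ▸ hi⟩
    simp only [Exp.cost]
    ring

end Rules

end ArrayLang

/-! ### Radix sort -/

/-- The stable rearrangement of `L` by increasing values `f p < n`. -/
def bucketSort (n : ℕ) (f : ℕ → ℕ) (L : List ℕ) : List ℕ :=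
  (List.range n).flatMap fun d => L.filter fun p => f p = d

theorem mem_bucketSort {n : ℕ} {f : ℕ → ℕ} {L : List ℕ} (hf : ∀ p ∈ L, f p < n) {p : ℕ} :
    p ∈ bucketSort n f L ↔ p ∈ L := by
  simp only [bucketSort, List.mem_flatMap, List.mem_range, List.mem_filter, decide_eq_true_eq]
  exact ⟨fun ⟨_, _, h, _⟩ => h, fun h => ⟨f p, hf p h, h, rfl⟩⟩

theorem nodup_bucketSort {n : ℕ} {f : ℕ → ℕ} {L : List ℕ} (h : L.Nodup) :
    (bucketSort n f L).Nodup := by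
  rw [bucketSort, List.nodup_flatMap]
  refine ⟨fun d _ => h.filter _, List.nodup_range.imp fun {a b} hab => ?_⟩
  simp only [Function.onFun, List.disjoint_left, List.mem_filter, decide_eq_true_eq]
  rintro p ⟨_, ha⟩ ⟨_, hb⟩
  exact hab (ha.symm.trans hb)

theorem perm_bucketSort {n : ℕ} {f : ℕ → ℕ} {L : List ℕ} (h : L.Nodup) (hf : ∀ p ∈ L, f p < n) :
    (bucketSort n f L).Perm L :=
  (List.perm_ext_iff_of_nodup (nodup_bucketSort h) h).2 fun _ => mem_bucketSort hf

theorem pairwise_bucketSort {n d : ℕ} {f : ℕ → ℕ} {L : List ℕ} (hd : 0 < d)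
    (h : L.Pairwise fun p q => f p % d ≤ f q % d) :
    (bucketSort n (fun p => f p / d % n) L).Pairwise
      fun p q => f p % (d * n) ≤ f q % (d * n) := by
  simp only [bucketSort, List.pairwise_flatMap, Nat.mod_mul]
  constructor
  · intro b _
    refine List.pairwise_filter.2 (h.imp fun {p q} hpq hp hq => ?_)
    rw [decide_eq_true_eq] at hp hq
    rw [hp, hq]
    exact Nat.add_le_add_right hpq _
  · refine List.pairwise_lt_range.imp fun {a b} hab p hp q hq => ?_
    simp only [List.mem_filter, decide_eq_true_eq] at hp hq
    rw [hp.2, hq.2]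
    have hlt := Nat.mod_lt (f p) hd
    have hle : d * (a + 1) ≤ d * b := Nat.mul_le_mul_left _ hab
    rw [mul_add, mul_one] at hle
    omega

/-- The list `l` is stored as a linked list with first element `h - 1`; `h = 0` marks its end. -/
def Chain (next : ℕ → ℕ) : ℕ → List ℕ → Prop
  | h, [] => h = 0
  | h, p :: l => h = p + 1 ∧ Chain next (next p) l

theorem Chain.congr {next next' : ℕ → ℕ} {l : List ℕ} : ∀ {h : ℕ}, Chain next h l →
    (∀ p ∈ l, next' p = next p) → Chain next' h l := by
  induction l with
  | nil => exact fun h _ => h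
  | cons p l ih =>
    intro h hc hn
    refine ⟨hc.1, ?_⟩
    rw [hn p (by simp)]
    exact ih hc.2 fun q hq => hn q (by simp [hq])

theorem Chain.push {head next : ℕ → ℕ} {bucket : ℕ → List ℕ} {p b i : ℕ}
    (hp : p ∉ bucket i) (h : Chain next (head i) (bucket i)) :
    Chain (Function.update next p (head b)) (Function.update head b (p + 1) i)
      (if b = i then p :: bucket i else bucket i) := by
  have hi : Chain (Function.update next p (head b)) (head i) (bucket i) :=
    h.congr fun q hq => Function.update_of_ne (ne_of_mem_of_not_mem hq hp) _ _
  split_ifs with hb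
  · subst hb
    exact ⟨Function.update_self .., by rwa [Function.update_self]⟩
  · rwa [Function.update_of_ne (Ne.symm hb)]

/-- The sequence `a` starts with the elements of `L`. -/
def StartsWith (a : ℕ → ℕ) (L : List ℕ) : Prop := ∀ (i : ℕ) (h : i < L.length), a i = L[i]

theorem StartsWith.concat {a : ℕ → ℕ} {L : List ℕ} (h : StartsWith a L) (x : ℕ) :
    StartsWith (Function.update a L.length x) (L ++ [x]) := by
  intro i hi
  rw [List.length_append, List.length_singleton] at hi
  rcases Nat.lt_succ_iff_lt_or_eq.1 hi with hi | rfl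
  · rw [Function.update_of_ne hi.ne, h i hi, List.getElem_append_left hi]
  · simp

namespace ArrayLang

/-- The variables of the construction program. The first two hold its input. -/
inductive Var
  | n | τ
  | t | w | idBits | numIds | perWord | power
  | i | p | letter | weight | rest | bucket | cursor | out
  | block | offset
  | blockLen | entry | id | first | last | best | cand | match
  | numWords | tableStart | numEntries
  deriving DecidableEq

instance : FinEnum Var :=
  FinEnum.ofNodupList
    [.n, .τ, .t, .w, .idBits, .numIds, .perWord, .power, .i, .p, .letter, .weight, .rest, .bucket,
      .cursor, .out, .block, .offset, .blockLen, .entry, .id, .first, .last, .best, .cand,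
      .match, .numWords, .tableStart, .numEntries]
    (by intro x; cases x <;> simp) (by decide)

/-- The arrays of the construction program. The array `text` is the input and the output. -/
inductive Arr
  | text | order | head | next | count | last | word
  deriving DecidableEq

instance : FinEnum Arr :=
  FinEnum.ofNodupList [.text, .order, .head, .next, .count, .last, .word]
    (by intro x; cases x <;> simp) (by decide)

/-- The text is the sequence `f` of letters, and its length is stored in the variable `n`. -/
structure HasText (D : Dims) (f : ℕ → ℕ) (s : Env Var Arr) : Prop where
  n : s.v .n = D.len
  two_le : 2 ≤ D.len
  room : 8 * D.len ≤ D.words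
  letter : ∀ p < D.len, s.arr .text p = f p
  lt : ∀ p < D.len, f p < D.words

theorem HasText.frame {D : Dims} {f : ℕ → ℕ} {p : Cmd Var Arr} {s s' : Env Var Arr}
    (h : HasText D f s) (hf : Frame p s s') (hn : .n ∉ p.vars) (ht : .text ∉ p.arrays) :
    HasText D f s' :=
  ⟨(hf.v _ hn).trans h.n, h.two_le, h.room, by rw [hf.arr _ ht]; exact h.letter, h.lt⟩

theorem HasText.set {D : Dims} {f : ℕ → ℕ} {s : Env Var Arr} (h : HasText D f s) {x : Var}
    (hx : x ≠ .n) (a : ℕ) : HasText D f (s.set x a) :=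
  ⟨by rw [Env.set_v, if_neg hx.symm, h.n], h.two_le, h.room, h.letter, h.lt⟩

/-- Put the `i`-th position of the order into the bucket of its digit. -/
def scatterBody : Cmd Var Arr :=
  .i ::= 𝐯 .i -ₑ 𝐥 1 ;;
  .p ::= .get .order (𝐯 .i) ;;
  .bucket ::= .get .text (𝐯 .p) /ₑ 𝐯 .weight %ₑ 𝐯 .n ;;
  .put .next (𝐯 .p) (.get .head (𝐯 .bucket)) ;;
  .put .head (𝐯 .bucket) (𝐯 .p +ₑ 𝐥 1)

/-- Append the next position of the current bucket to the order, or proceed to the next bucket. -/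
def collectBody : Cmd Var Arr :=
  .ite (𝐯 .cursor)
    (.p ::= 𝐯 .cursor -ₑ 𝐥 1 ;;
     .put .order (𝐯 .out) (𝐯 .p) ;;
     .out ::= 𝐯 .out +ₑ 𝐥 1 ;;
     .cursor ::= .get .next (𝐯 .p))
    (.cursor ::= .get .head (𝐯 .bucket) ;;
     .put .head (𝐯 .bucket) (𝐥 0) ;;
     .bucket ::= 𝐯 .bucket +ₑ 𝐥 1)

/-- Proceed to the next digit. -/
def nextDigitCmd : Cmd Var Arr :=
  .rest ::= 𝐯 .rest /ₑ 𝐯 .n ;; .ite (𝐯 .rest) (.weight ::= 𝐯 .weight *ₑ 𝐯 .n) .skip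

/-- One pass of the radix sort: a bucket sort by the digit of weight `weight`. -/
def passBody : Cmd Var Arr :=
  .i ::= 𝐯 .n ;;
  .while (𝐯 .i) scatterBody ;;
  .cursor ::= 𝐥 0 ;; .bucket ::= 𝐥 0 ;; .out ::= 𝐥 0 ;;
  .while (𝐯 .out <ₑ 𝐯 .n) collectBody ;;
  nextDigitCmd

/-- Initialize the order by the identity, and compute the maximum of the letters. -/
def initBody : Cmd Var Arr :=
  .put .order (𝐯 .i) (𝐯 .i) ;;
  .ite (𝐯 .rest <ₑ .get .text (𝐯 .i)) (.rest ::= .get .text (𝐯 .i)) .skip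

/-- Store in `order` the positions of the text, sorted by their letters. -/
def sortCmd : Cmd Var Arr :=
  .i ::= 𝐥 0 ;; .rest ::= 𝐥 0 ;; .for .i (𝐯 .n) initBody ;;
  .weight ::= 𝐥 1 ;; .while (𝐯 .rest) passBody

section Sorting

variable {D : Dims} {f : ℕ → ℕ} {s : Env Var Arr} {d k : ℕ} {L : List ℕ}

/-- The array `order` holds the list `L` of all positions, of which those with index at least `k`
have been distributed to the buckets of their digits of weight `d`. -/
structure Scattered (D : Dims) (f : ℕ → ℕ) (d : ℕ) (L : List ℕ) (k : ℕ) (s : Env Var Arr) :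
    Prop where
  perm : L.Perm (List.range D.len)
  order : StartsWith (s.arr .order) L
  weight : s.v .weight = d
  i : s.v .i = k
  le : k ≤ D.len
  heads : ∀ b < D.len,
    Chain (s.arr .next) (s.arr .head b) ((L.drop k).filter fun p => f p / d % D.len = b)

theorem runs_scatterBody (hT : HasText D f s) (h : Scattered D f d L (k + 1) s) :
    Runs D scatterBody s fun s' t => t ≤ 28 ∧ Scattered D f d L k s' := by
  have hkL : k < L.length := by simpa [h.perm.length_eq] using h.le
  have hp : L[k] < D.len := by simpa using h.perm.mem_iff.1 (List.getElem_mem hkL)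
  have hdrop : L.drop k = L[k] :: L.drop (k + 1) := List.drop_eq_getElem_cons hkL
  have hnot : L[k] ∉ L.drop (k + 1) := by
    have := (h.perm.nodup_iff.2 List.nodup_range).sublist (List.drop_sublist k L)
    rw [hdrop, List.nodup_cons] at this
    exact this.1
  have hlt : f L[k] / d % D.len < D.len := Nat.mod_lt _ (by omega)
  have hle := h.le
  have hroom := hT.room
  have hi : s.v .i - 1 = k := by rw [h.i, Nat.add_sub_cancel]
  simp only [scatterBody, runs_seq, runs_asg, runs_put, Exp.Safe, Exp.eval, exactValue, Fits,
    Exp.cost, Env.set_v, Env.write_v, Env.set_arr, reduceCtorEq, if_true, if_false,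
    h.order k hkL, hi, hT.letter _ hp, hT.n, h.weight, true_and, and_true, and_assoc]
  refine ⟨by omega, by rw [h.i]; omega, by rw [h.i]; omega, by omega, hp, hlt, hp, by omega,
    by omega, hlt, by simp, h.perm, h.order, h.weight, rfl, by omega, fun b hb => ?_⟩
  rw [hdrop, List.filter_cons]
  simpa using Chain.push (b := f L[k] / d % D.len)
    (bucket := fun b => (L.drop (k + 1)).filter fun p => f p / d % D.len = b)
    (fun hmem => hnot (List.mem_filter.1 hmem).1) (h.heads b hb)

theorem runs_scatter (hT : HasText D f s) (h : Scattered D f d L D.len s) :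
    Runs D (.while (𝐯 .i) scatterBody) s fun s' t =>
      t ≤ 30 * D.len + 2 ∧ Scattered D f d L 0 s' := by
  refine (Runs.while (B := 28) (Scattered D f d L) h (by simp) ?_).mono ?_
  · intro k s' hf hk hne
    obtain ⟨k, rfl⟩ := Nat.exists_eq_succ_of_ne_zero (hk.i.symm.trans_ne hne)
    exact (runs_scatterBody (hT.frame hf (by decide) (by decide)) hk).mono
      fun _ _ _ ⟨ht, hk⟩ => ⟨ht, k, Nat.lt_succ_self k, hk⟩
  · rintro s' t - ⟨ht, hz, k, hk⟩
    obtain rfl : 0 = k := hz.symm.trans hk.i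
    exact ⟨by simpa using ht, hk⟩

/-- The concatenation `done` of all previous buckets and of a part of the current one is stored in
`order`; the remaining part `cur` of the current bucket is a linked list, as are the following
buckets. -/
structure Collected (D : Dims) (bucket : ℕ → List ℕ) (done cur : List ℕ) (s : Env Var Arr) :
    Prop where
  order : StartsWith (s.arr .order) done
  out : s.v .out = done.length
  cursor : Chain (s.arr .next) (s.v .cursor) cur
  heads : ∀ b < D.len,
    Chain (s.arr .next) (s.arr .head b) (if b < s.v .bucket then [] else bucket b)
  split : done ++ cur ++ (List.range' (s.v .bucket) (D.len - s.v .bucket)).flatMap bucket =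
    (List.range D.len).flatMap bucket

theorem runs_collectBody_cons {bucket : ℕ → List ℕ} {done cur : List ℕ} {p : ℕ}
    (hT : HasText D f s) (h : Collected D bucket done (p :: cur) s) (hp : p < D.len)
    (hlt : done.length < D.len) :
    Runs D collectBody s fun s' t => t ≤ 18 ∧ s'.v .bucket = s.v .bucket ∧
      Collected D bucket (done ++ [p]) cur s' := by
  have hroom := hT.room
  have hsplit := h.split
  have hc := h.cursor
  simp only [collectBody, runs_ite, runs_seq, runs_asg, runs_put, Exp.Safe, Exp.eval, exactValue,
    Fits, Exp.cost, Env.set_v, Env.write_v, Env.set_arr, Env.write_arr, reduceCtorEq, if_true,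
    if_false, hc.1, h.out, Nat.add_sub_cancel, true_and, and_assoc]
  refine ⟨fun _ => ?_, fun h0 => absurd h0 (by simp)⟩
  refine ⟨by omega, by omega, by omega, hlt, by omega, by omega, hp, by simp, ?_⟩
  exact ⟨h.order.concat p, by simp, hc.2, h.heads, by simpa using hsplit⟩

theorem runs_collectBody_nil {bucket : ℕ → List ℕ} {done : List ℕ} (hT : HasText D f s)
    (h : Collected D bucket done [] s) (hlt : s.v .bucket < D.len) :
    Runs D collectBody s fun s' t => t ≤ 18 ∧ s'.v .bucket = s.v .bucket + 1 ∧
      s'.v .out = s.v .out ∧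
      Collected D bucket done (bucket (s.v .bucket)) s' := by
  have hroom := hT.room
  have hsplit := h.split
  have hcursor : s.v .cursor = 0 := h.cursor
  have hhead := h.heads _ hlt
  rw [if_neg (lt_irrefl _)] at hhead
  simp only [collectBody, runs_ite, runs_seq, runs_asg, runs_put, Exp.Safe, Exp.eval, exactValue,
    Fits, Exp.cost, Env.set_v, Env.write_v, Env.set_arr, Env.write_arr, reduceCtorEq, if_true,
    if_false, hcursor, true_and, and_assoc]
  refine ⟨fun h0 => absurd rfl h0, fun _ => ?_⟩
  refine ⟨hlt, by omega, hlt, by omega, by omega, by simp, h.order, h.out, hhead,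
    fun b hb => ?_, ?_⟩
  · rcases lt_trichotomy b (s.v .bucket) with hbs | rfl | hbs
    · simpa [hbs.ne, hbs, Nat.lt_succ_of_lt hbs] using h.heads b hb
    · simp [Chain]
    · simpa [hbs.ne', hbs.not_gt, show ¬ b < s.v .bucket + 1 by omega] using h.heads b hb
  · rw [← hsplit, show D.len - s.v .bucket = D.len - (s.v .bucket + 1) + 1 by omega,
      List.range'_succ]
    simp

theorem Collected.eq_of_length_le {bucket : ℕ → List ℕ} {done cur : List ℕ}
    (h : Collected D bucket done cur s)
    (hlen : ((List.range D.len).flatMap bucket).length ≤ done.length) :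
    done = (List.range D.len).flatMap bucket ∧ ∀ b < D.len, s.arr .head b = 0 := by
  have hsplit := h.split
  rw [List.append_assoc] at hsplit
  have hnil : cur ++ (List.range' (s.v .bucket) (D.len - s.v .bucket)).flatMap bucket = [] := by
    rw [← hsplit, List.length_append] at hlen
    exact List.eq_nil_of_length_eq_zero (by omega)
  refine ⟨by rw [← hsplit, hnil, List.append_nil], fun b hb => ?_⟩
  have hb' := h.heads b hb
  split_ifs at hb' with hlt
  · exact hb'
  · have hempty := List.flatMap_eq_nil_iff.1 (List.append_eq_nil_iff.1 hnil).2 b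
      (List.mem_range'_1.2 (by omega))
    rwa [hempty] at hb'

theorem runs_collect {bucket : ℕ → List ℕ} (hT : HasText D f s) (h : Collected D bucket [] [] s)
    (hperm : ((List.range D.len).flatMap bucket).Perm (List.range D.len)) :
    Runs D (.while (𝐯 .out <ₑ 𝐯 .n) collectBody) s fun s' t => t ≤ 44 * D.len + 4 ∧
      StartsWith (s'.arr .order) ((List.range D.len).flatMap bucket) ∧
      ∀ b < D.len, s'.arr .head b = 0 := by
  have hlen : ((List.range D.len).flatMap bucket).length = D.len := by
    simpa using hperm.length_eq
  refine (Runs.while (B := 18) (fun k s' => ∃ done cur,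
    k = (D.len - s'.v .bucket) + (D.len - s'.v .out) ∧ Collected D bucket done cur s')
    ⟨[], [], rfl, h⟩ (by simp) ?_).mono ?_
  · rintro k s' hf ⟨done, cur, rfl, hC⟩ hne
    have hT' := hT.frame hf (by decide) (by decide)
    have hlt : done.length < D.len := by simpa [hT'.n, hC.out] using hne
    cases cur with
    | nil =>
      have hb : s'.v .bucket < D.len := by
        by_contra hb
        have := congrArg List.length hC.split
        rw [Nat.sub_eq_zero_of_le (not_lt.1 hb), hlen] at this
        simp at this
        omega
      exact (runs_collectBody_nil hT' hC hb).mono fun s'' t _ ⟨ht, _, _, hC'⟩ =>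
        ⟨ht, _, by omega, _, _, rfl, hC'⟩
    | cons p cur =>
      have hp : p < D.len := by
        simpa using hperm.mem_iff.1 (hC.split ▸ by simp : p ∈ (List.range D.len).flatMap bucket)
      refine (runs_collectBody_cons hT' hC hp hlt).mono fun s'' t _ ⟨ht, hb', hC'⟩ =>
        ⟨ht, _, ?_, _, _, rfl, hC'⟩
      rw [hb', hC'.out, hC.out, List.length_append, List.length_singleton]
      omega
  · rintro s' t hf ⟨ht, hz, k, done, cur, -, hC⟩
    have hle : D.len ≤ done.length := by
      simpa [(hT.frame hf (by decide) (by decide)).n, hC.out] using hz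
    obtain ⟨rfl, hheads⟩ := hC.eq_of_length_le (hlen.trans_le hle)
    refine ⟨ht.trans ?_, hC.order, hheads⟩
    simp only [Exp.cost]
    have := hT.n
    omega

/-- The array `order` holds the list `L` of all positions, sorted by the `j` lowest digits of their
letters in base `D.len`. -/
structure SortedMod (D : Dims) (f : ℕ → ℕ) (j : ℕ) (L : List ℕ) (s : Env Var Arr) : Prop where
  perm : L.Perm (List.range D.len)
  order : StartsWith (s.arr .order) L
  pairwise : L.Pairwise fun p q => f p % D.len ^ j ≤ f q % D.len ^ j
  heads : ∀ b < D.len, s.arr .head b = 0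
  rest : s.v .rest = (Finset.range D.len).sup f / D.len ^ j
  weight : s.v .rest ≠ 0 → s.v .weight = D.len ^ j

theorem HasText.sup_lt (hT : HasText D f s) : (Finset.range D.len).sup f < D.words := by
  have := hT.two_le
  have := hT.room
  rw [Finset.sup_lt_iff (by rw [Nat.bot_eq_zero]; omega)]
  exact fun p hp => hT.lt p (Finset.mem_range.1 hp)

theorem runs_nextDigitCmd {j m : ℕ} (hn : s.v .n = D.len) (hm : m < D.words)
    (hr : s.v .rest = m / D.len ^ j) (hw : s.v .weight = D.len ^ j) :
    Runs D nextDigitCmd s fun s' t => t ≤ 10 ∧ s'.v .rest = m / D.len ^ (j + 1) ∧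
      (s'.v .rest ≠ 0 → s'.v .weight = D.len ^ (j + 1)) := by
  have hdiv : m / D.len ^ j / D.len = m / D.len ^ (j + 1) := by
    rw [Nat.div_div_eq_div_mul, pow_succ]
  have hfits : m / D.len ^ (j + 1) ≠ 0 → D.len ^ (j + 1) < D.words := fun h0 =>
    (not_lt.1 fun hlt => h0 (Nat.div_eq_of_lt hlt)).trans_lt hm
  simp only [nextDigitCmd, runs_seq, runs_asg, runs_ite, runs_skip, Exp.Safe, Exp.eval, exactValue,
    Fits, Exp.cost, Env.set_v, reduceCtorEq, if_true, if_false, hn, hr, hw, hdiv, ← pow_succ,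
    true_and, and_true]
  exact ⟨fun h0 => ⟨hfits h0, by simp⟩, fun h0 => ⟨by simp, fun h => absurd h0 h⟩⟩

theorem runs_passBody {j : ℕ} (hT : HasText D f s) (h : SortedMod D f j L s)
    (hne : s.v .rest ≠ 0) :
    Runs D passBody s fun s' t => t ≤ 74 * D.len + 40 ∧
      ∃ L', SortedMod D f (j + 1) L' s' := by
  have hn := hT.two_le
  have hroom := hT.room
  have hperm := (perm_bucketSort (h.perm.nodup_iff.2 List.nodup_range) fun p _ =>
    Nat.mod_lt (f p / D.len ^ j) (by omega : 0 < D.len)).trans h.perm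
  rw [passBody, runs_seq, runs_asg]
  refine ⟨trivial, ?_⟩
  have hT₀ := hT.set (x := .i) (by decide) (s.v .n)
  have hscatter : Scattered D f (D.len ^ j) L D.len (s.set .i (s.v .n)) :=
    ⟨h.perm, h.order, h.weight hne, hT.n, le_rfl, fun b hb => by
      rw [List.drop_eq_nil_of_le (by simp [h.perm.length_eq])]
      exact h.heads b hb⟩
  refine (runs_scatter hT₀ hscatter).seq fun s₁ t₁ hf₁ ⟨_, hS⟩ => ?_
  have hT₁ := ((hT₀.frame hf₁ (by decide) (by decide)).set (x := .cursor) (by decide) 0).set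
    (x := .bucket) (by decide) 0 |>.set (x := .out) (by decide) 0
  simp only [runs_seq, runs_asg, Exp.Safe, Exp.cost, Exp.eval]
  refine ⟨by omega, by omega, by omega, ?_⟩
  refine (runs_collect (bucket := fun b => L.filter fun p => f p / D.len ^ j % D.len = b) hT₁
    ⟨by simp [StartsWith], rfl, rfl, fun b hb => by simpa using hS.heads b hb,
      by simp [List.range_eq_range']⟩ hperm).mono fun s₂ t₂ hf₂ ⟨_, hO, hH⟩ => ?_
  have hrest : s₂.v .rest = (Finset.range D.len).sup f / D.len ^ j := by
    rw [hf₂.v .rest (by decide), ← h.rest]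
    simp [hf₁.v .rest (by decide)]
  have hweight : s₂.v .weight = D.len ^ j := by
    rw [hf₂.v .weight (by decide), ← hS.weight]
    simp
  refine (runs_nextDigitCmd (hT₁.frame hf₂ (by decide) (by decide)).n hT.sup_lt hrest
    hweight).mono fun s₃ t₃ hf₃ ⟨_, hr, hw⟩ => ⟨by omega, _, hperm, ?_, ?_, ?_, hr, hw⟩
  · rwa [hf₃.arr .order (by decide)]
  · rw [pow_succ]
    exact pairwise_bucketSort (Nat.pow_pos (by omega)) h.pairwise
  · rwa [hf₃.arr .head (by decide)]

theorem runs_initLoop (hT : HasText D f s) (hi : s.v .i = 0) (hr : s.v .rest = 0) :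
    Runs D (.for .i (𝐯 .n) initBody) s fun s' t => t ≤ 27 * D.len + 4 ∧
      (∀ i < D.len, s'.arr .order i = i) ∧ s'.v .rest = (Finset.range D.len).sup f := by
  have hroom := hT.room
  have hn := hT.two_le
  refine (Runs.for (B := 15) (N := D.len) (fun i s' => (∀ k < i, s'.arr .order k = k) ∧
    s'.v .rest = (Finset.range i).sup f) (by omega) (by omega) (by simp [hi, hr]) ?_ ?_).mono ?_
  · exact fun s' hf => ⟨trivial, (hT.frame hf (by decide) (by decide)).n⟩
  · intro s' hf hlt ⟨hO, hM⟩
    have hT' := hT.frame hf (by decide) (by decide)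
    have hO' : ∀ k < s'.v .i + 1,
        Function.update (s'.arr .order) (s'.v .i) (s'.v .i) k = k := by
      intro k hk
      rcases Nat.lt_succ_iff_lt_or_eq.1 hk with hk | rfl
      · rw [Function.update_of_ne hk.ne, hO k hk]
      · rw [Function.update_self]
    have hsup : (Finset.range (s'.v .i + 1)).sup f = max (f (s'.v .i)) (s'.v .rest) := by
      rw [Finset.range_add_one, Finset.sup_insert, hM]
    simp only [initBody, runs_seq, runs_put, runs_ite, runs_asg, runs_skip, Exp.Safe, Exp.eval,
      exactValue, Fits, Exp.cost, Env.set_v, Env.write_v, Env.set_arr, Env.write_arr, reduceCtorEq,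
      if_true, if_false, hT'.letter _ hlt, hsup, true_and, and_true]
    refine ⟨hlt, hlt, fun h1 => ⟨hlt, by simp, hO', (max_eq_left ?_).symm⟩,
      fun h0 => ⟨by simp, hO', (max_eq_right ?_).symm⟩⟩
    · exact le_of_lt (by simpa using h1)
    · simpa using h0
  · rintro s' t - ⟨ht, -, hO, hM⟩
    refine ⟨ht.trans ?_, hO, hM⟩
    simp only [hi, Exp.cost]
    omega

theorem runs_sortCmd (hT : HasText D f s) {c : ℕ} (hc : ∀ p < D.len, f p < D.len ^ c)
    (hH : ∀ b < D.len, s.arr .head b = 0) :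
    Runs D sortCmd s fun s' t => t ≤ 200 * (c + 1) * D.len ∧
      ∃ L : List ℕ, L.Perm (List.range D.len) ∧ StartsWith (s'.arr .order) L ∧
        L.Pairwise fun p q => f p ≤ f q := by
  have hroom := hT.room
  have hn := hT.two_le
  simp only [sortCmd, runs_seq, runs_asg, Exp.Safe, Exp.cost, Exp.eval]
  refine ⟨by omega, by omega, ?_⟩
  have hT₀ := (hT.set (x := .i) (by decide) 0).set (x := .rest) (by decide) 0
  refine (runs_initLoop hT₀ (by simp) (by simp)).mono fun s₁ t₁ hf₁ ⟨_, hO, hM⟩ => ?_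
  refine ⟨by omega, ?_⟩
  have hT₁ := (hT₀.frame hf₁ (by decide) (by decide)).set (x := .weight) (by decide) 1
  have hsup : (Finset.range D.len).sup f < D.len ^ c := by
    rw [Finset.sup_lt_iff (Nat.pow_pos (by omega))]
    exact fun p hp => hc p (Finset.mem_range.1 hp)
  have hsorted : SortedMod D f 0 (List.range D.len) (s₁.set .weight 1) :=
    ⟨.refl _, fun i hi => by simpa using hO i (by simpa using hi),
      by simp [Nat.mod_one, List.pairwise_of_forall],
      fun b hb => by simp [hf₁.arr .head (by decide), hH b hb], by simpa using hM, by simp⟩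
  refine (Runs.while (B := 74 * D.len + 40) (fun k s' => ∃ j L, k = c - j ∧ SortedMod D f j L s')
    ⟨0, _, rfl, hsorted⟩ (by simp) ?_).mono ?_
  · rintro k s' hf ⟨j, L, rfl, hL⟩ hne
    refine (runs_passBody (hT₁.frame hf (by decide) (by decide)) hL hne).mono
      fun s'' t _ ⟨ht, L', hL'⟩ => ⟨ht, _, ?_, j + 1, L', rfl, hL'⟩
    by_contra hcj
    have hle : D.len ^ c ≤ D.len ^ j := Nat.pow_le_pow_right (by omega) (by omega)
    exact hne (hL.rest.trans (Nat.div_eq_of_lt (by omega)))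
  · rintro s' t - ⟨ht, hz, _, j, L, -, hL⟩
    refine ⟨?_, L, hL.perm, hL.order, ?_⟩
    · simp only [Exp.cost, Nat.sub_zero] at ht
      nlinarith [Nat.mul_le_mul_left c hn]
    · have hlt {p} (hp : p ∈ L) : f p < D.len ^ j := by
        have hle : f p ≤ (Finset.range D.len).sup f :=
          Finset.le_sup (Finset.mem_range.2 (List.mem_range.1 (hL.perm.mem_iff.1 hp)))
        exact hle.trans_lt (Nat.lt_of_div_eq_zero (Nat.pow_pos (by omega)) (hL.rest.symm.trans hz))
      exact hL.pairwise.imp_of_mem fun hp hq h => by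
        rwa [Nat.mod_eq_of_lt (hlt hp), Nat.mod_eq_of_lt (hlt hq)] at h

end Sorting

end ArrayLang

/-! ### Packed digits and ranks within groups -/

/-- The number with the digits `a s, …, a (s + l - 1)` in base `B`, the least significant one
first. -/
def digitWord (B : ℕ) (a : ℕ → ℕ) (s l : ℕ) : ℕ := ∑ k ∈ Finset.range l, a (s + k) * B ^ k

section DigitWord

variable {B : ℕ} {a : ℕ → ℕ} {s k l : ℕ}

theorem digitWord_add : digitWord B a s (k + l) =
    digitWord B a s k + B ^ k * digitWord B a (s + k) l := by
  simp only [digitWord, Finset.sum_range_add, Finset.mul_sum, pow_add, add_assoc, mul_left_comm]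

@[simp] theorem digitWord_one : digitWord B a s 1 = a s := by simp [digitWord]

theorem digitWord_lt (h : ∀ i, a i < B) : digitWord B a s l < B ^ l := by
  induction l with
  | zero => simp [digitWord]
  | succ l ih =>
    rw [digitWord_add, digitWord_one, pow_succ]
    have hle : B ^ l * (a (s + l) + 1) ≤ B ^ l * B := Nat.mul_le_mul_left _ (h _)
    rw [mul_add, mul_one] at hle
    omega

theorem digitWord_div_pow_mod_pow (h : ∀ i, a i < B) {j : ℕ} (hkj : k + j ≤ l) :
    digitWord B a s l / B ^ k % B ^ j = digitWord B a (s + k) j := by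
  obtain ⟨r, rfl⟩ := Nat.exists_eq_add_of_le hkj
  have hB : 0 < B := (Nat.zero_le _).trans_lt (h 0)
  rw [add_assoc, digitWord_add, Nat.add_mul_div_left _ _ (pow_pos hB k),
    Nat.div_eq_of_lt (digitWord_lt h), zero_add, digitWord_add, Nat.add_mul_mod_self_left,
    Nat.mod_eq_of_lt (digitWord_lt h)]

theorem digitWord_update (hk : k < l) (ha : a (s + k) = 0) (x : ℕ) :
    digitWord B (Function.update a (s + k) x) s l = digitWord B a s l + x * B ^ k := by
  have hterm (i : ℕ) : Function.update a (s + k) x (s + i) * B ^ i =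
      a (s + i) * B ^ i + if i = k then x * B ^ k else 0 := by
    rcases eq_or_ne i k with rfl | hi
    · simp [ha]
    · rw [Function.update_of_ne (by omega), if_neg hi, add_zero]
  simp only [digitWord, hterm, Finset.sum_add_distrib, Finset.sum_ite_eq', Finset.mem_range, hk,
    if_true]

theorem digitWord_congr {b : ℕ → ℕ} (h : ∀ k < l, a (s + k) = b (s + k)) :
    digitWord B a s l = digitWord B b s l :=
  Finset.sum_congr rfl fun k hk => by rw [h k (Finset.mem_range.1 hk)]

end DigitWord

/-- The indices are divided into groups of `m` consecutive ones. The rank of the index `d` is the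
number of positive values that do not exceed `h d` and that `h` takes on the group of `d`. -/
def groupRank (m : ℕ) (h : ℕ → ℕ) (d : ℕ) : ℕ :=
  (((Finset.Ico (d / m * m) (d / m * m + m)).image h) ∩ Finset.Ioc 0 (h d)).card

section GroupRank

variable {m d e : ℕ} {h : ℕ → ℕ}

theorem mem_Ico_group (hm : 0 < m) {J : ℕ} :
    d ∈ Finset.Ico (J * m) (J * m + m) ↔ d / m = J := by
  rw [Finset.mem_Ico, Nat.div_eq_iff hm]
  omega

theorem groupRank_le : groupRank m h d ≤ m :=
  calc groupRank m h d ≤ ((Finset.Ico (d / m * m) (d / m * m + m)).image h).card :=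
        Finset.card_le_card Finset.inter_subset_left
    _ ≤ m := Finset.card_image_le.trans (by simp)

theorem groupRank_eq_zero (hd : h d = 0) : groupRank m h d = 0 := by simp [groupRank, hd]

theorem groupRank_lt_groupRank_iff (hm : 0 < m) (hde : d / m = e / m) :
    groupRank m h d < groupRank m h e ↔ h d < h e := by
  have hmono {d e : ℕ} (hde : d / m = e / m) (hle : h d ≤ h e) :
      groupRank m h d ≤ groupRank m h e := by
    rw [groupRank, groupRank, hde]
    exact Finset.card_le_card
      (Finset.inter_subset_inter_left (Finset.Ioc_subset_Ioc_right hle))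
  refine ⟨fun hlt => lt_of_not_ge fun hle => hlt.not_ge (hmono hde.symm hle), fun hlt => ?_⟩
  rw [groupRank, groupRank, hde]
  refine Finset.card_lt_card (Finset.ssubset_iff_of_subset
    (Finset.inter_subset_inter_left (Finset.Ioc_subset_Ioc_right hlt.le)) |>.2 ⟨h e, ?_, ?_⟩)
  · exact Finset.mem_inter.2 ⟨Finset.mem_image_of_mem h ((mem_Ico_group hm).2 rfl),
      Finset.mem_Ioc.2 ⟨by omega, le_rfl⟩⟩
  · simp [hlt]

/-- The set of the positive values of `h` on the indices in `S` that belong to the group `J`. -/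
def groupValues (m : ℕ) (h : ℕ → ℕ) (S : Finset ℕ) (J : ℕ) : Finset ℕ :=
  ((S.filter fun e => e / m = J).image h).erase 0

/-- The greatest value of `h` on the indices in `S` that belong to the group `J`. -/
def groupMax (m : ℕ) (h : ℕ → ℕ) (S : Finset ℕ) (J : ℕ) : ℕ :=
  (S.filter fun e => e / m = J).sup h

variable {S : Finset ℕ}

theorem groupMax_insert (hd : ∀ e ∈ S, h e ≤ h d) :
    groupMax m h (insert d S) = Function.update (groupMax m h S) (d / m) (h d) := by
  ext J
  rcases eq_or_ne J (d / m) with rfl | hJ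
  · rw [Function.update_self, groupMax, Finset.filter_insert, if_pos rfl, Finset.sup_insert]
    exact max_eq_left (Finset.sup_le fun e he => hd e (Finset.mem_filter.1 he).1)
  · rw [Function.update_of_ne hJ, groupMax, Finset.filter_insert, if_neg hJ.symm, groupMax]

theorem card_groupValues_insert (hd : ∀ e ∈ S, h e ≤ h d) :
    (groupValues m h (insert d S) (d / m)).card =
      (groupValues m h S (d / m)).card + if groupMax m h S (d / m) = h d then 0 else 1 := by
  set P := S.filter fun e => e / m = d / m
  have hins : groupValues m h (insert d S) (d / m) = (insert (h d) (P.image h)).erase 0 := by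
    rw [groupValues, Finset.filter_insert, if_pos rfl, Finset.image_insert]
  have hmax : groupMax m h S (d / m) = P.sup h := rfl
  rw [hins, hmax, show groupValues m h S (d / m) = (P.image h).erase 0 from rfl]
  split_ifs with hlast
  · rcases Nat.eq_zero_or_pos (h d) with h0 | hpos
    · rw [h0, Finset.erase_insert_eq_erase, add_zero]
    · obtain ⟨e, he, hsup⟩ := Finset.exists_mem_eq_sup P
        (Finset.nonempty_iff_ne_empty.2 fun hP0 => hpos.ne (by simpa [hP0] using hlast)) h
      rw [Finset.insert_eq_self.2 (Finset.mem_image.2 ⟨e, he, hsup.symm.trans hlast⟩), add_zero]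
  · have hlt : P.sup h < h d :=
      lt_of_le_of_ne (Finset.sup_le fun e he => hd e (Finset.mem_filter.1 he).1) hlast
    have hnot : h d ∉ P.image h := fun hmem => by
      obtain ⟨e, he, heq⟩ := Finset.mem_image.1 hmem
      exact hlt.not_ge (heq ▸ Finset.le_sup he)
    rw [Finset.erase_insert_of_ne (by omega), Finset.card_insert_of_notMem
      fun hmem => hnot (Finset.mem_of_mem_erase hmem)]

theorem groupValues_insert_of_ne {J : ℕ} (hJ : J ≠ d / m) :
    groupValues m h (insert d S) J = groupValues m h S J := by
  rw [groupValues, Finset.filter_insert, if_neg hJ.symm, groupValues]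

theorem card_groupValues_le (hm : 0 < m) {J : ℕ} : (groupValues m h S J).card ≤ m := by
  have hsub : (S.filter fun e => e / m = J) ⊆ Finset.Ico (J * m) (J * m + m) := fun e he =>
    (mem_Ico_group hm).2 (Finset.mem_filter.1 he).2
  calc (groupValues m h S J).card ≤ (S.filter fun e => e / m = J).card :=
        (Finset.card_le_card (Finset.erase_subset _ _)).trans Finset.card_image_le
    _ ≤ m := (Finset.card_le_card hsub).trans (by simp)

/-- If the indices are inserted in the order of their values, then the rank of each index is known
when it is inserted. -/
theorem card_groupValues_insert_eq_groupRank (hm : 0 < m) (hd : ∀ e ∈ S, h e ≤ h d)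
    (hS : ∀ e, 0 < h e → h e < h d → e ∈ S) :
    (groupValues m h (insert d S) (d / m)).card = groupRank m h d := by
  rw [groupRank]
  congr 1
  ext y
  simp only [groupValues, Finset.mem_erase, Finset.mem_image, Finset.mem_filter,
    Finset.mem_insert, Finset.mem_inter, Finset.mem_Ioc, mem_Ico_group hm]
  constructor
  · rintro ⟨hy, e, ⟨he, hJ⟩, rfl⟩
    refine ⟨⟨e, hJ, rfl⟩, Nat.pos_of_ne_zero hy, ?_⟩
    rcases he with rfl | he
    exacts [le_rfl, hd e he]
  · rintro ⟨⟨e, hJ, rfl⟩, hy, hle⟩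
    rcases hle.eq_or_lt with heq | hlt
    · exact ⟨hy.ne', d, ⟨.inl rfl, rfl⟩, heq.symm⟩
    · exact ⟨hy.ne', e, ⟨.inr (hS e hy hlt), hJ⟩, rfl⟩

/-- The ranks of the indices in `S`, all other ranks being replaced by `0`. -/
def partialRank (m : ℕ) (h : ℕ → ℕ) (S : Finset ℕ) (d : ℕ) : ℕ :=
  if d ∈ S then groupRank m h d else 0

theorem partialRank_le : partialRank m h S d ≤ m := by
  rw [partialRank]
  split_ifs
  exacts [groupRank_le, Nat.zero_le m]

theorem partialRank_insert : partialRank m h (insert d S) =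
    Function.update (partialRank m h S) d (groupRank m h d) := by
  ext e
  rcases eq_or_ne e d with rfl | he
  · simp [partialRank]
  · simp [partialRank, he]

end GroupRank

/-- The text is covered by overlapping blocks: block `J` consists of the `2 * t` positions from
`J * t` on. If the letters of all blocks are numbered consecutively, this is the position of the
letter number `d`. -/
def blockPos (t d : ℕ) : ℕ := d / (2 * t) * t + d % (2 * t)

theorem mul_add_div_mod {m J k : ℕ} (hk : k < m) : (J * m + k) / m = J ∧ (J * m + k) % m = k :=
  (Nat.div_mod_unique (by omega)).2 ⟨by ring, hk⟩

theorem blockPos_mul_add {t J k : ℕ} (hk : k < 2 * t) :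
    blockPos t (J * (2 * t) + k) = J * t + k := by
  rw [blockPos, (mul_add_div_mod hk).1, (mul_add_div_mod hk).2]

theorem blockPos_eq_iff {t p d : ℕ} (ht : 0 < t) : blockPos t d = p ↔
    d = p / t * (2 * t) + p % t ∨ t ≤ p ∧ d = (p / t - 1) * (2 * t) + (t + p % t) := by
  have hmod : p % t < t := Nat.mod_lt _ ht
  have hp : p / t * t + p % t = p := Nat.div_add_mod' p t
  constructor
  · rintro rfl
    have hd : d = d / (2 * t) * (2 * t) + d % (2 * t) := (Nat.div_add_mod' d _).symm
    have hk : d % (2 * t) < 2 * t := Nat.mod_lt _ (by omega)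
    set J := d / (2 * t)
    set k := d % (2 * t)
    rw [hd, blockPos_mul_add hk]
    rcases lt_or_ge k t with hkt | hkt
    · rw [(mul_add_div_mod hkt).1, (mul_add_div_mod hkt).2]
      exact .inl rfl
    · have hJk : J * t + k = (J + 1) * t + (k - t) := by rw [add_mul, one_mul]; omega
      have hkt' : k - t < t := by omega
      rw [hJk, (mul_add_div_mod hkt').1, (mul_add_div_mod hkt').2, Nat.add_sub_cancel,
        Nat.add_sub_cancel' hkt, add_mul, one_mul]
      exact .inr ⟨by omega, rfl⟩
  · rintro (rfl | ⟨hle, rfl⟩)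
    · rw [blockPos_mul_add (by omega), hp]
    · obtain ⟨J, hJ⟩ := Nat.exists_eq_succ_of_ne_zero (Nat.div_pos hle ht).ne'
      rw [hJ, Nat.succ_eq_add_one, add_mul, one_mul] at hp
      rw [blockPos_mul_add (by omega), hJ, Nat.succ_eq_add_one, Nat.add_sub_cancel]
      omega

/-! ### The parameters -/

/-- The parameters of the data structure: the block length is `2 * t`, the rank of a letter occupies
`w` bits, and the ranks of `g` blocks are packed into one word. -/
structure Params (n t w g : ℕ) : Prop where
  two_le : 2 ≤ t
  pow : 2 ^ w = 4 * t
  pow_four_le : (2 ^ (2 * t * w)) ^ 4 ≤ n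
  g_pos : 1 ≤ g
  le : (2 ^ (2 * t * w)) ^ g ≤ n
  lt : n < (2 ^ (2 * t * w)) ^ (g + 1)

namespace Params

variable {n t w g : ℕ}

theorem three_le_w (h : Params n t w g) : 3 ≤ w := by
  by_contra hw
  have hpow : 2 ^ w ≤ 2 ^ 2 := Nat.pow_le_pow_right (by omega) (by omega)
  have := h.pow
  have := h.two_le
  omega

theorem bits_lt (h : Params n t w g) : 2 * t * w * g < n :=
  Nat.lt_two_pow_self.trans_le (by rw [pow_mul]; exact h.le)

theorem t_lt (h : Params n t w g) : 24 * t < n := by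
  have hbits : 2 * t * w * 4 < n :=
    Nat.lt_two_pow_self.trans_le (by rw [pow_mul]; exact h.pow_four_le)
  have := h.three_le_w
  nlinarith

theorem two_mul_lt (h : Params n t w g) : 2 * t < 2 ^ w := by
  have := h.pow
  have := h.two_le
  omega

theorem digitWord_lt (h : Params n t w g) {a : ℕ → ℕ} (ha : ∀ i, a i < 2 ^ w) (s : ℕ) :
    digitWord (2 ^ w) a s (2 * t * g) < n :=
  (_root_.digitWord_lt ha).trans_le (by
    rw [← pow_mul, show w * (2 * t * g) = 2 * t * w * g by ring, pow_mul]; exact h.le)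

end Params

namespace ArrayLang

/-- The variables hold the parameters. -/
structure HasParams (D : Dims) (t w g : ℕ) (s : Env Var Arr) : Prop where
  params : Params D.len t w g
  eq_t : s.v .t = t
  eq_w : s.v .w = w
  eq_perWord : s.v .perWord = g
  eq_idBits : s.v .idBits = 2 * t * w
  eq_numIds : s.v .numIds = 2 ^ (2 * t * w)

theorem HasParams.frame {D : Dims} {t w g : ℕ} {p : Cmd Var Arr} {s s' : Env Var Arr}
    (h : HasParams D t w g s) (hf : Frame p s s')
    (hp : ∀ x ∈ [Var.t, .w, .perWord, .idBits, .numIds], x ∉ p.vars) : HasParams D t w g s' where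
  params := h.params
  eq_t := (hf.v _ (hp _ (by simp))).trans h.eq_t
  eq_w := (hf.v _ (hp _ (by simp))).trans h.eq_w
  eq_perWord := (hf.v _ (hp _ (by simp))).trans h.eq_perWord
  eq_idBits := (hf.v _ (hp _ (by simp))).trans h.eq_idBits
  eq_numIds := (hf.v _ (hp _ (by simp))).trans h.eq_numIds

/-! ### Ranking the letters within the blocks -/

/-- Count the letter `letter` for the block `block`, unless it equals the previous one. -/
def countCmd : Cmd Var Arr :=
  .ite (.get .last (𝐯 .block) =ₑ 𝐯 .letter) .skip
    (.put .count (𝐯 .block) (.get .count (𝐯 .block) +ₑ 𝐥 1) ;;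
     .put .last (𝐯 .block) (𝐯 .letter))

/-- Add the rank of the letter number `offset` of the block `block` to the packed word. -/
def packCmd : Cmd Var Arr :=
  .put .word (𝐯 .block /ₑ 𝐯 .perWord)
    (.get .word (𝐯 .block /ₑ 𝐯 .perWord) +ₑ .get .count (𝐯 .block) <<ₑ
      (𝐯 .w *ₑ ((𝐯 .t +ₑ 𝐯 .t) *ₑ (𝐯 .block %ₑ 𝐯 .perWord) +ₑ 𝐯 .offset)))

/-- Rank the letter number `offset` of the block `block`. -/
def rankCmd : Cmd Var Arr := countCmd ;; packCmd

/-- Rank the letter once more in the previous block, of which it lies in the second half. -/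
def rankPrevCmd : Cmd Var Arr :=
  .ite (𝐯 .block) (.block ::= 𝐯 .block -ₑ 𝐥 1 ;; .offset ::= 𝐯 .t +ₑ 𝐯 .offset ;; rankCmd) .skip

/-- Find the next position `p` and its place in the block that has it in its first half. -/
def fetchCmd : Cmd Var Arr :=
  .p ::= .get .order (𝐯 .i) ;; .letter ::= .get .text (𝐯 .p) ;;
  .block ::= 𝐯 .p /ₑ 𝐯 .t ;; .offset ::= 𝐯 .p %ₑ 𝐯 .t

/-- Rank the letter of the next position in its one or two blocks. -/
def sweepBody : Cmd Var Arr := fetchCmd ;; rankCmd ;; rankPrevCmd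

/-- Store in `word` the packed ranks of the letters of all blocks. -/
def sweepCmd : Cmd Var Arr := .i ::= 𝐥 0 ;; .for .i (𝐯 .n) sweepBody

section Sweep

variable {D : Dims} {f : ℕ → ℕ} {t w g : ℕ} {s : Env Var Arr} {S : Finset ℕ} {J k : ℕ}

/-- The letters with the numbers in `S` have been ranked. -/
structure Ranked (f : ℕ → ℕ) (t w g : ℕ) (S : Finset ℕ) (s : Env Var Arr) : Prop where
  count : ∀ J, s.arr .count J = (groupValues (2 * t) (fun d => f (blockPos t d)) S J).card
  last : s.arr .last = groupMax (2 * t) (fun d => f (blockPos t d)) S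
  word : ∀ q, s.arr .word q = digitWord (2 ^ w)
    (partialRank (2 * t) (fun d => f (blockPos t d)) S) (2 * t * g * q) (2 * t * g)

theorem runs_countCmd (hJ : s.v .block < D.len) (hc : s.arr .count (s.v .block) + 1 < D.words) :
    Runs D countCmd s fun s' T => T ≤ 20 ∧
      s'.arr .count = Function.update (s.arr .count) (s.v .block) (s.arr .count (s.v .block) +
        if s.arr .last (s.v .block) = s.v .letter then 0 else 1) ∧
      s'.arr .last = Function.update (s.arr .last) (s.v .block) (s.v .letter) := by
  simp only [countCmd, runs_ite, runs_skip, runs_seq, runs_put, Exp.Safe, Exp.eval, exactValue,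
    Fits, Exp.cost, Env.write_v, Env.write_arr, reduceCtorEq, if_true, if_false, true_and, and_true]
  refine ⟨hJ, fun hne => ?_, fun h0 => ?_⟩
  · have heq : s.arr .last (s.v .block) = s.v .letter :=
      by_contra fun h => hne (if_neg h)
    refine ⟨by omega, ?_, ?_⟩
    · rw [if_pos heq, add_zero, Function.update_eq_self]
    · rw [← heq, Function.update_eq_self]
  · have hne : s.arr .last (s.v .block) ≠ s.v .letter :=
      fun h => one_ne_zero ((if_pos h).symm.trans h0)
    exact ⟨⟨hJ, by omega, hc⟩, hJ, hJ, by omega, by rw [if_neg hne]⟩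

/-- The letter number `k` of block `J` can be ranked next: all smaller letters have been ranked, and
no larger ones. -/
structure IsNext (f : ℕ → ℕ) (t : ℕ) (S : Finset ℕ) (J k : ℕ) : Prop where
  lt : k < 2 * t
  notMem : J * (2 * t) + k ∉ S
  le : ∀ e ∈ S, f (blockPos t e) ≤ f (J * t + k)
  mem : ∀ e, 0 < f (blockPos t e) → f (blockPos t e) < f (J * t + k) → e ∈ S

theorem runs_packCmd (hT : HasText D f s) (hP : HasParams D t w g s) (hJ : J < D.len)
    (hblock : s.v .block = J) (hoffset : s.v .offset = k) (hk : k < 2 * t)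
    (hadd : s.arr .word (J / g) + s.arr .count J * 2 ^ (w * (2 * t * (J % g) + k)) < D.words) :
    Runs D packCmd s fun s' T => T ≤ 40 ∧ s'.arr .word = Function.update (s.arr .word) (J / g)
      (s.arr .word (J / g) + s.arr .count J * 2 ^ (w * (2 * t * (J % g) + k))) := by
  have hroom := hT.room
  have ht := hP.params.t_lt
  have hw := hP.params.three_le_w
  have hmod : J % g < g := Nat.mod_lt _ hP.params.g_pos
  have hpos : 2 * t * (J % g) + k < 2 * t * g :=
    calc 2 * t * (J % g) + k < 2 * t * (J % g + 1) := by rw [mul_add]; omega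
      _ ≤ 2 * t * g := Nat.mul_le_mul_left _ hmod
  have hbits := hP.params.bits_lt
  have hshift : w * (2 * t * (J % g) + k) < D.len :=
    calc w * (2 * t * (J % g) + k) ≤ w * (2 * t * g) := Nat.mul_le_mul_left _ hpos.le
      _ = 2 * t * w * g := by ring
      _ < D.len := hbits
  have hpos' : 2 * t * (J % g) + k < D.len := by nlinarith
  have hword : J / g < D.len := (Nat.div_le_self _ _).trans_lt hJ
  simp only [packCmd, runs_put, Exp.Safe, Exp.eval, exactValue, Fits, Exp.cost, Env.write_arr,
    hblock, hoffset, hP.eq_t, hP.eq_w, hP.eq_perWord, ← two_mul, true_and, and_true, if_true]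
  have hcount := (Nat.le_add_left _ _).trans_lt hadd
  exact ⟨⟨hword, ⟨hJ, ⟨⟨⟨by omega, by omega⟩, by omega⟩, by omega⟩, hcount⟩, hadd⟩, hword,
    by omega⟩

theorem IsNext.card_groupValues (h : IsNext f t S J k) :
    (groupValues (2 * t) (fun d => f (blockPos t d)) (insert (J * (2 * t) + k) S) J).card =
      groupRank (2 * t) (fun d => f (blockPos t d)) (J * (2 * t) + k) := by
  have hpos : blockPos t (J * (2 * t) + k) = J * t + k := blockPos_mul_add h.lt
  have hcard := card_groupValues_insert_eq_groupRank (m := 2 * t)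
    (h := fun d => f (blockPos t d)) (d := J * (2 * t) + k) (by have := h.lt; omega)
    (by simpa only [hpos] using h.le) (by simpa only [hpos] using h.mem)
  rwa [(mul_add_div_mod h.lt).1] at hcard

theorem IsNext.digitWord_partialRank_insert (hk : IsNext f t S J k) (hg : 0 < g) (h : ℕ → ℕ) :
    digitWord (2 ^ w) (partialRank (2 * t) h (insert (J * (2 * t) + k) S)) (2 * t * g * (J / g))
        (2 * t * g) =
      digitWord (2 ^ w) (partialRank (2 * t) h S) (2 * t * g * (J / g)) (2 * t * g) +
        groupRank (2 * t) h (J * (2 * t) + k) * 2 ^ (w * (2 * t * (J % g) + k)) := by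
  have hd : J * (2 * t) + k = 2 * t * g * (J / g) + (2 * t * (J % g) + k) := by
    conv_lhs => rw [← Nat.div_add_mod J g]
    ring
  have hlt : 2 * t * (J % g) + k < 2 * t * g :=
    calc 2 * t * (J % g) + k < 2 * t * (J % g + 1) := by rw [mul_add]; have := hk.lt; omega
      _ ≤ 2 * t * g := Nat.mul_le_mul_left _ (Nat.mod_lt J hg)
  have hnot := hk.notMem
  rw [hd] at hnot ⊢
  rw [partialRank_insert, digitWord_update hlt (if_neg hnot), pow_mul]

theorem digitWord_partialRank_insert_of_ne (hk : k < 2 * t) {q : ℕ} (hq : q ≠ J / g)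
    (h : ℕ → ℕ) :
    digitWord (2 ^ w) (partialRank (2 * t) h (insert (J * (2 * t) + k) S)) (2 * t * g * q)
        (2 * t * g) =
      digitWord (2 ^ w) (partialRank (2 * t) h S) (2 * t * g * q) (2 * t * g) := by
  rw [partialRank_insert]
  refine digitWord_congr fun i hi => Function.update_of_ne (fun heq => hq ?_) _ _
  calc q = (i + 2 * t * g * q) / (2 * t * g) := by
        rw [Nat.add_mul_div_left _ _ (by omega), Nat.div_eq_of_lt hi, zero_add]
    _ = J / g := by
        rw [add_comm, heq, ← Nat.div_div_eq_div_mul, (mul_add_div_mod hk).1]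

theorem Ranked.count_add (h : Ranked f t w g S s) (hk : IsNext f t S J k) :
    (s.arr .count J + if s.arr .last J = f (J * t + k) then 0 else 1) =
      (groupValues (2 * t) (fun d => f (blockPos t d)) (insert (J * (2 * t) + k) S) J).card := by
  have hpos : blockPos t (J * (2 * t) + k) = J * t + k := blockPos_mul_add hk.lt
  have hins := card_groupValues_insert (m := 2 * t) (S := S) (h := fun d => f (blockPos t d))
    (d := J * (2 * t) + k) (by simpa only [hpos] using hk.le)
  rw [(mul_add_div_mod hk.lt).1] at hins
  rw [hins, h.count, h.last, hpos]

theorem Ranked.insert {s' : Env Var Arr} (h : Ranked f t w g S s) (hk : IsNext f t S J k)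
    (hg : 0 < g)
    (hcount : s'.arr .count = Function.update (s.arr .count) J
      (s.arr .count J + if s.arr .last J = f (J * t + k) then 0 else 1))
    (hlast : s'.arr .last = Function.update (s.arr .last) J (f (J * t + k)))
    (hword : s'.arr .word = Function.update (s.arr .word) (J / g) (s.arr .word (J / g) +
      groupRank (2 * t) (fun d => f (blockPos t d)) (J * (2 * t) + k) *
        2 ^ (w * (2 * t * (J % g) + k)))) :
    Ranked f t w g (insert (J * (2 * t) + k) S) s' := by
  have hpos : blockPos t (J * (2 * t) + k) = J * t + k := blockPos_mul_add hk.lt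
  have hdiv : (J * (2 * t) + k) / (2 * t) = J := (mul_add_div_mod hk.lt).1
  have hle : ∀ e ∈ S, f (blockPos t e) ≤ f (blockPos t (J * (2 * t) + k)) := by
    simpa only [hpos] using hk.le
  refine ⟨fun I => ?_, ?_, fun q => ?_⟩
  · rw [hcount]
    rcases eq_or_ne I J with rfl | hI
    · rw [Function.update_self, h.count_add hk]
    · rw [Function.update_of_ne hI, groupValues_insert_of_ne (by rwa [hdiv]), h.count]
  · rw [hlast, groupMax_insert (h := fun d => f (blockPos t d)) hle, hdiv, hpos, h.last]
  · rw [hword]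
    rcases eq_or_ne q (J / g) with rfl | hq
    · rw [Function.update_self, hk.digitWord_partialRank_insert hg, h.word]
    · rw [Function.update_of_ne hq, digitWord_partialRank_insert_of_ne hk.lt hq, h.word]

theorem runs_rankCmd (hT : HasText D f s) (hP : HasParams D t w g s) (h : Ranked f t w g S s)
    (hJ : J < D.len) (hk : IsNext f t S J k) (hblock : s.v .block = J) (hoffset : s.v .offset = k)
    (hletter : s.v .letter = f (J * t + k)) :
    Runs D rankCmd s fun s' T => T ≤ 60 ∧
      Ranked f t w g (insert (J * (2 * t) + k) S) s' := by
  have hroom := hT.room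
  have ht := hP.params.t_lt
  have hold : s.arr .count J ≤ 2 * t :=
    (h.count J).trans_le (card_groupValues_le (by have := hk.lt; omega))
  refine (runs_countCmd (by rwa [hblock]) (by rw [hblock]; omega)).seq
    fun s₁ T₁ hf₁ ⟨_, hcount, hlast⟩ => ?_
  rw [hblock, hletter] at hcount hlast
  have hrank : s₁.arr .count J =
      groupRank (2 * t) (fun d => f (blockPos t d)) (J * (2 * t) + k) := by
    rw [hcount, Function.update_self, h.count_add hk, hk.card_groupValues]
  have hword₁ : s₁.arr .word = s.arr .word := hf₁.arr .word (by decide)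
  have hbound := hP.params.digitWord_lt (a := partialRank (2 * t) (fun d => f (blockPos t d))
    (Insert.insert (J * (2 * t) + k) S)) (fun _ => partialRank_le.trans_lt hP.params.two_mul_lt)
    (2 * t * g * (J / g))
  rw [hk.digitWord_partialRank_insert hP.params.g_pos, ← h.word] at hbound
  refine (runs_packCmd (hT.frame hf₁ (by decide) (by decide)) (hP.frame hf₁ (by decide)) hJ
    ((hf₁.v .block (by decide)).trans hblock) ((hf₁.v .offset (by decide)).trans hoffset) hk.lt
    (by rw [hword₁, hrank]; omega)).mono fun s₂ T₂ hf₂ ⟨_, hword⟩ => ⟨by omega, ?_⟩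
  refine h.insert hk hP.params.g_pos ?_ ?_ ?_
  · rw [hf₂.arr .count (by decide), hcount]
  · rw [hf₂.arr .last (by decide), hlast]
  · rw [hword, hrank, hword₁]

/-- The ranks of the letters at the first `i` positions of the order `L` have been computed. -/
def SweptUpTo (f : ℕ → ℕ) (t w g : ℕ) (L : List ℕ) (i : ℕ) (s : Env Var Arr) : Prop :=
  ∃ S : Finset ℕ, (∀ d, d ∈ S ↔ blockPos t d ∈ L.take i) ∧ Ranked f t w g S s

theorem Ranked.frame {p : Cmd Var Arr} {s' : Env Var Arr} (h : Ranked f t w g S s)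
    (hf : Frame p s s') (hp : ∀ k ∈ [Arr.count, .last, .word], k ∉ p.arrays) :
    Ranked f t w g S s' where
  count J := by rw [hf.arr _ (hp _ (by simp)), h.count]
  last := by rw [hf.arr _ (hp _ (by simp)), h.last]
  word q := by rw [hf.arr _ (hp _ (by simp)), h.word]

theorem getElem_notMem_take {L : List ℕ} {i : ℕ} (hL : L.Nodup) (hi : i < L.length) :
    L[i] ∉ L.take i := fun hmem => by
  obtain ⟨j, hj, heq⟩ := List.mem_take_iff_getElem.1 hmem
  have := hL.getElem_inj_iff.1 heq
  omega

theorem isNext_of_sorted {L : List ℕ} {n i : ℕ} (hL : L.Perm (List.range n))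
    (hsort : L.Pairwise fun p q => f p ≤ f q) (hf0 : ∀ p, n ≤ p → f p = 0) (hi : i < L.length)
    (hpos : J * t + k = L[i]) (hk : k < 2 * t) (hnot : J * (2 * t) + k ∉ S)
    (hle : ∀ e ∈ S, blockPos t e ∈ L.take (i + 1)) (hge : ∀ e, blockPos t e ∈ L.take i → e ∈ S) :
    IsNext f t S J k := by
  rw [List.pairwise_iff_getElem] at hsort
  refine ⟨hk, hnot, fun e he => ?_, fun e hpos_e hlt => hge e ?_⟩
  · obtain ⟨j, hj, heq⟩ := List.mem_take_iff_getElem.1 (hle e he)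
    rw [← heq, hpos]
    rcases (show j ≤ i by omega).eq_or_lt with rfl | hji
    · exact le_rfl
    · exact hsort j i (by omega) hi hji
  · have hmem : blockPos t e ∈ L := by
      rw [hL.mem_iff, List.mem_range]
      exact not_le.1 fun h => hpos_e.ne' (hf0 _ h)
    obtain ⟨j, hj, heq⟩ := List.getElem_of_mem hmem
    rw [← heq, hpos] at hlt
    have hji : j < i := by
      rcases lt_trichotomy j i with h | rfl | h
      · exact h
      · exact absurd hlt (lt_irrefl _)
      · exact absurd (hsort i j hi hj h) (not_le.2 hlt)
    exact List.mem_take_iff_getElem.2 ⟨j, by omega, heq⟩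

theorem runs_rankPrevCmd {p : ℕ} (hT : HasText D f s) (hP : HasParams D t w g s)
    (hR : Ranked f t w g S s) (hp : p < D.len) (hblock : s.v .block = p / t)
    (hoffset : s.v .offset = p % t) (hletter : s.v .letter = f p)
    (hnext : t ≤ p → IsNext f t S (p / t - 1) (t + p % t)) :
    Runs D rankPrevCmd s fun s' T => T ≤ 80 ∧ ∃ S' : Finset ℕ,
      (∀ d, d ∈ S' ↔ d ∈ S ∨ t ≤ p ∧ d = (p / t - 1) * (2 * t) + (t + p % t)) ∧
      Ranked f t w g S' s' := by
  have hroom := hT.room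
  have _ := hP.params.t_lt
  have htwo := hP.params.two_le
  have hdiv : p / t < D.len := (Nat.div_le_self _ _).trans_lt hp
  have _ : p % t < t := Nat.mod_lt _ (by omega)
  have hle : t ≤ p ↔ 1 ≤ p / t := by rw [Nat.le_div_iff_mul_le (by omega), one_mul]
  simp only [rankPrevCmd, runs_ite, runs_seq, runs_asg, runs_skip, Exp.Safe, Exp.eval, exactValue,
    Fits, Exp.cost, Env.set_v, reduceCtorEq, if_false, hblock, hoffset, hP.eq_t, true_and]
  refine ⟨fun hne => ?_, fun h0 => ?_⟩
  · have htp : t ≤ p := hle.2 (by omega)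
    have hsum : (p / t - 1) * t + (t + p % t) = p := by
      rw [← add_assoc, ← add_one_mul, Nat.sub_add_cancel (hle.1 htp), Nat.div_add_mod']
    have hT' := (hT.set (x := .block) (by decide) (p / t - 1)).set (x := .offset) (by decide)
      (t + p % t)
    refine ⟨by omega, by omega, (runs_rankCmd (t := t) (w := w) (g := g) hT'
      ⟨hP.1, hP.2, hP.3, hP.4, hP.5, hP.6⟩ ⟨hR.1, hR.2, hR.3⟩ (by omega) (hnext htp)
      rfl rfl (by rw [hsum]; exact hletter)).mono ?_⟩
    rintro s' T - ⟨hT', hR'⟩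
    exact ⟨by omega, _, fun d => by rw [Finset.mem_insert, or_comm, and_iff_right htp], hR'⟩
  · exact ⟨by omega, S, fun d => by rw [hle, h0, or_iff_left (by omega)], hR⟩

theorem runs_fetchCmd {p : ℕ} (hT : HasText D f s) (hP : HasParams D t w g s)
    (hi : s.v .i < D.len) (hord : s.arr .order (s.v .i) = p) (hp : p < D.len) :
    Runs D fetchCmd s fun s' T => T ≤ 20 ∧ s'.v .block = p / t ∧ s'.v .offset = p % t ∧
      s'.v .letter = f p := by
  have _ := hT.room
  have _ := hP.params.t_lt
  have _ := hP.params.two_le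
  simp only [fetchCmd, runs_seq, runs_asg, Exp.Safe, Exp.eval, exactValue, Fits, Exp.cost,
    Env.set_v, Env.set_arr, reduceCtorEq, if_true, if_false, hi, hord, hT.letter p hp, hP.eq_t,
    true_and, and_true]
  exact ⟨hp, by omega⟩

theorem isNext_first {L : List ℕ} {n i : ℕ} (hL : L.Perm (List.range n))
    (hsort : L.Pairwise fun p q => f p ≤ f q) (hf0 : ∀ p, n ≤ p → f p = 0) (ht : 0 < t)
    (hi : i < L.length) (hS : ∀ d, d ∈ S ↔ blockPos t d ∈ L.take i) :
    IsNext f t S (L[i] / t) (L[i] % t) := by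
  have hsum : L[i] / t * t + L[i] % t = L[i] := Nat.div_add_mod' _ t
  have hmod : L[i] % t < 2 * t := by
    have := Nat.mod_lt L[i] ht
    omega
  refine isNext_of_sorted hL hsort hf0 hi hsum hmod ?_ (fun e he => ?_) fun e => (hS e).2
  · rw [hS, blockPos_mul_add hmod, hsum]
    exact getElem_notMem_take (hL.nodup_iff.2 List.nodup_range) hi
  · rw [List.take_succ_eq_append_getElem hi]
    exact List.mem_append_left _ ((hS e).1 he)

theorem isNext_second {L : List ℕ} {n i : ℕ} (hL : L.Perm (List.range n))
    (hsort : L.Pairwise fun p q => f p ≤ f q) (hf0 : ∀ p, n ≤ p → f p = 0) (ht : 0 < t)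
    (hi : i < L.length) (hS : ∀ d, d ∈ S ↔ blockPos t d ∈ L.take i) (htL : t ≤ L[i]) :
    IsNext f t (insert (L[i] / t * (2 * t) + L[i] % t) S) (L[i] / t - 1) (t + L[i] % t) := by
  have hmod : L[i] % t < t := Nat.mod_lt L[i] ht
  obtain ⟨J, hJ⟩ : ∃ J, L[i] / t = J + 1 :=
    Nat.exists_eq_add_of_le' (Nat.div_pos htL ht)
  have hsum : J * t + (t + L[i] % t) = L[i] := by
    rw [← add_assoc, ← add_one_mul, ← hJ, Nat.div_add_mod']
  rw [hJ, Nat.add_sub_cancel]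
  refine isNext_of_sorted hL hsort hf0 hi hsum (by omega) ?_ (fun e he => ?_)
    fun e he => Finset.mem_insert_of_mem ((hS e).2 he)
  · rw [Finset.mem_insert, hS, blockPos_mul_add (by omega), hsum, add_one_mul, not_or]
    exact ⟨by omega, getElem_notMem_take (hL.nodup_iff.2 List.nodup_range) hi⟩
  · rw [List.take_succ_eq_append_getElem hi, List.mem_append, List.mem_singleton]
    rcases Finset.mem_insert.1 he with rfl | he
    · rw [← hJ, blockPos_mul_add (by omega), Nat.div_add_mod']
      exact .inr rfl
    · exact .inl ((hS e).1 he)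

theorem runs_sweepBody {L : List ℕ} {i : ℕ} (hT : HasText D f s) (hP : HasParams D t w g s)
    (hf0 : ∀ p, D.len ≤ p → f p = 0) (hL : L.Perm (List.range D.len))
    (hord : StartsWith (s.arr .order) L) (hsort : L.Pairwise fun p q => f p ≤ f q)
    (hi : s.v .i = i) (hlt : i < D.len) (h : SweptUpTo f t w g L i s) :
    Runs D sweepBody s fun s' T => T ≤ 200 ∧ SweptUpTo f t w g L (i + 1) s' := by
  have ht : 0 < t := by have := hP.params.two_le; omega
  have hiL : i < L.length := by simpa [hL.length_eq] using hlt
  have hp : L[i] < D.len := by simpa [hL.mem_iff] using List.getElem_mem hiL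
  obtain ⟨S, hS, hR⟩ := h
  refine (runs_fetchCmd hT hP (by rwa [hi]) ((congrArg _ hi).trans (hord i hiL)) hp).seq
    fun s₁ T₁ hf₁ ⟨_, hblock, hoffset, hletter⟩ => ?_
  have hT₁ := hT.frame hf₁ (by decide) (by decide)
  have hP₁ := hP.frame hf₁ (by decide)
  have hR₁ := hR.frame hf₁ (by decide)
  refine (runs_rankCmd hT₁ hP₁ hR₁ ((Nat.div_le_self _ _).trans_lt hp)
    (isNext_first hL hsort hf0 ht hiL hS) hblock hoffset
    (by rwa [Nat.div_add_mod'])).seq fun s₂ T₂ hf₂ ⟨_, hR₂⟩ => ?_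
  refine (runs_rankPrevCmd (hT₁.frame hf₂ (by decide) (by decide)) (hP₁.frame hf₂ (by decide)) hR₂
    hp ((hf₂.v .block (by decide)).trans hblock) ((hf₂.v .offset (by decide)).trans hoffset)
    ((hf₂.v .letter (by decide)).trans hletter) (isNext_second hL hsort hf0 ht hiL hS)).mono
    fun s₃ T₃ _ ⟨_, S', hS', hR₃⟩ => ⟨by omega, S', fun d => ?_, hR₃⟩
  rw [hS', Finset.mem_insert, hS, List.take_succ_eq_append_getElem hiL, List.mem_append,
    List.mem_singleton, blockPos_eq_iff ht]
  tauto

theorem runs_sweepCmd {L : List ℕ} (hT : HasText D f s) (hP : HasParams D t w g s)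
    (hf0 : ∀ p, D.len ≤ p → f p = 0) (hL : L.Perm (List.range D.len))
    (hord : StartsWith (s.arr .order) L) (hsort : L.Pairwise fun p q => f p ≤ f q)
    (hcount : s.arr .count = 0) (hlast : s.arr .last = 0) (hword : s.arr .word = 0) :
    Runs D sweepCmd s fun s' T => T ≤ 220 * D.len ∧ ∀ q, s'.arr .word q =
      digitWord (2 ^ w) (groupRank (2 * t) fun d => f (blockPos t d)) (2 * t * g * q)
        (2 * t * g) := by
  have hroom := hT.room
  have hn := hT.two_le
  have hlen : L.length = D.len := by simpa using hL.length_eq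
  have hinit : SweptUpTo f t w g L 0 (s.set .i 0) := by
    refine ⟨∅, by simp, fun J => ?_, ?_, fun q => ?_⟩
    · simp [hcount, groupValues]
    · ext J
      simp [hlast, groupMax]
    · simp [hword, digitWord, partialRank]
  simp only [sweepCmd, runs_seq, runs_asg, Exp.Safe, Exp.eval, Exp.cost]
  refine ⟨by omega, (Runs.for (B := 200) (N := D.len) (SweptUpTo f t w g L) (by omega) (by simp)
    hinit ?_ ?_).mono ?_⟩
  · exact fun s' hf => ⟨trivial, (hf.v .n (by decide)).trans (by simpa using hT.n)⟩
  · intro s' hf hlt hI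
    have hP' : HasParams D t w g (s.set .i 0) := ⟨hP.1, hP.2, hP.3, hP.4, hP.5, hP.6⟩
    refine (runs_sweepBody ((hT.set (by decide) 0).frame hf (by decide) (by decide))
      (hP'.frame hf (by decide)) hf0 hL (by rw [hf.arr .order (by decide)]; exact hord) hsort rfl
      hlt hI).mono fun s'' T hf' ⟨hT', hI'⟩ => ⟨hT', hf'.v .i (by decide), ?_⟩
    obtain ⟨S, hS, hR⟩ := hI'
    exact ⟨S, hS, hR.1, hR.2, hR.3⟩
  · rintro s' T - ⟨hT', -, S, hS, hR⟩
    refine ⟨?_, fun q => ?_⟩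
    · simp only [Exp.cost, Env.set_v, if_true] at hT'
      omega
    · rw [hR.word]
      congr 1
      ext d
      rw [partialRank]
      split_ifs with hd
      · rfl
      · refine (groupRank_eq_zero (h := fun d => f (blockPos t d)) (hf0 _ ?_)).symm
        rw [hS, ← hlen, List.take_length, hL.mem_iff, List.mem_range] at hd
        exact not_lt.1 hd

end Sweep

end ArrayLang

/-! ### Minimal suffixes by pairwise comparison -/

/-- The letters `f a, …, f (e - 1)`. -/
def subword (f : ℕ → ℕ) (a e : ℕ) : List ℕ := (List.range' a (e - a)).map f

section Subword

variable {f f' : ℕ → ℕ} {a b e i m : ℕ}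

@[simp]
theorem length_subword : (subword f a e).length = e - a := by
  rw [subword, List.length_map, List.length_range']

theorem subword_of_le (f : ℕ → ℕ) (h : e ≤ a) : subword f a e = [] := by
  rw [← List.length_eq_zero_iff, length_subword, Nat.sub_eq_zero_of_le h]

theorem subword_of_lt (f : ℕ → ℕ) (h : a < e) : subword f a e = f a :: subword f (a + 1) e := by
  rw [subword, show e - a = e - (a + 1) + 1 by omega, List.range'_succ, List.map_cons, subword]

theorem subword_shift (f : ℕ → ℕ) (a e d : ℕ) :
    subword (fun x => f (x + d)) a e = subword f (a + d) (e + d) := by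
  rw [subword, subword, Nat.add_sub_add_right, add_comm a d, ← List.map_add_range', List.map_map]
  simp only [Function.comp_def, add_comm d]

theorem drop_take_eq_subword (T : List ℕ) (he : e ≤ T.length) :
    (T.take e).drop a = subword (T.getD · 0) a e := by
  refine List.ext_getElem ?_ fun k hk _ => ?_
  · rw [List.length_drop, List.length_take, length_subword, min_eq_left he]
  · rw [List.length_drop, List.length_take] at hk
    simp only [List.getElem_drop, List.getElem_take, subword, List.getElem_map,
      List.getElem_range', one_mul]
    rw [List.getD_eq_getElem]

theorem subword_lt_subword_iff_of_agree (ha : a + m ≤ e) (hb : b + m ≤ e)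
    (h : ∀ k < m, f (a + k) = f (b + k)) :
    subword f a e < subword f b e ↔ subword f (a + m) e < subword f (b + m) e := by
  induction m with
  | zero => rfl
  | succ m ih =>
    rw [ih (by omega) (by omega) fun k hk => h k (by omega),
      subword_of_lt f (a := a + m) (by omega), subword_of_lt f (a := b + m) (by omega),
      h m (by omega), List.cons_lt_cons_self, add_assoc, add_assoc]

theorem subword_lt_subword_iff (hba : b < a) (ha : a + m ≤ e)
    (h : ∀ k < m, f (a + k) = f (b + k)) (hm : a + m = e ∨ f (a + m) ≠ f (b + m)) :
    subword f a e < subword f b e ↔ a + m = e ∨ f (a + m) < f (b + m) := by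
  rw [subword_lt_subword_iff_of_agree ha (by omega) h, subword_of_lt f (a := b + m) (by omega)]
  rcases ha.lt_or_eq with hlt | heq
  · rw [subword_of_lt f hlt, List.cons_lt_cons_iff, or_iff_right hlt.ne,
      or_iff_left fun h => hm.resolve_left hlt.ne h.1]
  · rw [heq, subword_of_le f le_rfl]
    exact iff_of_true (List.nil_lt_cons _ _) (.inl rfl)

theorem subword_lt_subword_iff_of_lt_iff {a b : ℕ}
    (h : ∀ x y, i ≤ x → x < e → i ≤ y → y < e → (f x < f y ↔ f' x < f' y)) (ha : i ≤ a)
    (hb : i ≤ b) : subword f a e < subword f b e ↔ subword f' a e < subword f' b e := by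
  rcases lt_or_ge b e with hbe | hbe
  · rcases lt_or_ge a e with hae | hae
    · have heq : f a = f b ↔ f' a = f' b := by
        have := h a b ha hae hb hbe
        have := h b a hb hbe ha hae
        omega
      simp only [subword_of_lt _ hae, subword_of_lt _ hbe, List.cons_lt_cons_iff, heq,
        h a b ha hae hb hbe,
        subword_lt_subword_iff_of_lt_iff h (ha.trans a.le_succ) (hb.trans b.le_succ)]
    · simp only [subword_of_le _ hae, subword_of_lt _ hbe, List.nil_lt_cons]
  · simp only [subword_of_le _ hbe, List.not_lt_nil]
termination_by e - a

/-- `b` is the starting position of the least non-empty suffix of `f i, …, f (e - 1)`. -/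
structure IsMinStart (f : ℕ → ℕ) (i e b : ℕ) : Prop where
  le : i ≤ b
  lt : b < e
  subword_le : ∀ k, i ≤ k → k < e → subword f b e ≤ subword f k e

theorem isMinStart_add_one (f : ℕ → ℕ) (i : ℕ) : IsMinStart f i (i + 1) i :=
  ⟨le_rfl, i.lt_succ_self, fun k hi hk => by rw [Nat.le_antisymm (Nat.lt_succ_iff.1 hk) hi]⟩

theorem IsMinStart.of_lt_iff (hb : IsMinStart f i e b)
    (h : ∀ x y, i ≤ x → x < e → i ≤ y → y < e → (f x < f y ↔ f' x < f' y)) :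
    IsMinStart f' i e b :=
  ⟨hb.le, hb.lt, fun k hk hke => not_lt.1 <|
    (subword_lt_subword_iff_of_lt_iff h hk hb.le).not.1 (not_lt.2 (hb.subword_le k hk hke))⟩

theorem IsMinStart.shift {d : ℕ} (hb : IsMinStart (fun x => f (x + d)) i e b) :
    IsMinStart f (i + d) (e + d) (b + d) := by
  refine ⟨Nat.add_le_add_right hb.le d, Nat.add_lt_add_right hb.lt d, fun k hk hke => ?_⟩
  have := hb.subword_le (k - d) (by omega) (by omega)
  rwa [subword_shift, subword_shift, Nat.sub_add_cancel (by omega)] at this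

theorem IsMinStart.isMinSuf {T : List ℕ} {ℓ r : ℕ} (hr : r ≤ T.length)
    (hb : IsMinStart (T.getD · 0) (ℓ - 1) r b) :
    ∃ s, IsMinSuf (fragment T ℓ r) s ∧ r - b = s.length := by
  have hdrop (k : ℕ) : (fragment T ℓ r).drop k = subword (T.getD · 0) (ℓ - 1 + k) r := by
    rw [fragment, List.drop_drop, drop_take_eq_subword T hr]
  refine ⟨subword (T.getD · 0) b r, ⟨?_, ?_, fun u hu hsuf => ?_⟩, length_subword.symm⟩
  · rw [subword_of_lt _ hb.lt]
    exact List.cons_ne_nil _ _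
  · rw [← Nat.add_sub_cancel' hb.le, ← hdrop]
    exact List.drop_suffix _ _
  · rw [List.suffix_iff_eq_drop, hdrop] at hsuf
    have hlt := lt_of_not_ge fun h => hu (hsuf.trans (subword_of_le _ h))
    rw [hsuf]
    exact (hb.subword_le _ (Nat.le_add_right _ _) hlt).eq_or_lt

end Subword

/-! ### The table of minimal suffixes -/

/-- The letter number `k` of the block with the identifier `id`, a sequence of `w`-bit digits. -/
def digit (w id k : ℕ) : ℕ := id / 2 ^ (w * k) % 2 ^ w

namespace ArrayLang

/-- The digit of the identifier `id` at the given place. -/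
def digitExp (e : Exp Var Arr) : Exp Var Arr :=
  (𝐯 .id >>ₑ (𝐯 .w *ₑ e)) %ₑ (𝐥 1 <<ₑ 𝐯 .w)

/-- The suffixes that start at `cand` and at `best` agree also at the distance `match` from their
starts. -/
def matchGuard : Exp Var Arr :=
  (𝐯 .cand +ₑ 𝐯 .match <ₑ 𝐯 .last +ₑ 𝐥 1) *ₑ
    (digitExp (𝐯 .cand +ₑ 𝐯 .match) =ₑ digitExp (𝐯 .best +ₑ 𝐯 .match))

/-- Compute in `match` the length of the longest common prefix of the suffixes that start at `cand`
and at `best`. -/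
def matchCmd : Cmd Var Arr :=
  .match ::= 𝐥 0 ;; .while matchGuard (.match ::= 𝐯 .match +ₑ 𝐥 1)

/-- Replace `best` by `cand` if the latter starts the smaller suffix. -/
def compareCmd : Cmd Var Arr :=
  matchCmd ;;
  .ite ((𝐯 .cand +ₑ 𝐯 .match =ₑ 𝐯 .last +ₑ 𝐥 1) +ₑ
      (digitExp (𝐯 .cand +ₑ 𝐯 .match) <ₑ digitExp (𝐯 .best +ₑ 𝐯 .match)))
    (.best ::= 𝐯 .cand) .skip

/-- Compute in `best` the start of the least suffix of the letters number `first, …, last` of the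
block with the identifier `id`. -/
def minStartCmd : Cmd Var Arr :=
  .best ::= 𝐯 .first ;; .cand ::= 𝐯 .first +ₑ 𝐥 1 ;; .for .cand (𝐯 .last +ₑ 𝐥 1) compareCmd

/-- Compute the entry number `entry` of the table. -/
def entryBody : Cmd Var Arr :=
  .last ::= 𝐯 .entry %ₑ 𝐯 .blockLen ;; .first ::= 𝐯 .entry /ₑ 𝐯 .blockLen %ₑ 𝐯 .blockLen ;;
  .id ::= 𝐯 .entry /ₑ 𝐯 .blockLen /ₑ 𝐯 .blockLen ;;
  .ite (𝐯 .last <ₑ 𝐯 .first) .skip minStartCmd ;;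
  .put .text (𝐯 .tableStart +ₑ 𝐯 .entry) (𝐯 .best)

section Table

variable {D : Dims} {s s' : Env Var Arr} {p : Cmd Var Arr} {t w g id j b c : ℕ}

theorem eval_digitExp (hP : HasParams D t w g s) (hid : s.v .id = id) (e : Exp Var Arr) :
    (digitExp e).eval s = digit w id (e.eval s) := by
  simp only [digitExp, Exp.eval, exactValue, hP.eq_w, hid, one_mul, digit]

theorem safe_digitExp (hroom : 8 * D.len ≤ D.words) (hP : HasParams D t w g s) {x y : Var}
    (hlt : s.v x + s.v y ≤ 2 * t) : (digitExp (𝐯 x +ₑ 𝐯 y)).Safe D s := by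
  have ht := hP.params.t_lt
  have hpow := hP.params.pow
  have hshift : w * (s.v x + s.v y) < D.len :=
    calc w * (s.v x + s.v y) ≤ w * (2 * t) := Nat.mul_le_mul_left _ hlt
      _ = 2 * t * w * 1 := by ring
      _ ≤ 2 * t * w * g := Nat.mul_le_mul_left _ hP.params.g_pos
      _ < D.len := hP.params.bits_lt
  simp only [digitExp, Exp.Safe, Exp.eval, exactValue, Fits, hP.eq_w, one_mul, true_and, and_true]
  exact ⟨⟨by omega, by omega⟩, by omega, by omega⟩

/-- The suffixes at `c` and `b` of the first `j + 1` letters of the block with identifier `id` are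
to be compared. -/
structure Comparing (t id j b c : ℕ) (s : Env Var Arr) : Prop where
  eq_id : s.v .id = id
  eq_last : s.v .last = j
  eq_best : s.v .best = b
  eq_cand : s.v .cand = c
  lt : b < c
  le : c ≤ j
  last_lt : j < 2 * t

theorem Comparing.frame (h : Comparing t id j b c s) (hf : Frame p s s')
    (hp : ∀ x ∈ [Var.id, .last, .best, .cand], x ∉ p.vars) : Comparing t id j b c s' where
  eq_id := (hf.v _ (hp _ (by simp))).trans h.eq_id
  eq_last := (hf.v _ (hp _ (by simp))).trans h.eq_last
  eq_best := (hf.v _ (hp _ (by simp))).trans h.eq_best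
  eq_cand := (hf.v _ (hp _ (by simp))).trans h.eq_cand
  lt := h.lt
  le := h.le
  last_lt := h.last_lt

theorem safe_matchGuard (hroom : 8 * D.len ≤ D.words) (hP : HasParams D t w g s)
    (hC : Comparing t id j b c s) (hle : c + s.v .match ≤ j + 1) : matchGuard.Safe D s := by
  have ht := hP.params.t_lt
  have := hC.lt
  have := hC.last_lt
  have := hC.eq_cand
  have := hC.eq_best
  simp only [matchGuard, Exp.Safe, Exp.eval, exactValue, Fits, hC.eq_last, hC.eq_cand, true_and,
    and_true]
  exact ⟨⟨by omega, by omega⟩, ⟨safe_digitExp hroom hP (by omega),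
    safe_digitExp hroom hP (by omega)⟩, by split_ifs <;> omega⟩

theorem eval_matchGuard_eq_zero_iff (hP : HasParams D t w g s) (hC : Comparing t id j b c s) :
    matchGuard.eval s = 0 ↔ j + 1 ≤ c + s.v .match ∨
      digit w id (c + s.v .match) ≠ digit w id (b + s.v .match) := by
  simp only [matchGuard, Exp.eval, exactValue, eval_digitExp hP hC.eq_id, hC.eq_last, hC.eq_cand,
    hC.eq_best, mul_eq_zero, ite_eq_right_iff, one_ne_zero, imp_false, not_lt, ne_eq]

theorem runs_matchCmd (hroom : 8 * D.len ≤ D.words) (hP : HasParams D t w g s)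
    (hC : Comparing t id j b c s) :
    Runs D matchCmd s fun s' T => T ≤ 40 * (2 * t) + 40 ∧ ∃ m, s'.v .match = m ∧ c + m ≤ j + 1 ∧
      (∀ k < m, digit w id (c + k) = digit w id (b + k)) ∧
      (c + m = j + 1 ∨ digit w id (c + m) ≠ digit w id (b + m)) := by
  have ht := hP.params.t_lt
  have := hC.lt
  have := hC.le
  have := hC.last_lt
  have hP₀ : HasParams D t w g (s.set .match 0) := ⟨hP.1, hP.2, hP.3, hP.4, hP.5, hP.6⟩
  have hC₀ : Comparing t id j b c (s.set .match 0) :=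
    ⟨hC.1, hC.2, hC.3, hC.4, hC.5, hC.6, hC.7⟩
  simp only [matchCmd, runs_seq, runs_asg, Exp.Safe, Exp.eval, Exp.cost]
  refine ⟨by omega, (Runs.while (B := 4) (k := j + 1 - c) (fun k s' => c + s'.v .match ≤ j + 1 ∧
    k = j + 1 - (c + s'.v .match) ∧ ∀ k < s'.v .match, digit w id (c + k) = digit w id (b + k))
    ?_ ?_ ?_).mono ?_⟩
  · simp only [Env.set_v, if_true]
    exact ⟨by omega, by omega, fun k hk => absurd hk k.not_lt_zero⟩
  · rintro k s' hf ⟨hle, -, -⟩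
    exact safe_matchGuard hroom (hP₀.frame hf (by decide)) (hC₀.frame hf (by decide)) hle
  · rintro k s' hf ⟨_, rfl, hag⟩ hne
    rw [ne_eq, eval_matchGuard_eq_zero_iff (hP₀.frame hf (by decide)) (hC₀.frame hf (by decide)),
      not_or, not_le, ne_eq, not_not] at hne
    obtain ⟨hlt, heq⟩ := hne
    simp only [runs_asg, Exp.Safe, Exp.eval, exactValue, Fits, Exp.cost, Env.set_v, if_true,
      true_and]
    refine ⟨by omega, le_rfl, _, by omega, by omega, rfl, fun k hk => ?_⟩
    rcases Nat.lt_succ_iff_lt_or_eq.1 hk with h | rfl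
    exacts [hag k h, heq]
  · rintro s' T hf ⟨hT, hend, k, hle, -, hag⟩
    rw [eval_matchGuard_eq_zero_iff (hP₀.frame hf (by decide)) (hC₀.frame hf (by decide))] at hend
    refine ⟨?_, _, rfl, hle, hag, hend.imp_left fun h => le_antisymm hle h⟩
    simp only [matchGuard, digitExp, Exp.cost] at hT
    calc _ ≤ 1 + 1 + (36 * (j + 1 - c) + 32) := by omega
      _ ≤ _ := by omega

theorem runs_compareCmd (hroom : 8 * D.len ≤ D.words) (hP : HasParams D t w g s)
    (hC : Comparing t id j b c s) :
    Runs D compareCmd s fun s' T => T ≤ 40 * (2 * t) + 80 ∧ s'.v .best =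
      if subword (digit w id) c (j + 1) < subword (digit w id) b (j + 1) then c else b := by
  have := hP.params.t_lt
  have := hC.lt
  have := hC.last_lt
  refine (runs_matchCmd hroom hP hC).seq fun s' T hf ⟨_, m, hm, hle, hag, hend⟩ => ?_
  have hP' := hP.frame hf (by decide)
  have hC' := hC.frame hf (by decide)
  simp only [subword_lt_subword_iff hC.lt hle hag hend, runs_ite, runs_asg, runs_skip, Exp.Safe,
    Exp.eval, exactValue, Fits, Exp.cost,
    eval_digitExp hP' hC'.eq_id, hC'.eq_last, hC'.eq_cand, hC'.eq_best, hm, Env.set_v, if_true,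
    true_and, and_true, ne_eq, Nat.add_eq_zero_iff, not_and_or]
  have := hC'.eq_cand
  have := hC'.eq_best
  refine ⟨⟨⟨by omega, by omega⟩, ⟨safe_digitExp hroom hP' (by omega),
    safe_digitExp hroom hP' (by omega)⟩, by split_ifs <;> omega⟩, fun h => ?_, fun h => ?_⟩
  · rw [if_pos (h.imp (fun h => by_contra fun h' => h (if_neg h')) fun h => by_contra fun h' =>
      h (if_neg h'))]
    simp only [digitExp, Exp.cost]
    exact ⟨by omega, trivial⟩
  · rw [if_neg (not_or.2 ⟨fun h' => one_ne_zero ((if_pos h').symm.trans h.1),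
      fun h' => one_ne_zero ((if_pos h').symm.trans h.2)⟩)]
    simp only [digitExp, Exp.cost]
    exact ⟨by omega, trivial⟩

theorem runs_minStartCmd {i : ℕ} (hroom : 8 * D.len ≤ D.words) (hP : HasParams D t w g s)
    (hid : s.v .id = id) (hfirst : s.v .first = i) (hlast : s.v .last = j) (hij : i ≤ j)
    (hj : j < 2 * t) :
    Runs D minStartCmd s fun s' T =>
      T ≤ 64 * (2 * t) ^ 2 ∧ IsMinStart (digit w id) i (j + 1) (s'.v .best) := by
  have := hP.params.t_lt
  have htwo := hP.params.two_le
  simp only [minStartCmd, runs_seq, runs_asg, Exp.Safe, Exp.eval, exactValue, Fits, Exp.cost,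
    Env.set_v, reduceCtorEq, if_false, hfirst, true_and]
  set s₀ := (s.set .best i).set .cand (i + 1) with hs₀
  have hP₀ : HasParams D t w g s₀ := ⟨hP.1, hP.2, hP.3, hP.4, hP.5, hP.6⟩
  refine ⟨by omega, (Runs.for (B := 40 * (2 * t) + 80) (N := j + 1) (fun c s' =>
    i ≤ s'.v .best ∧ s'.v .best < c ∧ ∀ k, i ≤ k → k < c →
      subword (digit w id) (s'.v .best) (j + 1) ≤ subword (digit w id) k (j + 1))
    (by omega) (Nat.add_le_add_right hij 1) ?_ ?_ ?_).mono ?_⟩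
  · exact ⟨le_rfl, i.lt_succ_self, fun k hk hki => (Nat.le_antisymm (Nat.lt_succ_iff.1 hki) hk) ▸
      le_rfl⟩
  · intro s' hf
    have hlast' : s'.v .last = j := (hf.v .last (by decide)).trans hlast
    simp only [Exp.Safe, Exp.eval, exactValue, Fits, hlast', true_and, and_true]
    omega
  · intro s' hf hlt ⟨hle, hbest, hmin⟩
    have hC : Comparing t id j (s'.v .best) (s'.v .cand) s' :=
      ⟨(hf.v .id (by decide)).trans hid, (hf.v .last (by decide)).trans hlast, rfl, rfl, hbest,
        Nat.lt_succ_iff.1 hlt, hj⟩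
    refine (runs_compareCmd hroom (hP₀.frame hf (by decide)) hC).mono fun s'' T hf' ⟨hT, hb⟩ =>
      ⟨hT, hf'.v .cand (by decide), ?_⟩
    simp only [Env.set_v, reduceCtorEq, if_false, hb]
    split_ifs with h
    · refine ⟨hle.trans hbest.le, Nat.lt_succ_self _, fun k hk hkc => ?_⟩
      rcases Nat.lt_succ_iff_lt_or_eq.1 hkc with hkc | rfl
      exacts [h.le.trans (hmin k hk hkc), le_rfl]
    · refine ⟨hle, hbest.trans (Nat.lt_succ_self _), fun k hk hkc => ?_⟩
      rcases Nat.lt_succ_iff_lt_or_eq.1 hkc with hkc | rfl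
      exacts [hmin k hk hkc, not_lt.1 h]
  · rintro s' T - ⟨hT, -, hle, hlt, hmin⟩
    refine ⟨?_, hle, hlt, hmin⟩
    simp only [Env.set_v, if_true, Exp.cost, hs₀] at hT
    have : (40 * (2 * t) + 80 + 3 + 7) * (j + 1 - (i + 1)) ≤ (40 * (2 * t) + 90) * (2 * t) :=
      Nat.mul_le_mul_left _ (by omega)
    nlinarith

theorem runs_entryBody (hroom : 8 * D.len ≤ D.words) (hP : HasParams D t w g s)
    (hlen : s.v .blockLen = 2 * t) (hlt : s.v .tableStart + s.v .entry < D.len) :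
    Runs D entryBody s fun s' T => T ≤ 80 * (2 * t) ^ 2 ∧ ∃ b,
      s'.arr .text = Function.update (s.arr .text) (s.v .tableStart + s.v .entry) b ∧
      ∀ id i j, s.v .entry = (id * (2 * t) + i) * (2 * t) + j → i ≤ j → j < 2 * t →
        IsMinStart (digit w id) i (j + 1) b := by
  have htwo := hP.params.two_le
  set x := s.v .entry with hx
  simp only [entryBody, runs_seq, runs_asg, Exp.Safe, Exp.eval, exactValue, Fits, Exp.cost,
    Env.set_v, reduceCtorEq, if_false, ← hx, hlen, true_and, and_true]
  set s₀ := ((s.set .last (x % (2 * t))).set .first (x / (2 * t) % (2 * t))).set .id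
    (x / (2 * t) / (2 * t))
  have hP₀ : HasParams D t w g s₀ := ⟨hP.1, hP.2, hP.3, hP.4, hP.5, hP.6⟩
  have hbest : Runs D (.ite (𝐯 .last <ₑ 𝐯 .first) .skip minStartCmd) s₀ fun s' T =>
      T ≤ 64 * (2 * t) ^ 2 + 10 ∧ (s₀.v .first ≤ s₀.v .last →
        IsMinStart (digit w (s₀.v .id)) (s₀.v .first) (s₀.v .last + 1) (s'.v .best)) := by
    simp only [runs_ite, runs_skip, Exp.Safe, Exp.eval, exactValue, Exp.cost]
    refine ⟨⟨trivial, trivial, trivial⟩, fun h => ⟨by omega, fun h' => absurd (if_neg h'.not_gt) h⟩,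
      fun h => ?_⟩
    have hle : s₀.v .first ≤ s₀.v .last :=
      not_lt.1 fun hlt => one_ne_zero ((if_pos hlt).symm.trans h)
    exact (runs_minStartCmd hroom hP₀ rfl rfl rfl hle (Nat.mod_lt _ (by omega))).mono
      fun s' T _ h => ⟨by omega, fun _ => h.2⟩
  refine hbest.mono fun s' T hf ⟨_, hmin⟩ => ?_
  have htable : s'.v .tableStart = s.v .tableStart := hf.v .tableStart (by decide)
  have hentry : s'.v .entry = x := hf.v .entry (by decide)
  simp only [runs_put, Exp.Safe, Exp.eval, exactValue, Fits, Exp.cost, htable, hentry, true_and,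
    Env.write_arr, if_true, hf.arr .text (by decide)]
  refine ⟨by omega, hlt, by nlinarith, _, rfl, fun id i j hxe hij hj => ?_⟩
  obtain ⟨hdiv, hmod⟩ := mul_add_div_mod (J := id * (2 * t) + i) hj
  obtain ⟨hdiv', hmod'⟩ := mul_add_div_mod (J := id) (hij.trans_lt hj)
  have hfirst : s₀.v .first = i := show x / (2 * t) % (2 * t) = i by rw [hxe, hdiv, hmod']
  have hlast : s₀.v .last = j := show x % (2 * t) = j by rw [hxe, hmod]
  have hid : s₀.v .id = id := show x / (2 * t) / (2 * t) = id by rw [hxe, hdiv, hdiv']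
  rw [hfirst, hlast, hid] at hmin
  exact hmin hij

end Table

/-! ### Computing the parameters -/

/-- Compute `t`, the least power of two that is at least `τ`, and `w`, where `2 ^ w = 4 * t`. -/
def blockLenCmd : Cmd Var Arr :=
  .t ::= 𝐥 1 ;; .w ::= 𝐥 2 ;;
  .while (𝐯 .t <ₑ 𝐯 .τ) (.t ::= 𝐯 .t +ₑ 𝐯 .t ;; .w ::= 𝐯 .w +ₑ 𝐥 1)

/-- Compute the greatest `perWord` for which `numIds ^ perWord` is at most `n`. -/
def perWordCmd : Cmd Var Arr :=
  .power ::= 𝐯 .numIds ;; .perWord ::= 𝐥 1 ;;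
  .while (𝐯 .power <ₑ 𝐯 .n /ₑ 𝐯 .numIds +ₑ 𝐥 1)
    (.power ::= 𝐯 .power *ₑ 𝐯 .numIds ;; .perWord ::= 𝐯 .perWord +ₑ 𝐥 1)

/-- Compute the parameters. -/
def paramCmd : Cmd Var Arr :=
  blockLenCmd ;; .idBits ::= (𝐯 .t +ₑ 𝐯 .t) *ₑ 𝐯 .w ;; .numIds ::= 𝐥 1 <<ₑ 𝐯 .idBits ;; perWordCmd

section Parameters

variable {D : Dims} {s : Env Var Arr} {τ t w M : ℕ}

theorem runs_blockLenCmd (hτ : s.v .τ = τ) (hD : 2 * 2 ^ Nat.clog 2 τ < D.words) :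
    Runs D blockLenCmd s fun s' T => T ≤ 13 * Nat.clog 2 τ + 10 ∧ s'.v .t = 2 ^ Nat.clog 2 τ ∧
      s'.v .w = Nat.clog 2 τ + 2 := by
  have hclog : Nat.clog 2 τ < 2 ^ Nat.clog 2 τ := Nat.lt_two_pow_self
  simp only [blockLenCmd, runs_seq, runs_asg, Exp.Safe, Exp.eval, Exp.cost]
  refine ⟨by omega, by omega, (Runs.while (B := 8) (k := Nat.clog 2 τ) (fun k s' =>
    ∃ i ≤ Nat.clog 2 τ, k = Nat.clog 2 τ - i ∧ s'.v .t = 2 ^ i ∧ s'.v .w = i + 2)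
    ⟨0, Nat.zero_le _, rfl, rfl, rfl⟩ ?_ ?_).mono ?_⟩
  · exact fun _ _ _ _ => ⟨trivial, trivial, trivial⟩
  · rintro k s' hf ⟨i, _, rfl, ht, hw⟩ hne
    simp only [Exp.eval, exactValue, ht, (hf.v .τ (by decide)).trans hτ] at hne
    have hlt : i < Nat.clog 2 τ :=
      (Nat.lt_clog_iff_pow_lt one_lt_two).2 (by_contra fun h => hne (if_neg h))
    have hpow : 2 ^ (i + 1) ≤ 2 ^ Nat.clog 2 τ := Nat.pow_le_pow_right two_pos hlt
    simp only [runs_seq, runs_asg, Exp.Safe, Exp.eval, exactValue, Fits, Exp.cost, Env.set_v,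
      reduceCtorEq, if_true, if_false, ht, hw, true_and, ← two_mul, ← pow_succ']
    exact ⟨by omega, by omega, by omega, _, by omega, i + 1, hlt, rfl, rfl, rfl⟩
  · rintro s' T hf ⟨hT, hz, _, i, hi, -, ht, hw⟩
    simp only [Exp.eval, exactValue, ht, (hf.v .τ (by decide)).trans hτ] at hz
    have hle : Nat.clog 2 τ ≤ i := (Nat.clog_le_iff_le_pow one_lt_two).2
      (not_lt.1 fun h => one_ne_zero ((if_pos h).symm.trans hz))
    rw [le_antisymm hi hle] at ht hw
    simp only [Exp.cost] at hT
    exact ⟨by omega, ht, hw⟩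

theorem runs_perWordCmd (hroom : 8 * D.len ≤ D.words) (hn : s.v .n = D.len)
    (hM : s.v .numIds = M) (hM₂ : 2 ≤ M) (hle : M ≤ D.len) :
    Runs D perWordCmd s fun s' T => T ≤ 20 * D.len ∧ ∃ g, s'.v .perWord = g ∧ 1 ≤ g ∧
      M ^ g ≤ D.len ∧ D.len < M ^ (g + 1) := by
  have hdiv : D.len / M ≤ D.len := Nat.div_le_self _ _
  have hcond (g : ℕ) : M ^ g < D.len / M + 1 ↔ M ^ (g + 1) ≤ D.len := by
    rw [Nat.lt_succ_iff, Nat.le_div_iff_mul_le (by omega), pow_succ]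
  simp only [perWordCmd, runs_seq, runs_asg, Exp.Safe, Exp.eval, Exp.cost, hM]
  refine ⟨trivial, by omega, (Runs.while (B := 8) (k := D.len - 1) (fun k s' =>
    ∃ g, 1 ≤ g ∧ M ^ g ≤ D.len ∧ k = D.len - g ∧ s'.v .power = M ^ g ∧ s'.v .perWord = g)
    ⟨1, le_rfl, (pow_one M).trans_le hle, rfl, (pow_one M).symm, rfl⟩ ?_ ?_).mono ?_⟩
  · intro k s' hf _
    simp only [Exp.Safe, Exp.eval, exactValue, Fits, (hf.v .n (by decide)).trans hn,
      (hf.v .numIds (by decide)).trans hM, true_and, and_true]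
    omega
  · rintro k s' hf ⟨g, hg, hle, rfl, hp, hw⟩ hne
    have hM' : s'.v .numIds = M := (hf.v .numIds (by decide)).trans hM
    simp only [Exp.eval, exactValue, hp, (hf.v .n (by decide)).trans hn, hM', hcond] at hne
    have hle' : M ^ (g + 1) ≤ D.len := by_contra fun h => hne (if_neg h)
    have hglt : g < D.len := (Nat.lt_pow_self hM₂).trans_le hle
    simp only [runs_seq, runs_asg, Exp.Safe, Exp.eval, exactValue, Fits, Exp.cost, Env.set_v,
      reduceCtorEq, if_true, if_false, hp, hw, hM', true_and, ← pow_succ]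
    exact ⟨by omega, by omega, by omega, _, by omega, g + 1, by omega, hle', rfl, rfl, rfl⟩
  · rintro s' T hf ⟨hT, hz, _, g, hg, hle, -, hp, hw⟩
    have hM' : s'.v .numIds = M := (hf.v .numIds (by decide)).trans hM
    simp only [Exp.eval, exactValue, hp, (hf.v .n (by decide)).trans hn, hM', hcond] at hz
    simp only [Exp.cost] at hT
    exact ⟨by omega, g, hw, hg, hle,
      not_le.1 fun h => one_ne_zero ((if_pos h).symm.trans hz)⟩

theorem runs_paramCmd (hroom : 8 * D.len ≤ D.words) (hn : s.v .n = D.len) (hτ : s.v .τ = τ)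
    (hτ₂ : 2 ≤ τ) (ht : t = 2 ^ Nat.clog 2 τ) (hw : w = Nat.clog 2 τ + 2)
    (hle : (2 ^ (2 * t * w)) ^ 4 ≤ D.len) :
    Runs D paramCmd s fun s' T => T ≤ 50 * D.len ∧ ∃ g, HasParams D t w g s' := by
  have hclog : 1 ≤ Nat.clog 2 τ := (Nat.lt_clog_iff_pow_lt one_lt_two).2 hτ₂
  have htwo : 2 ≤ t := ht ▸ Nat.le_self_pow (by omega) 2
  have hpow : 2 ^ w = 4 * t := by rw [hw, ht]; ring
  have hbits : 2 * t * w < 2 ^ (2 * t * w) := Nat.lt_two_pow_self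
  have htw : 2 * t ≤ 2 * t * w := Nat.le_mul_of_pos_right _ (by omega)
  have hwt : w ≤ 2 * t * w := Nat.le_mul_of_pos_left _ (by omega)
  have hMn : 2 ^ (2 * t * w) ≤ D.len := (Nat.le_self_pow (by omega) _).trans hle
  refine (runs_blockLenCmd hτ (by omega)).seq fun s₁ T₁ hf₁ ⟨_, ht₁, hw₁⟩ => ?_
  rw [← ht] at ht₁
  rw [← hw] at hw₁
  simp only [runs_seq, runs_asg, Exp.Safe, Exp.eval, exactValue, Fits, Exp.cost, Env.set_v,
    if_true, ht₁, hw₁, true_and, ← two_mul, one_mul]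
  refine ⟨⟨by omega, by omega⟩, ⟨by omega, by omega⟩,
    (runs_perWordCmd (s := (s₁.set .idBits (2 * t * w)).set .numIds (2 ^ (2 * t * w)))
      (M := 2 ^ (2 * t * w)) hroom ((hf₁.v .n (by decide)).trans hn) rfl (by omega) hMn).mono
        fun s₂ T₂ hf₂ ⟨_, g, hg, hg₁, hgle, hglt⟩ => ⟨by omega, g, ?_⟩⟩
  exact ⟨⟨htwo, hpow, hle, hg₁, hgle, hglt⟩, (hf₂.v .t (by decide)).trans ht₁,
    (hf₂.v .w (by decide)).trans hw₁, hg, hf₂.v .idBits (by decide), hf₂.v .numIds (by decide)⟩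

end Parameters

end ArrayLang

/-! ### The layout of the data structure -/

/-- The letters of the successive blocks, each replaced by its rank within its block. -/
def blockRank (t : ℕ) (f : ℕ → ℕ) : ℕ → ℕ := groupRank (2 * t) fun d => f (blockPos t d)

/-- The word number `q` of packed identifiers: those of the blocks number `g * q, …, g * q + g - 1`,
written with digits of `w` bits. -/
def packedIds (t w g : ℕ) (f : ℕ → ℕ) (q : ℕ) : ℕ :=
  digitWord (2 ^ w) (blockRank t f) (2 * t * g * q) (2 * t * g)

/-- The number of words that store the identifiers of the blocks. -/
def wordCount (n t g : ℕ) : ℕ := n / t / g + 1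

/-- The first address of the table, which follows five parameters and the packed identifiers. -/
def tableStart (n t g : ℕ) : ℕ := wordCount n t g + 5

/-- The number of entries of the table, one for each identifier and each pair of places. -/
def tableSize (t w : ℕ) : ℕ := 2 ^ (2 * t * w) * (2 * t) * (2 * t)

/-- The number of words of the data structure. -/
def dataSize (n t w g : ℕ) : ℕ := tableStart n t g + tableSize t w

/-- The entries of `T` with a number below `N` hold the starts of the minimal suffixes. The entry
for the letters number `i, …, j` of the block with the identifier `id` has the number
`(id * (2 * t) + i) * (2 * t) + j`. -/
def IsTable (t w N : ℕ) (T : ℕ → ℕ) : Prop :=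
  ∀ id i j, (id * (2 * t) + i) * (2 * t) + j < N → i ≤ j → j < 2 * t →
    IsMinStart (digit w id) i (j + 1) (T ((id * (2 * t) + i) * (2 * t) + j))

/-- The memory `A` holds the data structure for the text `f` of length `n`: the parameters, the
packed identifiers, and the table. -/
structure IsDataStructure (n t w g : ℕ) (f A : ℕ → ℕ) : Prop where
  zero : A 0 = t
  one : A 1 = g
  two : A 2 = 2 * t * w
  three : A 3 = 2 ^ (2 * t * w)
  four : A 4 = tableStart n t g
  word : ∀ q < wordCount n t g, A (q + 5) = packedIds t w g f q
  table : IsTable t w (tableSize t w) fun x => A (tableStart n t g + x)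

namespace Params

variable {n t w g : ℕ}

theorem pow_four_le_two_pow (h : Params n t w g) : (4 * t) ^ 4 ≤ 2 ^ (2 * t * w) := by
  have := h.two_le
  rw [mul_comm (2 * t) w, pow_mul, h.pow]
  exact Nat.pow_le_pow_right (by omega) (by omega)

theorem tableSize_mul_le (h : Params n t w g) :
    4096 * (tableSize t w * (2 * t) ^ 2) ≤ n := by
  have hM := h.pow_four_le_two_pow
  have h4096 : 4096 ≤ 2 ^ (2 * t * w) :=
    le_trans (by norm_num) ((Nat.pow_le_pow_left (Nat.mul_le_mul_left 4 h.two_le) 4).trans hM)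
  have hn := h.pow_four_le
  rw [tableSize]
  set M := 2 ^ (2 * t * w)
  calc 4096 * (M * (2 * t) * (2 * t) * (2 * t) ^ 2) = 256 * M * (4 * t) ^ 4 := by ring
    _ ≤ M * M * M := Nat.mul_le_mul (Nat.mul_le_mul_right M (by omega)) hM
    _ ≤ M * M * M * M := Nat.le_mul_of_pos_right _ (by omega)
    _ = M ^ 4 := by ring
    _ ≤ n := hn

theorem dataSize_le (h : Params n t w g) :
    dataSize n t w g ≤ n := by
  have htable := h.tableSize_mul_le
  have htwo := h.two_le
  have := h.t_lt
  have hpos : 1 ≤ (2 * t) ^ 2 := Nat.one_le_pow _ _ (by omega)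
  have hsize : tableSize t w ≤ tableSize t w * (2 * t) ^ 2 := Nat.le_mul_of_pos_right _ hpos
  have hblocks : n / t ≤ n / 2 := Nat.div_le_div_left htwo two_pos
  have hwords : n / t / g ≤ n / t := Nat.div_le_self _ _
  rw [dataSize, tableStart, wordCount]
  omega

end Params

namespace ArrayLang

/-- Compute the layout of the data structure. -/
def layoutCmd : Cmd Var Arr :=
  .blockLen ::= 𝐯 .t +ₑ 𝐯 .t ;; .numWords ::= 𝐯 .n /ₑ 𝐯 .t /ₑ 𝐯 .perWord +ₑ 𝐥 1 ;;
  .tableStart ::= 𝐯 .numWords +ₑ 𝐥 5 ;; .numEntries ::= 𝐯 .numIds *ₑ 𝐯 .blockLen *ₑ 𝐯 .blockLen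

/-- Move the packed identifiers to the data structure. -/
def copyCmd : Cmd Var Arr :=
  .i ::= 𝐥 0 ;; .for .i (𝐯 .numWords) (.put .text (𝐯 .i +ₑ 𝐥 5) (.get .word (𝐯 .i)))

/-- Compute the table. -/
def tableCmd : Cmd Var Arr := .entry ::= 𝐥 0 ;; .for .entry (𝐯 .numEntries) entryBody

/-- Store the parameters and return the size of the data structure. -/
def headerCmd : Cmd Var Arr :=
  .put .text (𝐥 0) (𝐯 .t) ;; .put .text (𝐥 1) (𝐯 .perWord) ;; .put .text (𝐥 2) (𝐯 .idBits) ;;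
  .put .text (𝐥 3) (𝐯 .numIds) ;; .put .text (𝐥 4) (𝐯 .tableStart) ;;
  .n ::= 𝐯 .tableStart +ₑ 𝐯 .numEntries

/-- Assemble the data structure in the array `text` and store its size in `n`. -/
def finishCmd : Cmd Var Arr := layoutCmd ;; copyCmd ;; tableCmd ;; headerCmd

/-- The construction program. -/
def buildCmd : Cmd Var Arr :=
  .ite (𝐯 .τ <ₑ 𝐥 2) (.n ::= 𝐥 0) (paramCmd ;; sortCmd ;; sweepCmd ;; finishCmd)

section Build

variable {D : Dims} {s s' : Env Var Arr} {p : Cmd Var Arr} {f word : ℕ → ℕ} {t w g : ℕ}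

/-- The variables hold the parameters and the layout of the data structure. -/
structure HasLayout (D : Dims) (t w g : ℕ) (s : Env Var Arr) : Prop extends
    HasParams D t w g s where
  eq_blockLen : s.v .blockLen = 2 * t
  eq_numWords : s.v .numWords = wordCount D.len t g
  eq_tableStart : s.v .tableStart = tableStart D.len t g
  eq_numEntries : s.v .numEntries = tableSize t w

theorem HasLayout.frame (h : HasLayout D t w g s) (hf : Frame p s s')
    (hp : ∀ x ∈ [Var.t, .w, .perWord, .idBits, .numIds, .blockLen, .numWords, .tableStart,
      .numEntries], x ∉ p.vars) : HasLayout D t w g s' where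
  toHasParams := h.toHasParams.frame hf fun x hx => hp x (by
    simp only [List.mem_cons, List.not_mem_nil, or_false] at hx ⊢; tauto)
  eq_blockLen := (hf.v _ (hp _ (by simp))).trans h.eq_blockLen
  eq_numWords := (hf.v _ (hp _ (by simp))).trans h.eq_numWords
  eq_tableStart := (hf.v _ (hp _ (by simp))).trans h.eq_tableStart
  eq_numEntries := (hf.v _ (hp _ (by simp))).trans h.eq_numEntries

theorem runs_layoutCmd (hroom : 8 * D.len ≤ D.words) (hn : s.v .n = D.len)
    (hP : HasParams D t w g s) :
    Runs D layoutCmd s fun s' T => T ≤ D.len ∧ HasLayout D t w g s' := by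
  have hstart := hP.params.dataSize_le
  have htable := hP.params.tableSize_mul_le
  have htwo := hP.params.two_le
  have hsize : 2 ^ (2 * t * w) * (2 * t) ≤ tableSize t w :=
    Nat.le_mul_of_pos_right _ (by omega)
  have ht := hP.params.t_lt
  rw [dataSize, tableStart] at hstart
  simp only [layoutCmd, runs_seq, runs_asg, Exp.Safe, Exp.eval, exactValue, Fits, Exp.cost,
    Env.set_v, reduceCtorEq, if_true, if_false, hn, hP.eq_t, hP.eq_perWord, hP.eq_numIds, ← two_mul,
    true_and, and_true]
  rw [← tableSize, ← wordCount]
  exact ⟨by omega, by omega, by omega, by omega, by omega,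
    ⟨hP.1, hP.2, hP.3, hP.4, hP.5, hP.6⟩, rfl, rfl, rfl, rfl⟩

theorem runs_copyCmd (hroom : 8 * D.len ≤ D.words) (hL : HasLayout D t w g s)
    (hword : s.arr .word = word) :
    Runs D copyCmd s fun s' T => T ≤ 30 * D.len ∧
      ∀ q < wordCount D.len t g, s'.arr .text (q + 5) = word q := by
  have hstart := hL.params.dataSize_le
  rw [dataSize, tableStart] at hstart
  simp only [copyCmd, runs_seq, runs_asg, Exp.Safe, Exp.eval, Exp.cost]
  refine ⟨by omega, (Runs.for (B := 8) (N := wordCount D.len t g)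
    (fun i s' => ∀ q < i, s'.arr .text (q + 5) = word q) (by omega) (Nat.zero_le _)
    (fun q hq => absurd hq q.not_lt_zero) (fun s' hf => ?_) fun s' hf hlt hI => ?_).mono
      fun s' T _ ⟨hT, _, hI⟩ => ⟨?_, hI⟩⟩
  · exact ⟨trivial, (hf.v .numWords (by decide)).trans hL.eq_numWords⟩
  · simp only [runs_put, Exp.Safe, Exp.eval, exactValue, Fits, Exp.cost, Env.write_v,
      Env.write_arr, Env.set_arr, if_true, (hf.arr .word (by decide)).trans hword, true_and]
    refine ⟨by omega, by omega, by omega, by omega, fun q hq => ?_⟩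
    rcases Nat.lt_succ_iff_lt_or_eq.1 hq with hq | rfl
    · rw [Function.update_of_ne (by omega), hI q hq]
    · exact Function.update_self ..
  · simp only [Env.set_v, if_true, Exp.cost] at hT
    have := hL.params.t_lt
    omega

theorem runs_tableCmd (hroom : 8 * D.len ≤ D.words) (hL : HasLayout D t w g s) :
    Runs D tableCmd s fun s' T => T ≤ 100 * D.len ∧
      (∀ q < tableStart D.len t g, s'.arr .text q = s.arr .text q) ∧
      IsTable t w (tableSize t w) fun x => s'.arr .text (tableStart D.len t g + x) := by
  have hfit := hL.params.dataSize_le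
  rw [dataSize] at hfit
  have ht := hL.params.t_lt
  simp only [tableCmd, runs_seq, runs_asg, Exp.Safe, Exp.eval, Exp.cost]
  refine ⟨by omega, (Runs.for (B := 80 * (2 * t) ^ 2) (N := tableSize t w)
    (fun x s' => (∀ q < tableStart D.len t g, s'.arr .text q = s.arr .text q) ∧
      IsTable t w x fun y => s'.arr .text (tableStart D.len t g + y)) (by omega) (Nat.zero_le _)
    ⟨fun _ _ => rfl, fun _ _ _ h => absurd h (Nat.not_lt_zero _)⟩ (fun s' hf => ?_)
    fun s' hf hlt hI => ?_).mono fun s' T _ ⟨hT, _, hI⟩ => ⟨?_, hI⟩⟩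
  · exact ⟨trivial, (hf.v .numEntries (by decide)).trans hL.eq_numEntries⟩
  · obtain ⟨hkeep, hI⟩ := hI
    have hL₀ : HasLayout D t w g (s.set .entry 0) :=
      ⟨⟨hL.params, hL.eq_t, hL.eq_w, hL.eq_perWord, hL.eq_idBits, hL.eq_numIds⟩, hL.eq_blockLen,
        hL.eq_numWords, hL.eq_tableStart, hL.eq_numEntries⟩
    have hL' := hL₀.frame hf (by decide)
    have hstart := hL'.eq_tableStart
    refine (runs_entryBody hroom hL'.toHasParams hL'.eq_blockLen (by omega)).mono
      fun s'' T hf' ⟨hT, b, hb, hmin⟩ => ⟨hT, hf'.v .entry (by decide), fun q hq => ?_,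
        fun id i j hx hij hj => ?_⟩
    all_goals simp only [Env.set_arr, hb, hstart]
    · rw [Function.update_of_ne (by omega), hkeep q hq]
    · rcases Nat.lt_succ_iff_lt_or_eq.1 hx with hx | hx
      · rw [Function.update_of_ne (by omega)]
        exact hI id i j hx hij hj
      · rw [hx, Function.update_self]
        exact hmin id i j hx.symm hij hj
  · have htable := hL.params.tableSize_mul_le
    simp only [Env.set_v, if_true, Exp.cost, Nat.sub_zero] at hT
    nlinarith

theorem runs_headerCmd (hroom : 8 * D.len ≤ D.words) (hL : HasLayout D t w g s)
    (hword : ∀ q < wordCount D.len t g, s.arr .text (q + 5) = packedIds t w g f q)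
    (htable : IsTable t w (tableSize t w) fun x => s.arr .text (tableStart D.len t g + x)) :
    Runs D headerCmd s fun s' T => T ≤ 2 * D.len ∧ IsDataStructure D.len t w g f (s'.arr .text) ∧
      s'.v .n = dataSize D.len t w g := by
  have hfit := hL.params.dataSize_le
  rw [dataSize] at hfit
  have hstart : tableStart D.len t g = wordCount D.len t g + 5 := rfl
  have htwo := hL.params.two_le
  have ht := hL.params.t_lt
  simp only [headerCmd, runs_seq, runs_asg, runs_put, Exp.Safe, Exp.eval, exactValue, Fits,
    Exp.cost, Env.set_v, Env.set_arr, Env.write_v, Env.write_arr, if_true, hL.eq_t, hL.eq_perWord,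
    hL.eq_idBits, hL.eq_numIds, hL.eq_tableStart, hL.eq_numEntries, true_and]
  refine ⟨by omega, by omega, by omega, by omega, by omega, by omega, by omega, by omega,
    by omega, by omega, by omega, by omega, ⟨rfl, rfl, rfl, rfl, rfl, fun q hq => ?_,
    fun id i j hx hij hj => ?_⟩, rfl⟩
  · simpa [Function.update_apply] using hword q hq
  · have hne (k : ℕ) (hk : k < 5) :
        tableStart D.len t g + ((id * (2 * t) + i) * (2 * t) + j) ≠ k := by omega
    simp only [ne_eq, hne, Nat.reduceLT, not_false_eq_true, Function.update_of_ne]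
    exact htable id i j hx hij hj

theorem runs_finishCmd (hroom : 8 * D.len ≤ D.words) (hn : s.v .n = D.len)
    (hP : HasParams D t w g s) (hword : s.arr .word = packedIds t w g f) :
    Runs D finishCmd s fun s' T => T ≤ 133 * D.len ∧
      IsDataStructure D.len t w g f (s'.arr .text) ∧
      s'.v .n = dataSize D.len t w g := by
  refine (runs_layoutCmd hroom hn hP).seq fun s₁ T₁ hf₁ ⟨_, hL₁⟩ => ?_
  refine (runs_copyCmd hroom hL₁ ((hf₁.arr .word (by decide)).trans hword)).seq
    fun s₂ T₂ hf₂ ⟨_, hw₂⟩ => ?_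
  have hL₂ := hL₁.frame hf₂ (by decide)
  refine (runs_tableCmd hroom hL₂).seq fun s₃ T₃ hf₃ ⟨_, hkeep, ht₃⟩ => ?_
  refine (runs_headerCmd hroom (hL₂.frame hf₃ (by decide)) (fun q hq => ?_) ht₃).mono
    fun s₄ T₄ _ ⟨_, hd₄, hn₄⟩ => ⟨by omega, hd₄, hn₄⟩
  rw [hkeep _ (Nat.add_lt_add_right hq 5), hw₂ q hq]

theorem runs_buildCmd {τ c : ℕ} (hT : HasText D f s) (hf0 : ∀ p, D.len ≤ p → f p = 0)
    (hc : ∀ p < D.len, f p < D.len ^ c) (hzero : ∀ k ≠ .text, s.arr k = 0) (hτ : s.v .τ = τ)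
    (hτ₂ : 2 ≤ τ) (ht : t = 2 ^ Nat.clog 2 τ) (hw : w = Nat.clog 2 τ + 2)
    (hle : (2 ^ (2 * t * w)) ^ 4 ≤ D.len) :
    Runs D buildCmd s fun s' T => T ≤ 700 * (c + 1) * D.len ∧ ∃ g, Params D.len t w g ∧
      IsDataStructure D.len t w g f (s'.arr .text) ∧ s'.v .n = dataSize D.len t w g := by
  have hroom := hT.room
  have htwo := hT.two_le
  simp only [buildCmd, runs_ite, runs_asg, Exp.Safe, Exp.eval, exactValue, Exp.cost, hτ]
  refine ⟨⟨trivial, by omega, trivial⟩, fun h => absurd (if_neg hτ₂.not_gt) h, fun _ => ?_⟩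
  refine (runs_paramCmd hroom hT.n hτ hτ₂ ht hw hle).seq fun s₁ T₁ hf₁ ⟨_, g, hP₁⟩ => ?_
  have hX₁ := hT.frame hf₁ (by decide) (by decide)
  refine (runs_sortCmd hX₁ hc fun b _ => ?_).seq fun s₂ T₂ hf₂ ⟨_, L, hL, hord, hsort⟩ => ?_
  · rw [hf₁.arr .head (by decide), hzero .head (by decide), Pi.zero_apply]
  have hX₂ := hX₁.frame hf₂ (by decide) (by decide)
  have hzero₂ {k} (h₁ : k ∉ paramCmd.arrays) (h₂ : k ∉ sortCmd.arrays) (hk : k ≠ .text) :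
      s₂.arr k = 0 := by rw [hf₂.arr k h₂, hf₁.arr k h₁, hzero k hk]
  have hP₂ := hP₁.frame hf₂ (by decide)
  refine (runs_sweepCmd hX₂ hP₂ hf0 hL hord hsort (hzero₂ (by decide) (by decide) (by decide))
    (hzero₂ (by decide) (by decide) (by decide))
    (hzero₂ (by decide) (by decide) (by decide))).seq fun s₃ T₃ hf₃ ⟨_, hword⟩ => ?_
  refine (runs_finishCmd hroom ((hf₃.v .n (by decide)).trans hX₂.n) (hP₂.frame hf₃ (by decide))
    (funext hword)).mono fun s₄ T₄ _ ⟨_, hD, hn⟩ => ⟨?_, g, hP₂.params, hD, hn⟩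
  nlinarith [Nat.zero_le (c * D.len)]

theorem runs_buildCmd_of_lt_two (hW : 2 < D.words) (hτ : s.v .τ < 2) :
    Runs D buildCmd s fun s' T => T ≤ 10 ∧ s'.v .n = 0 := by
  simp only [buildCmd, runs_ite, runs_asg, Exp.Safe, Exp.eval, exactValue, Exp.cost, Env.set_v,
    if_true]
  exact ⟨⟨trivial, hW, trivial⟩, fun _ => ⟨by omega, by omega, trivial⟩,
    fun h => absurd ((if_pos hτ).symm.trans h) one_ne_zero⟩

end Build

end ArrayLang

/-! ### Queries -/

/-- The identifier of the block number `J`: the number whose digits of `w` bits are the ranks of the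
letters of the block. -/
def blockId (t w : ℕ) (f : ℕ → ℕ) (J : ℕ) : ℕ :=
  digitWord (2 ^ w) (blockRank t f) (2 * t * J) (2 * t)

theorem blockRank_lt_blockRank_iff {t J k l : ℕ} {f : ℕ → ℕ} (hk : k < 2 * t) (hl : l < 2 * t) :
    blockRank t f (2 * t * J + k) < blockRank t f (2 * t * J + l) ↔
      f (k + J * t) < f (l + J * t) := by
  rw [mul_comm (2 * t) J, blockRank, groupRank_lt_groupRank_iff (by omega)
    (by rw [(mul_add_div_mod hk).1, (mul_add_div_mod hl).1]), blockPos_mul_add hk,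
    blockPos_mul_add hl, add_comm k, add_comm l]

namespace Params

variable {n t w g : ℕ} {f : ℕ → ℕ}

theorem blockRank_lt (h : Params n t w g) (d : ℕ) : blockRank t f d < 2 ^ w :=
  groupRank_le.trans_lt h.two_mul_lt

theorem blockId_lt (h : Params n t w g) (J : ℕ) : blockId t w f J < 2 ^ (2 * t * w) := by
  rw [mul_comm (2 * t) w, pow_mul]
  exact _root_.digitWord_lt h.blockRank_lt

theorem packedIds_div_mod (h : Params n t w g) (J : ℕ) :
    packedIds t w g f (J / g) / 2 ^ (2 * t * w * (J % g)) % 2 ^ (2 * t * w) = blockId t w f J := by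
  have hmod : J % g + 1 ≤ g := Nat.mod_lt _ h.g_pos
  have hroom : 2 * t * (J % g) + 2 * t ≤ 2 * t * g := by
    rw [← Nat.mul_add_one]
    exact Nat.mul_le_mul_left _ hmod
  rw [show 2 * t * w * (J % g) = w * (2 * t * (J % g)) by ring, mul_comm (2 * t) w,
    pow_mul 2 w (2 * t * (J % g)), pow_mul 2 w (2 * t), packedIds,
    digitWord_div_pow_mod_pow h.blockRank_lt hroom, mul_assoc (2 * t) g, ← mul_add,
    Nat.div_add_mod, blockId]

theorem digit_blockId (h : Params n t w g) {J k : ℕ} (hk : k < 2 * t) :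
    digit w (blockId t w f J) k = blockRank t f (2 * t * J + k) := by
  have := digitWord_div_pow_mod_pow (s := 2 * t * J) (h.blockRank_lt (f := f)) (j := 1) hk
  rwa [pow_one, digitWord_one, ← pow_mul] at this

theorem isMinStart_of_blockId (h : Params n t w g) {J i e b : ℕ} (he : e ≤ 2 * t)
    (hb : IsMinStart (digit w (blockId t w f J)) i e b) :
    IsMinStart f (i + J * t) (e + J * t) (b + J * t) := by
  refine (hb.of_lt_iff fun x y _ hx _ hy => ?_).shift
  rw [h.digit_blockId (hx.trans_le he), h.digit_blockId (hy.trans_le he)]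
  exact blockRank_lt_blockRank_iff (hx.trans_le he) (hy.trans_le he)

end Params

theorem add_lt_tableSize {t w id i j : ℕ} (hid : id < 2 ^ (2 * t * w)) (hi : i < 2 * t)
    (hj : j < 2 * t) : (id * (2 * t) + i) * (2 * t) + j < tableSize t w := by
  have hrow : id * (2 * t) + i < 2 ^ (2 * t * w) * (2 * t) := by nlinarith
  rw [tableSize]
  nlinarith

theorem IsDataStructure.congr {n t w g : ℕ} {f A B : ℕ → ℕ} (h : IsDataStructure n t w g f A)
    (hAB : ∀ a < dataSize n t w g, B a = A a) : IsDataStructure n t w g f B := by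
  have hsize : dataSize n t w g = wordCount n t g + 5 + tableSize t w := rfl
  have hpos : 0 < wordCount n t g := Nat.succ_pos _
  refine ⟨(hAB 0 (by omega)).trans h.zero, (hAB 1 (by omega)).trans h.one,
    (hAB 2 (by omega)).trans h.two, (hAB 3 (by omega)).trans h.three,
    (hAB 4 (by omega)).trans h.four, fun q hq => (hAB _ (by omega)).trans (h.word q hq),
    fun id i j hN hij hj => ?_⟩
  dsimp only
  rw [hAB _ (Nat.add_lt_add_left hN _)]
  exact h.table id i j hN hij hj

namespace ArrayLang

open WordRAM

/-- The variables of the query program. The registers `0` and `1`, which hold the input, are those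
of the first two. -/
inductive QueryVar
  | ℓ | r | t | perWord | block | first | last | id | best
  deriving DecidableEq

instance : FinEnum QueryVar :=
  .ofNodupList [.ℓ, .r, .t, .perWord, .block, .first, .last, .id, .best]
    (by intro x; cases x <;> simp) (by decide)

/-- The query program. The data structure is the only array. -/
def queryCmd : Cmd QueryVar Unit :=
  .ite (𝐯 .ℓ =ₑ 𝐯 .r) (.ℓ ::= 𝐥 1)
    (.t ::= .get () (𝐥 0) ;; .perWord ::= .get () (𝐥 1) ;;
    .block ::= (𝐯 .ℓ -ₑ 𝐥 1) /ₑ 𝐯 .t ;; .first ::= (𝐯 .ℓ -ₑ 𝐥 1) %ₑ 𝐯 .t ;;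
    .last ::= 𝐯 .first +ₑ (𝐯 .r -ₑ 𝐯 .ℓ) ;;
    .id ::= (.get () (𝐯 .block /ₑ 𝐯 .perWord +ₑ 𝐥 5) >>ₑ
      (.get () (𝐥 2) *ₑ (𝐯 .block %ₑ 𝐯 .perWord))) %ₑ .get () (𝐥 3) ;;
    .best ::= .get () (.get () (𝐥 4) +ₑ ((𝐯 .id *ₑ (𝐯 .t +ₑ 𝐯 .t) +ₑ 𝐯 .first) *ₑ
      (𝐯 .t +ₑ 𝐯 .t) +ₑ 𝐯 .last)) ;;
    .ℓ ::= 𝐯 .last +ₑ 𝐥 1 -ₑ 𝐯 .best)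

section Query

variable {D : Dims} {s : Env QueryVar Unit} {f : ℕ → ℕ} {n t w g ℓ r : ℕ}

theorem runs_queryCmd_of_eq (hD : 1 < D.words) (hℓ : s.v .ℓ = ℓ) (hr : s.v .r = ℓ) (hpos : 1 ≤ ℓ) :
    Runs D queryCmd s fun s' T => T ≤ 100 ∧ ∃ b, IsMinStart f (ℓ - 1) ℓ b ∧ s'.v .ℓ = ℓ - b := by
  have hmin := isMinStart_add_one f (ℓ - 1)
  rw [Nat.sub_add_cancel hpos] at hmin
  simp only [queryCmd, runs_ite, runs_asg, Exp.Safe, Exp.eval, exactValue, Exp.cost, Env.set_v,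
    if_true, hℓ, hr]
  exact ⟨⟨trivial, trivial, trivial⟩, fun _ => ⟨hD, by omega, _, hmin, by omega⟩,
    fun h => absurd h one_ne_zero⟩

theorem runs_queryCmd_of_lt (hroom : 8 * n ≤ D.words) (hlen : D.len = dataSize n t w g)
    (hP : Params n t w g) (hA : IsDataStructure n t w g f (s.arr ())) (hℓ : s.v .ℓ = ℓ)
    (hr : s.v .r = r) (hpos : 1 ≤ ℓ) (hlt : ℓ < r) (hrn : r ≤ n) (hlen' : r - ℓ + 1 ≤ t) :
    Runs D queryCmd s fun s' T => T ≤ 100 ∧ ∃ b, IsMinStart f (ℓ - 1) r b ∧ s'.v .ℓ = r - b := by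
  obtain ⟨hzero, hone, htwo, hthree, hfour, hword, htable⟩ := hA
  have ht₂ := hP.two_le
  have htn := hP.t_lt
  have hbits := hP.bits_lt
  set J := (ℓ - 1) / t with hJ
  set i := (ℓ - 1) % t with hi
  have hℓJ : J * t + i = ℓ - 1 := Nat.div_add_mod' _ _
  have hit : i < t := Nat.mod_lt _ (by omega)
  have hq : J / g < wordCount n t g :=
    Nat.lt_succ_of_le (Nat.div_le_div_right (Nat.div_le_div_right (by omega)))
  have hentry := add_lt_tableSize (hP.blockId_lt (f := f) J) (i := i) (j := i + (r - ℓ))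
    (by omega) (by omega)
  have hshift : 2 * t * w * (J % g) < n :=
    (Nat.mul_le_mul_left _ (Nat.mod_lt _ hP.g_pos).le).trans_lt hbits
  have hmin := hP.isMinStart_of_blockId (f := f) (by omega)
    (htable (blockId t w f J) i (i + (r - ℓ)) hentry (by omega) (by omega))
  rw [show i + J * t = ℓ - 1 by omega,
    show i + (r - ℓ) + 1 + J * t = r by omega] at hmin
  have hsize : D.len = wordCount n t g + 5 + tableSize t w := hlen
  have hfit := hP.dataSize_le
  have hstart : tableStart n t g = wordCount n t g + 5 := rfl
  have hid := (congrArg (· / 2 ^ (2 * t * w * (J % g)) % 2 ^ (2 * t * w)) (hword _ hq)).trans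
    (hP.packedIds_div_mod J)
  simp only [queryCmd, runs_ite, runs_seq, runs_asg, Exp.Safe, Exp.eval, exactValue, Fits,
    Exp.cost, Env.set_v, Env.set_arr, reduceCtorEq, if_true, if_false, hℓ, hr, hzero, hone, htwo,
    hthree, hfour, hid, hlt.ne, ← hJ, ← hi, ← two_mul, true_and, and_true]
  have hlt' := hmin.lt
  dsimp only at hmin hlt'
  set row := blockId t w f J * (2 * t) + i
  have : row ≤ row * (2 * t) := Nat.le_mul_of_pos_right _ (by omega)
  exact ⟨absurd rfl, fun _ => ⟨by omega, by omega, by omega, by omega, by omega, by omega, by omega,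
    by omega, by norm_num, _, hmin, by omega⟩⟩

end Query

/-- The program has no `store` instruction. -/
def NoStore : Prog → Prop
  | .instr (.store _ _) => False
  | .instr _ => True
  | .seq p q => NoStore p ∧ NoStore q
  | .ite _ p q => NoStore p ∧ NoStore q
  | .while _ p => NoStore p

theorem NoStore.mem_eq {W : ℕ} {p : Prog} {z z' : State} {t : ℕ} (h : Exec W p z z' t) :
    NoStore p → z'.mem = z.mem := by
  induction h with
  | instr i s => cases i <;> simp [NoStore, Instr.exec]
  | seq _ _ hp hq => exact fun h => (hq h.2).trans (hp h.1)
  | ite_nonzero _ _ hp => exact fun h => hp h.1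
  | ite_zero _ _ hq => exact fun h => hq h.2
  | while_zero => exact fun _ => rfl
  | while_nonzero _ _ _ hp hw => exact fun h => (hw h).trans (hp h)

theorem noStore_queryCmd_compile : NoStore queryCmd.compile := by
  simp [queryCmd, Cmd.compile, Exp.compile, NoStore]

theorem answersMinSuf_of_runs {W size τ : ℕ} {A : ℕ → ℕ} {T : List ℕ} (hsize : size ≤ 2 ^ W)
    (h : ∀ (s : Env QueryVar Unit) ℓ r, s.v .ℓ = ℓ → s.v .r = r → 1 ≤ ℓ → ℓ ≤ r → r ≤ T.length →
      r - ℓ + 1 ≤ τ → (∀ a < size, s.arr () a = A a) →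
      Runs ⟨W, size⟩ queryCmd s fun s' t => t ≤ 100 ∧
        ∃ b, IsMinStart (T.getD · 0) (ℓ - 1) r b ∧ s'.v .ℓ = r - b) :
    AnswersMinSuf W queryCmd.compile A size T τ 100 := by
  intro ℓ r hℓ hℓr hr hτ M hM
  set z : State := ⟨inputRegs ℓ r, M⟩
  set s : Env QueryVar Unit := ⟨fun x => z.regs (varReg x), fun _ => M⟩
  have hrepr : Represents ⟨W, size⟩ z s :=
    ⟨fun _ => rfl, fun () => (Nat.zero_mul size).symm,
      fun _ _ _ => by simp [baseAddr, z, s]⟩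
  obtain ⟨s', t, he, ht, b, hb, hv⟩ := h s ℓ r rfl rfl hℓ hℓr hr hτ hM
  obtain ⟨z', hz, hz'⟩ := he.exec_compile (by simpa [Dims.words] using hsize) _ hrepr
  obtain ⟨u, hu, hlen⟩ := hb.isMinSuf hr
  exact ⟨z', t, hz, ht, NoStore.mem_eq hz noStore_queryCmd_compile, u, hu,
    (hz'.var .ℓ).trans (hv.trans hlen)⟩

end ArrayLang

/-! ### The construction on the word RAM -/

namespace ArrayLang

open WordRAM

/-- The program that stores the multiples `0, a, …, m * a` of the contents `a` of register `0` in
the registers `d, …, d + m`. It computes the addresses of the arrays from the length of the text. -/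
def multiplesProg (d : ℕ) : ℕ → Prog
  | 0 => .instr (.const d 0)
  | m + 1 => .seq (multiplesProg d m) (.instr (.op .add (d + (m + 1)) (d + m) 0))

theorem exec_multiplesProg {W d : ℕ} (hd : 0 < d) (z : State) :
    ∀ m, m * z.regs 0 < 2 ^ W → ∃ z', Exec W (multiplesProg d m) z z' (m + 1) ∧ z'.mem = z.mem ∧
      (∀ x < d, z'.regs x = z.regs x) ∧ ∀ k ≤ m, z'.regs (d + k) = k * z.regs 0
  | 0, _ => ⟨_, .instr _ _, rfl, fun x hx => Function.update_of_ne hx.ne _ _, fun k hk => by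
      simp [Instr.exec, Nat.le_zero.1 hk]⟩
  | m + 1, hm => by
    obtain ⟨z', he, hmem, hlow, hmul⟩ :=
      exec_multiplesProg hd z m ((Nat.mul_le_mul_right _ m.le_succ).trans_lt hm)
    refine ⟨_, he.seq (.instr _ _), hmem, fun x hx => ?_, fun k hk => ?_⟩
    · exact (Function.update_of_ne (by omega) _ _).trans (hlow x hx)
    rcases hk.lt_or_eq with hk | rfl
    · exact (Function.update_of_ne (by omega) _ _).trans (hmul k (by omega))
    · simp only [Instr.exec, Function.update_self, Op.eval, hmul m le_rfl, hlow 0 hd]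
      rw [← Nat.succ_mul, Nat.mod_eq_of_lt hm]

/-- The construction program for the word RAM. -/
def buildProg : Prog :=
  .seq (multiplesProg (FinEnum.card Var) 6) buildCmd.compile

/-- The environment in which `buildCmd` starts. -/
def buildEnv (T : List ℕ) (τ : ℕ) : Env Var Arr :=
  ⟨fun x => inputRegs T.length τ (varReg x), fun k => if k = .text then (T.getD · 0) else 0⟩

section Build

variable {W τ c : ℕ} {T : List ℕ}

theorem represents_buildEnv {z : State} (hmem : z.mem = (buildInput T τ).mem)
    (hvar : ∀ x < FinEnum.card Var, z.regs x = (buildInput T τ).regs x)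
    (hbase : ∀ k ≤ 6, z.regs (FinEnum.card Var + k) = k * T.length) :
    Represents ⟨W, T.length⟩ z (buildEnv T τ) where
  var x := hvar _ (varReg_lt x)
  base k := hbase _ (Nat.lt_succ_iff.1 (FinEnum.equiv k).isLt)
  arr k i _ := by
    rw [hmem]
    by_cases hk : k = .text
    · subst hk
      exact congrArg (T.getD · 0) (show 0 * T.length + i = i by omega)
    · have hpos : 1 ≤ (FinEnum.equiv k : ℕ) := by
        revert hk
        cases k <;> decide
      have : 1 * T.length ≤ baseAddr ⟨W, T.length⟩ k := Nat.mul_le_mul_right _ hpos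
      exact (List.getD_eq_default _ _ (by omega)).trans
        (congrFun (if_neg hk : (buildEnv T τ).arr k = 0) i).symm

theorem exec_buildProg_of_runs {Q : Env Var Arr → ℕ → Prop} (hW : 8 * T.length ≤ 2 ^ W)
    (h : Runs ⟨W, T.length⟩ buildCmd (buildEnv T τ) Q) :
    ∃ z s t, Exec W buildProg (buildInput T τ) z (7 + t) ∧
      Represents ⟨W, T.length⟩ z s ∧ Q s t := by
  have hpos : 0 < 2 ^ W := by positivity
  obtain ⟨z, hz, hmem, hvar, hbase⟩ := exec_multiplesProg (W := W) (d := FinEnum.card Var)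
    (by decide) (buildInput T τ) 6 (show 6 * T.length < 2 ^ W by omega)
  obtain ⟨s, t, he, hq⟩ := h
  obtain ⟨z', hz', hr⟩ := he.exec_compile (show 7 * T.length ≤ 2 ^ W by omega) _
    (represents_buildEnv hmem hvar hbase)
  exact ⟨z', s, t, hz.seq hz', hr, hq⟩

theorem exec_buildProg_of_lt_two (hW : 8 * T.length ≤ 2 ^ W) (hT : 0 < T.length) (hτ : τ < 2) :
    ∃ z t, Exec W buildProg (buildInput T τ) z t ∧ t ≤ 17 ∧ z.regs 0 = 0 ∧
      AnswersMinSuf W queryCmd.compile z.mem (z.regs 0) T τ 100 := by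
  obtain ⟨z, s, t, hz, hr, ht, hn⟩ := exec_buildProg_of_runs hW
    (runs_buildCmd_of_lt_two (s := buildEnv T τ) (show 2 < 2 ^ W by omega) hτ)
  have hsize : z.regs 0 = 0 := (hr.var .n).trans hn
  refine ⟨z, 7 + t, hz, by omega, hsize, answersMinSuf_of_runs (by omega) ?_⟩
  intro s ℓ r hℓ hr hpos _ _ hlen _
  obtain rfl : ℓ = r := by omega
  exact runs_queryCmd_of_eq (show 1 < 2 ^ W by omega) hℓ hr hpos

theorem hasText_buildEnv (hW : 8 * T.length ≤ 2 ^ W) (hT : 2 ≤ T.length)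
    (hx : ∀ x ∈ T, x < 2 ^ W) :
    HasText ⟨W, T.length⟩ (T.getD · 0) (buildEnv T τ) :=
  ⟨rfl, hT, hW, fun _ _ => rfl, fun p hp => by
    rw [List.getD_eq_getElem _ _ hp]
    exact hx _ (List.getElem_mem hp)⟩

theorem exec_buildProg_of_two_le {t w : ℕ} (hW : 8 * T.length ≤ 2 ^ W)
    (hx : ∀ x ∈ T, x < T.length ^ c ∧ x < 2 ^ W) (hτ : 2 ≤ τ) (ht : t = 2 ^ Nat.clog 2 τ)
    (hw : w = Nat.clog 2 τ + 2) (hle : (2 ^ (2 * t * w)) ^ 4 ≤ T.length) :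
    ∃ z u g, Exec W buildProg (buildInput T τ) z u ∧ u ≤ 1000 * (c + 1) * T.length ∧
      Params T.length t w g ∧ z.regs 0 = dataSize T.length t w g ∧
      AnswersMinSuf W queryCmd.compile z.mem (z.regs 0) T τ 100 := by
  have hT : 2 ≤ T.length := by
    have htwo : 2 ^ 1 ≤ 2 ^ (2 * t * w) :=
      Nat.pow_le_pow_right two_pos (Nat.succ_le_of_lt (by subst ht hw; positivity))
    exact (htwo.trans (Nat.le_self_pow four_ne_zero _)).trans hle
  obtain ⟨z, s, u, hz, hr, hu, g, hP, hA, hn⟩ := exec_buildProg_of_runs hW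
    (runs_buildCmd (hasText_buildEnv (τ := τ) hW hT fun x hxT => (hx x hxT).2)
      (fun p hp => List.getD_eq_default _ _ hp)
      (fun p hp => by rw [List.getD_eq_getElem _ _ hp]; exact (hx _ (List.getElem_mem hp)).1)
      (fun k hk => if_neg hk) rfl hτ ht hw hle)
  have hsize : z.regs 0 = dataSize T.length t w g := (hr.var .n).trans hn
  have hfit := hP.dataSize_le
  dsimp only at hfit
  refine ⟨z, 7 + u, g, hz, ?_, hP, hsize, ?_⟩
  · nlinarith
  rw [hsize]
  refine answersMinSuf_of_runs (by omega) ?_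
  intro s' ℓ r hℓ hr' hpos hℓr hrn hlen hM
  rcases hℓr.eq_or_lt with rfl | hlt
  · exact runs_queryCmd_of_eq (show 1 < 2 ^ W by omega) hℓ hr' hpos
  refine runs_queryCmd_of_lt (n := T.length) hW rfl hP (hA.congr fun a ha => ?_) hℓ hr' hpos hlt hrn
    (hlen.trans (ht ▸ Nat.le_pow_clog one_lt_two τ))
  rw [hM a ha, ← hr.arr .text a (ha.trans_le hfit)]
  exact congrArg z.mem (show a = 0 * T.length + a by omega)

end Build

end ArrayLang

/-! ### Asymptotics -/

section Asymptotics

open Filter Real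

theorem pow_clog_lt_mul_self {b x : ℕ} (hb : 1 < b) (hx : 0 < x) : b ^ Nat.clog b x < b * x := by
  rcases Nat.eq_or_lt_of_le hx with rfl | hx
  · simpa using hb
  have hpred := Nat.mul_lt_mul_of_pos_left (Nat.pow_pred_clog_lt_self hb hx) (zero_lt_one.trans hb)
  rwa [← Nat.pow_succ', Nat.succ_pred_eq_of_pos (Nat.clog_pos hb hx)] at hpred

theorem clog_add_two_mul_log_two_le {x : ℕ} (hx : 2 ≤ x) :
    ((Nat.clog 2 x + 2 : ℕ) : ℝ) * log 2 ≤ 4 * log x := by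
  have hpow : 2 ^ (Nat.clog 2 x + 2) ≤ x ^ 4 := by
    have hclog := pow_clog_lt_mul_self one_lt_two (two_pos.trans_le hx)
    have hcube : 2 ^ 3 * x ≤ x ^ 3 * x := Nat.mul_le_mul_right _ (Nat.pow_le_pow_left hx 3)
    rw [pow_add, pow_succ x 3]
    omega
  have hlog : log (2 ^ (Nat.clog 2 x + 2)) ≤ log ((x : ℝ) ^ 4) :=
    log_le_log (by positivity) (by exact_mod_cast hpow)
  simpa only [log_pow, Nat.cast_ofNat] using hlog

theorem isLittleO_mul_log {τ : ℕ → ℕ}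
    (h : (fun n => (τ n : ℝ)) =o[atTop] fun n : ℕ => log n / log (log n)) :
    (fun n => τ n * log (τ n)) =o[atTop] fun n : ℕ => log n := by
  have hlog : Tendsto (fun n : ℕ => log n) atTop atTop :=
    tendsto_log_atTop.comp tendsto_natCast_atTop_atTop
  have hloglog := (tendsto_log_atTop.comp hlog).eventually_ge_atTop 1
  have hmul : (fun n => τ n * log (log n)) =o[atTop] fun n : ℕ => log n :=
    (h.mul_isBigO (Asymptotics.isBigO_refl (fun n : ℕ => log (log n)) _)).congr'
      EventuallyEq.rfl (hloglog.mono fun n hn => div_mul_cancel₀ _ (zero_lt_one.trans_le hn).ne')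
  refine (Asymptotics.IsBigO.of_bound' ?_).trans_isLittleO hmul
  filter_upwards [h.def one_pos, hlog.eventually_ge_atTop 0, hloglog] with n hτ hpos hone
  have hone : 1 ≤ log (log n) := hone
  rcases (τ n).eq_zero_or_pos with hzero | hτpos
  · simp [hzero]
  rw [norm_natCast, norm_of_nonneg (by positivity), one_mul] at hτ
  rw [norm_of_nonneg (by positivity), norm_of_nonneg (by positivity)]
  have hle : (τ n : ℝ) ≤ log n := hτ.trans (div_le_self hpos hone)
  gcongr

theorem eventually_two_pow_le {τ : ℕ → ℕ}
    (h : (fun n => (τ n : ℝ)) =o[atTop] fun n : ℕ => log n / log (log n)) :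
    ∀ᶠ n in atTop, 2 ≤ τ n →
      (2 ^ (2 * 2 ^ Nat.clog 2 (τ n) * (Nat.clog 2 (τ n) + 2))) ^ 4 ≤ n := by
  filter_upwards [(isLittleO_mul_log h).def (show (0 : ℝ) < 1 / 64 by norm_num),
    eventually_gt_atTop 0] with n hn hpos hτ
  have hw := clog_add_two_mul_log_two_le hτ
  have ht : ((2 ^ Nat.clog 2 (τ n) : ℕ) : ℝ) ≤ 2 * τ n := by
    exact_mod_cast (pow_clog_lt_mul_self one_lt_two (two_pos.trans_le hτ)).le
  generalize 2 ^ Nat.clog 2 (τ n) = t at *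
  generalize Nat.clog 2 (τ n) + 2 = w at *
  rw [norm_of_nonneg (by positivity), norm_of_nonneg (by positivity)] at hn
  have hlog : log (((2 : ℝ) ^ (2 * t * w)) ^ 4) ≤ log n :=
    calc log (((2 : ℝ) ^ (2 * t * w)) ^ 4) = 8 * (t * (w * log 2)) := by
          rw [log_pow, log_pow]
          push_cast
          ring
      _ ≤ 8 * (2 * τ n * (4 * log (τ n))) := by gcongr
      _ ≤ log n := by linarith
  exact_mod_cast (log_le_log_iff (by positivity) (by positivity)).1 hlog

theorem sqrt_le_two_mul_div_log {x : ℝ} (hx : 1 < x) : √x ≤ 2 * (x / log x) := by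
  have hlog : log x ≤ 2 * √x := by
    have := log_le_rpow_div (zero_le_one.trans hx.le) (ε := 1 / 2) (by norm_num)
    rw [← sqrt_eq_rpow] at this
    linarith
  rw [mul_div_assoc', le_div_iff₀ (log_pos hx)]
  calc √x * log x ≤ √x * (2 * √x) := by gcongr
    _ = 2 * x := by rw [mul_left_comm, mul_self_sqrt (zero_le_one.trans hx.le)]

namespace Params

variable {n t w g : ℕ}

theorem tableSize_sq_le (h : Params n t w g) : tableSize t w ^ 2 ≤ n := by
  have hsq : 2 * t * (2 * t) ≤ 2 ^ (2 * t * w) :=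
    calc 2 * t * (2 * t) ≤ 4 * t * (4 * t) := Nat.mul_le_mul (by omega) (by omega)
      _ = (4 * t) ^ 2 := (sq _).symm
      _ ≤ (4 * t) ^ 4 := Nat.pow_le_pow_right (by have := h.two_le; omega) (by norm_num)
      _ ≤ 2 ^ (2 * t * w) := h.pow_four_le_two_pow
  calc tableSize t w ^ 2 ≤ (2 ^ (2 * t * w) * 2 ^ (2 * t * w)) ^ 2 := by
        rw [tableSize, mul_assoc]
        gcongr
    _ = (2 ^ (2 * t * w)) ^ 4 := by ring
    _ ≤ n := h.pow_four_le

theorem log_le (h : Params n t w g) : log n ≤ 4 * (t * g) * (w * log 2) := by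
  have hn : (n : ℝ) ≤ 2 ^ (2 * t * w * (g + 1)) := by
    rw [pow_mul]
    exact_mod_cast h.lt.le
  have hpos : (0 : ℝ) < n := by exact_mod_cast (Nat.zero_le _).trans_lt h.t_lt
  have hg : ((g + 1 : ℕ) : ℝ) ≤ 2 * g := by
    have := h.g_pos
    exact_mod_cast (show g + 1 ≤ 2 * g by omega)
  calc log n ≤ log (2 ^ (2 * t * w * (g + 1))) := log_le_log hpos hn
    _ = 2 * t * ((g + 1 : ℕ) * (w * log 2)) := by
      rw [log_pow]
      push_cast
      ring
    _ ≤ 2 * t * (2 * g * (w * log 2)) := by gcongr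
    _ = 4 * (t * g) * (w * log 2) := by ring

theorem cast_wordCount_le {τ : ℕ} (h : Params n t w g) (hτ : 2 ≤ τ) (hw : w = Nat.clog 2 τ + 2) :
    (wordCount n t g : ℝ) ≤ 16 * (n * log τ / log n) + 1 := by
  have hone : 1 < n := by have := h.t_lt; have := h.two_le; omega
  have htg : (0 : ℝ) < t * g := by
    have := h.two_le
    exact_mod_cast Nat.mul_pos (by omega) h.g_pos
  have hblocks : (n : ℝ) / (t * g) ≤ 16 * (n * log τ / log n) := by
    rw [mul_div_assoc', div_le_div_iff₀ htg (log_pos (by exact_mod_cast hone))]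
    calc n * log n ≤ n * (4 * (t * g) * (4 * log τ)) := by
          gcongr
          exact h.log_le.trans (mul_le_mul_of_nonneg_left
            (hw ▸ clog_add_two_mul_log_two_le hτ) (by positivity))
      _ = 16 * (n * log τ) * (t * g) := by ring
  rw [wordCount, Nat.div_div_eq_div_mul, Nat.cast_succ]
  have hdiv : ((n / (t * g) : ℕ) : ℝ) ≤ n / (t * g) := by exact_mod_cast Nat.cast_div_le
  linarith

theorem cast_tableSize_le {τ : ℕ} (h : Params n t w g) (hτ : 2 ≤ τ) :
    (tableSize t w : ℝ) ≤ 4 * (n * log τ / log n) := by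
  have hone : (1 : ℝ) < n := by
    have := h.t_lt
    have := h.two_le
    exact_mod_cast (show 1 < n by omega)
  have hlog : 1 ≤ 2 * log τ := by
    have hmono : log 2 ≤ log τ := log_le_log two_pos (by exact_mod_cast hτ)
    linarith [log_two_gt_d9]
  calc (tableSize t w : ℝ) ≤ √n := le_sqrt_of_sq_le (by exact_mod_cast h.tableSize_sq_le)
    _ ≤ 2 * (n / log n) := sqrt_le_two_mul_div_log hone
    _ ≤ 2 * (n / log n) * (2 * log τ) :=
      le_mul_of_one_le_right (mul_nonneg two_pos.le (div_nonneg n.cast_nonneg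
        (log_natCast_nonneg n))) hlog
    _ = 4 * (n * log τ / log n) := by ring

theorem cast_dataSize_le {τ : ℕ} (h : Params n t w g) (hτ : 2 ≤ τ) (hw : w = Nat.clog 2 τ + 2) :
    (dataSize n t w g : ℝ) ≤ 24 * (n * log τ / log n) := by
  have hwords := h.cast_wordCount_le hτ hw
  have htable := h.cast_tableSize_le hτ
  have hsix : (6 : ℝ) ≤ tableSize t w := by
    have := h.two_le
    have : 1 * 4 * 4 ≤ tableSize t w :=
      Nat.mul_le_mul (Nat.mul_le_mul Nat.one_le_two_pow (by omega)) (by omega)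
    exact_mod_cast (show 6 ≤ tableSize t w by omega)
  rw [dataSize, tableStart]
  push_cast
  linarith

end Params

end Asymptotics

theorem AnswersMinSuf.mono {W size τ a b : ℕ} {query : WordRAM.Prog} {A : ℕ → ℕ} {T : List ℕ}
    (h : AnswersMinSuf W query A size T τ a) (hab : a ≤ b) : AnswersMinSuf W query A size T τ b :=
  fun ℓ r hℓ hℓr hr hlen M hM =>
    let ⟨q, t, hq, ht, hrest⟩ := h ℓ r hℓ hℓr hr hlen M hM
    ⟨q, t, hq, ht.trans hab, hrest⟩

theorem ArrayLang.exec_buildProg {W τ c : ℕ} {T : List ℕ} (hW : 8 * T.length ≤ 2 ^ W)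
    (hT : 0 < T.length) (hx : ∀ x ∈ T, x < T.length ^ c ∧ x < 2 ^ W)
    (hle : 2 ≤ τ → (2 ^ (2 * 2 ^ Nat.clog 2 τ * (Nat.clog 2 τ + 2))) ^ 4 ≤ T.length) :
    ∃ z t, WordRAM.Exec W buildProg (WordRAM.buildInput T τ) z t ∧ t ≤ 1000 * (c + 1) * T.length ∧
      (z.regs 0 : ℝ) ≤ 24 * (T.length * Real.log τ / Real.log T.length) ∧
      AnswersMinSuf W queryCmd.compile z.mem (z.regs 0) T τ 100 := by
  rcases Nat.lt_or_ge τ 2 with hτ | hτ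
  · obtain ⟨z, t, hz, ht, hsize, hA⟩ := exec_buildProg_of_lt_two hW hT hτ
    refine ⟨z, t, hz, by nlinarith, ?_, hA⟩
    rw [hsize, Nat.cast_zero]
    positivity
  · obtain ⟨z, t, g, hz, ht, hP, hsize, hA⟩ := exec_buildProg_of_two_le hW hx hτ rfl rfl (hle hτ)
    exact ⟨z, t, hz, ht, hsize ▸ hP.cast_dataSize_le hτ rfl, hA⟩

/-- The programs `build` and `query` are fixed. The word size satisfies `W ≥ log₂ n + O(1)`, letters
are words and belong to an alphabet of size at most `n ^ c`. Register `0` holds the size of the data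
structure, in words, when `build` halts; the data structure occupies that many initial cells. -/
theorem mainTheorem7 :
    ∃ (build query : WordRAM.Prog) (K : ℕ), ∀ c : ℕ, ∃ C : ℕ, ∀ τ : ℕ → ℕ,
      Asymptotics.IsLittleO Filter.atTop (fun n : ℕ => (τ n : ℝ))
        (fun n : ℕ => Real.log n / Real.log (Real.log n)) →
      ∃ n₀ : ℕ, ∀ n : ℕ, n₀ ≤ n → ∀ W : ℕ, K * n ≤ 2 ^ W →
        ∀ T : List ℕ, T.length = n → (∀ x ∈ T, x < n ^ c ∧ x < 2 ^ W) →
          ∃ (D : WordRAM.State) (t : ℕ),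
            WordRAM.Exec W build (WordRAM.buildInput T (τ n)) D t ∧
            t ≤ C * n ∧
            (D.regs 0 : ℝ) ≤ C * (n * Real.log (τ n) / Real.log n) ∧
            AnswersMinSuf W query D.mem (D.regs 0) T (τ n) C := by
  refine ⟨ArrayLang.buildProg, ArrayLang.queryCmd.compile, 8, fun c => ⟨1000 * (c + 1),
    fun τ hτ => ?_⟩⟩
  obtain ⟨n₀, hn₀⟩ := Filter.eventually_atTop.1 (eventually_two_pow_le hτ)
  refine ⟨max n₀ 1, fun n hn W hW T hT hx => ?_⟩
  obtain ⟨hn₀n, hpos⟩ := max_le_iff.1 hn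
  subst hT
  obtain ⟨z, t, hz, ht, hsize, hA⟩ := ArrayLang.exec_buildProg hW hpos hx (hn₀ _ hn₀n)
  have hC : (24 : ℝ) ≤ (1000 * (c + 1) : ℕ) := by exact_mod_cast (show 24 ≤ 1000 * (c + 1) by omega)
  exact ⟨z, t, hz, ht, hsize.trans (mul_le_mul_of_nonneg_right hC (by positivity)),
    hA.mono (by omega)⟩
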